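/- Let $q\in(0,1)$, $c\in[0,\infty]$, $\lambda:=q-q^{-1}$, $[x]:=(q^x-q^{-x})/(q-q^{-1})$. Put $s:=1,\ \kappa:=c$ if $c<\infty$ and $s:=0,\ \kappa:=1$ if $c=\infty$. Let $\mathcal{O}(S^2_{qc})\rtimes\mathcal{U}_q(\mathrm{su}_2)$ be the unital complex $*$-algebra with generators $A=A^*,B,B^*,E,F=E^*,K=K^*,K^{-1}$ and the relations $$KK^{-1}=K^{-1}K=1,\quad KE=qEK,\quad FK=qKF,\quad EF-FE=\lambda^{-1}(K^2-K^{-2}),$$ $$AB=q^{-2}BA,\quad AB^*=q^2B^*A,\quad B^*B=sA-A^2+\kappa,\quad BB^*=sq^2A-q^4A^2+\kappa,$$ $$KA=AK,\quad EA=AE+q^{-1/2}B^*K,\quad FA=AF-q^{-3/2}BK,$$ $$KB=q^{-1}BK,\quad EB=qBE-q^{1/2}(1+q^2)AK+sq^{1/2}K,\quad FB=qBF,$$ $$KB^*=qB^*K,\quad EB^*=q^{-1}B^*E,\quad FB^*=q^{-1}B^*F+q^{-1/2}(1+q^2)AK-sq^{-1/2}K .$$ Set $x_1:=-(1+q^2)^{1/2}B^*$,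 $x_0:=s-(1+q^2)A$, $x_{-1}:=q^{-1}(1+q^2)^{1/2}B$. A $*$-representation on a pre-Hilbert space $D$ (a dense domain in the completion of $D$) is a unital homomorphism $\pi$ into the linear operators on $D$ with $\langle\pi(a)\xi,\eta\rangle=\langle\xi,\pi(a^*)\eta\rangle$; unitary equivalence means intertwining by an isometric linear bijection of the domains. Fix $l_0\in\frac12\mathbb{N}_0$. We say that $\pi$ satisfies $(*)$ if its restriction to $\mathcal{U}_q(\mathrm{su}_2)$ is the (algebraic) orthogonal direct sum $\bigoplus_{n\ge0}T_{l_0+n}$ of the spin $l$ representations $T_l$, i.e. $D$ is the linear span of orthonormal vectors $v^l_j$, $l\in l_0+\mathbb{N}_0$, $j=-l,-l+1,\dots,l$, with $$Kv^l_j=q^jv^l_j,\quad Ev^l_j=[l-j]^{1/2}[l+j+1]^{1/2}v^l_{j+1},\quad Fv^l_j=[l-j+1]^{1/2}[l+j]^{1/2}v^l_{j-1}.$$ **Theorem.** (i) There are $*$-representations $\pi_+,\pi_-$ satisfying $(*)$, on the same space with the same vectors $v^l_j$, for which (with vectors outside the index range read as $0$, together with their coefficients) $$\begin{aligned}x_1v^l_j={}&q^{-l+j}[l{+}j{+}1]^{1/2}[l{+}j{+}2]^{1/2}[2l{+}1]^{-1/2}[2l{+}2]^{-1/2}\alpha^+(l,l)_\pm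 v^{l+1}_{j+1}\\&-q^{j+2}[l{-}j]^{1/2}[l{+}j{+}1]^{1/2}[2]^{1/2}[2l]^{-1}\beta^0(l,l)_\pm v^l_{j+1}\\&-q^{l+j+1}[l{-}j{-}1]^{1/2}[l{-}j]^{1/2}[2l{-}1]^{-1/2}[2l]^{-1/2}\alpha^+(l{-}1,l{-}1)_\pm v^{l-1}_{j+1},\end{aligned}$$ $$\begin{aligned}x_0v^l_j={}&q^{j}[l{-}j{+}1]^{1/2}[l{+}j{+}1]^{1/2}[2]^{1/2}[2l{+}1]^{-1/2}[2l{+}2]^{-1/2}\alpha^+(l,l)_\pm v^{l+1}_{j}\\&+\big(1-q^{l+j+1}[l{-}j][2][2l]^{-1}\big)\beta^0(l,l)_\pm v^l_{j}\\&+q^{j}[l{-}j]^{1/2}[l{+}j]^{1/2}[2]^{1/2}[2l{-}1]^{-1/2}[2l]^{-1/2}\alpha^+(l{-}1,l{-}1)_\pm v^{l-1}_{j},\end{aligned}$$ $$\begin{aligned}x_{-1}v^l_j={}&q^{l+j}[l{-}j{+}1]^{1/2}[l{-}j{+}2]^{1/2}[2l{+}1]^{-1/2}[2l{+}2]^{-1/2}\alpha^+(l,l)_\pm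 v^{l+1}_{j-1}\\&+q^{j}[l{-}j{+}1]^{1/2}[l{+}j]^{1/2}[2]^{1/2}[2l]^{-1}\beta^0(l,l)_\pm v^l_{j-1}\\&-q^{-l+j-1}[l{+}j{-}1]^{1/2}[l{+}j]^{1/2}[2l{-}1]^{-1/2}[2l]^{-1/2}\alpha^+(l{-}1,l{-}1)_\pm v^{l-1}_{j-1}\end{aligned}$$ (for $l=j=0$ the terms with $[2l]^{-1}$ are read as $0$). Here, for $c<\infty$ and $\lambda_\pm:=\frac12\pm(c+\frac14)^{1/2}$, $$\beta^0(l,l)_\pm=[2l{+}2]^{-1}\big([2l_0](q^{-2}\lambda_\pm-\lambda_\mp)-(1-q^{-2})[l{-}l_0][l{+}l_0{+}1]\big),$$ $$\alpha^+(l,l)_\pm=[2]^{1/2}[2l{+}3]^{-1/2}[2l{+}2]^{-1/2}\Big([2l{+}2]^2(c+\tfrac14)-\big\{-\tfrac{\lambda}{2}[l{-}l_0{+}1][l{+}l_0{+}1]\pm[2l_0](c+\tfrac14)^{1/2}\big\}^2\Big)^{1/2},$$ and for $c=\infty$ $$\beta^0(l,l)_\pm=\pm q^{-1}[2][2l_0][2l{+}2]^{-1},\qquad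 \alpha^+(l,l)_\pm=[2]^{1/2}[2l{+}3]^{-1/2}[2l{+}2]^{-1/2}\big([2l{+}2]^2-[2l_0]^2\big)^{1/2}.$$ (ii) $\pi_+$ and $\pi_-$ are irreducible (their domain has no invariant subspaces except $\{0\}$ and itself). (iii) Every $*$-representation satisfying $(*)$ is unitarily equivalent to $\pi_+$ or to $\pi_-$. (iv) If $l_0>0$, then $\pi_+$ and $\pi_-$ are not unitarily equivalent, so there are exactly two classes. If $l_0=0$, then $\pi_+=\pi_-$ is, up to unitary equivalence, the only one, and it is the Heisenberg representation: the one on $\mathcal{O}(S^2_{qc})$ (modulo null vectors) with inner product $\langle x,y\rangle=h(x^*y)$, $h$ a $\mathcal{U}_q(\mathrm{su}_2)$-invariant state, where $\mathcal{O}(S^2_{qc})$ acts by left multiplication and $\mathcal{U}_q(\mathrm{su}_2)$ by its left action $f\triangleright x$. (v) More generally, if a $*$-representation on any $D$ is such that $D$ contains orthonormal vectors $v^l_j$ with dense linear span on which $E,F,K$ act as above, then after replacing $v^l_j$ by $\theta_l v^l_j$ with suitable $\theta_l\in\mathbb{C}$, $|\theta_l|=1$, the formulas for $x_1,x_0,x_{-1}$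 hold with one of the two signs. -/

import Mathlib

open scoped ENNReal InnerProductSpace

noncomputable section

namespace PodlesCross

/-- `[x] = (q^x - q^(-x)) / (q - q⁻¹)`. -/
def qnum (q x : ℝ) : ℝ := (q ^ x - q ^ (-x)) / (q - q⁻¹)

/-! ### The cross product `*`-algebra -/

/-- The generators `A, B, B*, E, F, K, K⁻¹`. -/
inductive Gen : Type
  | A | B | Bs | E | F | K | Ki

/-- Coefficient of the linear terms in the relations of the Podles sphere:
`1` for `c < ∞` and `0` for `c = ∞`. -/
def linCoeff (c : ℝ≥0∞) : ℝ := if c = ⊤ then 0 else 1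

/-- Constant term in the relations of the Podles sphere: `c` for `c < ∞` and `1` for `c = ∞`. -/
def constCoeff (c : ℝ≥0∞) : ℝ := if c = ⊤ then 1 else c.toReal

/-- A generator as an element of the free algebra. -/
def fgen (g : Gen) : FreeAlgebra ℂ Gen := FreeAlgebra.ι ℂ g

/-- The defining relations of `O(S²_{qc}) ⋊ U_q(su₂)`, for all `c ∈ [0,∞]` at once. -/
inductive Rel (q : ℝ) (c : ℝ≥0∞) : FreeAlgebra ℂ Gen → FreeAlgebra ℂ Gen → Prop
  -- the quantized enveloping algebra
  | K_Ki : Rel q c (fgen .K * fgen .Ki) 1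
  | Ki_K : Rel q c (fgen .Ki * fgen .K) 1
  | K_E : Rel q c (fgen .K * fgen .E) ((q : ℂ) • (fgen .E * fgen .K))
  | F_K : Rel q c (fgen .F * fgen .K) ((q : ℂ) • (fgen .K * fgen .F))
  | E_F : Rel q c (fgen .E * fgen .F - fgen .F * fgen .E)
      ((((q - q⁻¹)⁻¹ : ℝ) : ℂ) • (fgen .K * fgen .K - fgen .Ki * fgen .Ki))
  -- the Podles sphere
  | A_B : Rel q c (fgen .A * fgen .B) ((((q ^ 2)⁻¹ : ℝ) : ℂ) • (fgen .B * fgen .A))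
  | A_Bs : Rel q c (fgen .A * fgen .Bs) (((q ^ 2 : ℝ) : ℂ) • (fgen .Bs * fgen .A))
  | Bs_B : Rel q c (fgen .Bs * fgen .B)
      ((linCoeff c : ℂ) • fgen .A - fgen .A * fgen .A + (constCoeff c : ℂ) • 1)
  | B_Bs : Rel q c (fgen .B * fgen .Bs)
      (((q ^ 2 * linCoeff c : ℝ) : ℂ) • fgen .A - ((q ^ 4 : ℝ) : ℂ) • (fgen .A * fgen .A)
        + (constCoeff c : ℂ) • 1)
  -- the cross relations
  | K_A : Rel q c (fgen .K * fgen .A) (fgen .A * fgen .K)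
  | E_A : Rel q c (fgen .E * fgen .A)
      (fgen .A * fgen .E + ((q ^ (-(1 / 2) : ℝ) : ℝ) : ℂ) • (fgen .Bs * fgen .K))
  | F_A : Rel q c (fgen .F * fgen .A)
      (fgen .A * fgen .F - ((q ^ (-(3 / 2) : ℝ) : ℝ) : ℂ) • (fgen .B * fgen .K))
  | K_B : Rel q c (fgen .K * fgen .B) (((q⁻¹ : ℝ) : ℂ) • (fgen .B * fgen .K))
  | E_B : Rel q c (fgen .E * fgen .B)
      ((q : ℂ) • (fgen .B * fgen .E)
        - ((q ^ (1 / 2 : ℝ) * (1 + q ^ 2) : ℝ) : ℂ) • (fgen .A * fgen .K)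
        + ((q ^ (1 / 2 : ℝ) * linCoeff c : ℝ) : ℂ) • fgen .K)
  | F_B : Rel q c (fgen .F * fgen .B) ((q : ℂ) • (fgen .B * fgen .F))
  | K_Bs : Rel q c (fgen .K * fgen .Bs) ((q : ℂ) • (fgen .Bs * fgen .K))
  | E_Bs : Rel q c (fgen .E * fgen .Bs) (((q⁻¹ : ℝ) : ℂ) • (fgen .Bs * fgen .E))
  | F_Bs : Rel q c (fgen .F * fgen .Bs)
      (((q⁻¹ : ℝ) : ℂ) • (fgen .Bs * fgen .F)
        + ((q ^ (-(1 / 2) : ℝ) * (1 + q ^ 2) : ℝ) : ℂ) • (fgen .A * fgen .K)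
        - ((q ^ (-(1 / 2) : ℝ) * linCoeff c : ℝ) : ℂ) • fgen .K)

/-- The range `(0,1)` of the deformation parameter. -/
abbrev QParam : Type := Set.Ioo (0 : ℝ) 1

/-- The cross product algebra `O(S²_{qc}) ⋊ U_q(su₂)`. -/
def CrossAlg (q : QParam) (c : ℝ≥0∞) : Type := RingQuot (Rel q c)

instance (q : QParam) (c : ℝ≥0∞) : Ring (CrossAlg q c) :=
  inferInstanceAs (Ring (RingQuot (Rel q c)))

instance (q : QParam) (c : ℝ≥0∞) : Algebra ℂ (CrossAlg q c) :=
  inferInstanceAs (Algebra ℂ (RingQuot (Rel q c)))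

/-- The quotient map from the free algebra. -/
def mk (q : QParam) (c : ℝ≥0∞) : FreeAlgebra ℂ Gen →ₐ[ℂ] CrossAlg q c :=
  RingQuot.mkAlgHom ℂ (Rel q c)

/-- The generators of the cross product algebra. -/
def gen (q : QParam) (c : ℝ≥0∞) (g : Gen) : CrossAlg q c := mk q c (fgen g)

theorem mk_fgen (q : QParam) (c : ℝ≥0∞) (g : Gen) : mk q c (fgen g) = gen q c g := rfl

theorem mk_rel {q : QParam} {c : ℝ≥0∞} {x y : FreeAlgebra ℂ Gen} (h : Rel q c x y) :
    mk q c x = mk q c y := RingQuot.mkAlgHom_rel ℂ h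

/-- Two algebra homomorphisms that agree on the generators are equal. -/
theorem crossAlg_hom_ext {q : QParam} {c : ℝ≥0∞} {R : Type*} [Ring R] [Algebra ℂ R]
    {f g : CrossAlg q c →ₐ[ℂ] R} (h : ∀ x, f (gen q c x) = g (gen q c x)) : f = g := by
  apply RingQuot.ringQuot_ext'
  apply FreeAlgebra.hom_ext
  funext x
  exact h x

/-! ### The involution -/

/-- The action of the involution on the generators:
`A, K, K⁻¹` are hermitian, `B ↔ B*`, `E ↔ F`. -/
def starGen : Gen → Gen
  | .A => .A
  | .B => .Bs
  | .Bs => .B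
  | .E => .F
  | .F => .E
  | .K => .K
  | .Ki => .Ki

/-- The opposite ring, to be viewed as a complex algebra through complex conjugation. -/
def ConjOp (R : Type*) : Type _ := Rᵐᵒᵖ

instance (R : Type*) [Ring R] : Ring (ConjOp R) := inferInstanceAs (Ring Rᵐᵒᵖ)

instance (R : Type*) [Ring R] [Algebra ℂ R] : Algebra ℂ (ConjOp R) :=
  RingHom.toAlgebra' (((algebraMap ℂ Rᵐᵒᵖ).comp (starRingEnd ℂ) : ℂ →+* Rᵐᵒᵖ)) (by
    intro z x
    exact Algebra.commutes (A := Rᵐᵒᵖ) (starRingEnd ℂ z) x)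

/-- The identity `R → ConjOp R`, as an additive equivalence. -/
def toConj (R : Type*) [Ring R] : R ≃+ ConjOp R := MulOpposite.opAddEquiv

theorem toConj_mul {R : Type*} [Ring R] (x y : R) :
    toConj R (x * y) = toConj R y * toConj R x := rfl

theorem toConj_one {R : Type*} [Ring R] : toConj R 1 = 1 := rfl

theorem toConj_add {R : Type*} [Ring R] (x y : R) :
    toConj R (x + y) = toConj R x + toConj R y := rfl

theorem toConj_sub {R : Type*} [Ring R] (x y : R) :
    toConj R (x - y) = toConj R x - toConj R y := rfl

theorem toConj_smul {R : Type*} [Ring R] [Algebra ℂ R] (z : ℂ) (x : R) :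
    toConj R (z • x) = (starRingEnd ℂ z) • toConj R x := by
  rw [Algebra.smul_def, Algebra.smul_def, toConj_mul,
    Algebra.commutes (A := ConjOp R) (starRingEnd ℂ z)]
  congr 1
  change MulOpposite.op (algebraMap ℂ R z)
    = MulOpposite.op (algebraMap ℂ R ((starRingEnd ℂ) ((starRingEnd ℂ) z)))
  simp

theorem smul_toConj {R : Type*} [Ring R] [Algebra ℂ R] (r : ℝ) (x : R) :
    (r : ℂ) • toConj R x = toConj R ((r : ℂ) • x) := by
  rw [toConj_smul, Complex.conj_ofReal]

/-- The involution on the free algebra, followed by the quotient map. -/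
def preStar (q : QParam) (c : ℝ≥0∞) : FreeAlgebra ℂ Gen →ₐ[ℂ] ConjOp (CrossAlg q c) :=
  FreeAlgebra.lift ℂ (fun g => toConj _ (gen q c (starGen g)))

theorem preStar_fgen (q : QParam) (c : ℝ≥0∞) (g : Gen) :
    preStar q c (fgen g) = toConj _ (gen q c (starGen g)) := by
  simp [preStar, fgen]

theorem preStar_rel (q : QParam) (c : ℝ≥0∞) {x y : FreeAlgebra ℂ Gen} (h : Rel q c x y) :
    preStar q c x = preStar q c y := by
  have hq : (0 : ℝ) < q := q.2.1
  have hq0 : (q : ℝ) ≠ 0 := hq.ne'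
  have hqc : ((q : ℝ) : ℂ) ≠ 0 := by exact_mod_cast hq0
  have p1 : (q : ℝ) ^ (-(3 / 2) : ℝ) = (q : ℝ) ^ (-(1 / 2) : ℝ) * (q : ℝ)⁻¹ := by
    rw [← Real.rpow_neg_one, ← Real.rpow_add hq]; norm_num
  have p2 : (q : ℝ) ^ (1 / 2 : ℝ) = (q : ℝ) ^ (-(1 / 2) : ℝ) * q := by
    nth_rewrite 3 [← Real.rpow_one (q : ℝ)]
    rw [← Real.rpow_add hq]; norm_num
  have r1 := mk_rel (Rel.K_Ki (q := q) (c := c))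
  have r2 := mk_rel (Rel.Ki_K (q := q) (c := c))
  have r3 := mk_rel (Rel.K_E (q := q) (c := c))
  have r4 := mk_rel (Rel.F_K (q := q) (c := c))
  have r5 := mk_rel (Rel.E_F (q := q) (c := c))
  have r6 := mk_rel (Rel.A_B (q := q) (c := c))
  have r7 := mk_rel (Rel.A_Bs (q := q) (c := c))
  have r8 := mk_rel (Rel.Bs_B (q := q) (c := c))
  have r9 := mk_rel (Rel.B_Bs (q := q) (c := c))
  have r10 := mk_rel (Rel.K_A (q := q) (c := c))
  have r11 := mk_rel (Rel.E_A (q := q) (c := c))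
  have r12 := mk_rel (Rel.F_A (q := q) (c := c))
  have r13 := mk_rel (Rel.K_B (q := q) (c := c))
  have r14 := mk_rel (Rel.E_B (q := q) (c := c))
  have r15 := mk_rel (Rel.F_B (q := q) (c := c))
  have r16 := mk_rel (Rel.K_Bs (q := q) (c := c))
  have r17 := mk_rel (Rel.E_Bs (q := q) (c := c))
  have r18 := mk_rel (Rel.F_Bs (q := q) (c := c))
  simp only [map_mul, map_add, map_sub, map_smul, map_one, mk_fgen] at r1 r2 r3 r4 r5 r6 r7 r8 r9
  simp only [map_mul, map_add, map_sub, map_smul, mk_fgen] at r10 r11 r12 r13 r14 r15 r16 r17 r18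
  have inv_l : ∀ (s t : CrossAlg q c), s = ((q : ℝ) : ℂ) • t → t = (((q : ℝ)⁻¹ : ℝ) : ℂ) • s := by
    rintro s t rfl
    rw [smul_smul, Complex.ofReal_inv, inv_mul_cancel₀ hqc, one_smul]
  have inv_r : ∀ (s t : CrossAlg q c), s = (((q : ℝ)⁻¹ : ℝ) : ℂ) • t → t = ((q : ℝ) : ℂ) • s := by
    rintro s t rfl
    rw [smul_smul, Complex.ofReal_inv, mul_inv_cancel₀ hqc, one_smul]
  cases h <;> simp only [map_mul, map_add, map_sub, map_smul, map_one, preStar_fgen, starGen] <;>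
    simp only [← toConj_mul, ← toConj_one, smul_toConj, ← toConj_add, ← toConj_sub] <;>
    refine congrArg (toConj _) ?_
  case K_Ki => exact r2
  case Ki_K => exact r1
  case K_E => exact r4
  case F_K => exact r3
  case E_F => exact r5
  case A_B =>
    rw [r7, smul_smul, ← Complex.ofReal_mul, inv_mul_cancel₀ (pow_ne_zero 2 hq0)]; simp
  case A_Bs =>
    rw [r6, smul_smul, ← Complex.ofReal_mul, mul_inv_cancel₀ (pow_ne_zero 2 hq0)]; simp
  case Bs_B => exact r8
  case B_Bs => exact r9
  case K_A => exact r10.symm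
  case E_A =>
    rw [r12, r13, p1, smul_smul, ← Complex.ofReal_mul]; simp
  case F_A =>
    rw [r11, r16, p1, smul_smul, ← Complex.ofReal_mul, mul_assoc, inv_mul_cancel₀ hq0]; simp
  case K_B => exact inv_l _ _ r16
  case E_B =>
    rw [r18, ← r10]
    simp only [smul_add, smul_sub, smul_smul, p2, ← Complex.ofReal_mul]
    rw [mul_inv_cancel₀ hq0, Complex.ofReal_one, one_smul,
      show (q : ℝ) * ((q : ℝ) ^ (-(1 / 2) : ℝ) * (1 + (q : ℝ) ^ 2))
        = (q : ℝ) ^ (-(1 / 2) : ℝ) * q * (1 + (q : ℝ) ^ 2) by ring,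
      show (q : ℝ) * ((q : ℝ) ^ (-(1 / 2) : ℝ) * linCoeff c)
        = (q : ℝ) ^ (-(1 / 2) : ℝ) * q * linCoeff c by ring]
    abel
  case F_B => exact inv_r _ _ r17
  case K_Bs => exact inv_r _ _ r13
  case E_Bs => exact inv_l _ _ r15
  case F_Bs =>
    rw [r14, ← r10]
    simp only [smul_add, smul_sub, smul_smul, p2, ← Complex.ofReal_mul]
    rw [inv_mul_cancel₀ hq0, Complex.ofReal_one, one_smul,
      show (q : ℝ)⁻¹ * ((q : ℝ) ^ (-(1 / 2) : ℝ) * q * (1 + (q : ℝ) ^ 2))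
        = (q : ℝ) ^ (-(1 / 2) : ℝ) * (1 + (q : ℝ) ^ 2) by field_simp,
      show (q : ℝ)⁻¹ * ((q : ℝ) ^ (-(1 / 2) : ℝ) * q * linCoeff c)
        = (q : ℝ) ^ (-(1 / 2) : ℝ) * linCoeff c by field_simp]
    abel

/-- The involution as an algebra homomorphism to the conjugate opposite algebra. -/
def starHom (q : QParam) (c : ℝ≥0∞) : CrossAlg q c →ₐ[ℂ] ConjOp (CrossAlg q c) :=
  RingQuot.liftAlgHom ℂ ⟨preStar q c, fun _ _ h => preStar_rel q c h⟩

theorem starHom_gen (q : QParam) (c : ℝ≥0∞) (g : Gen) :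
    starHom q c (gen q c g) = toConj _ (gen q c (starGen g)) := by
  rw [← preStar_fgen]
  exact RingQuot.liftAlgHom_mkAlgHom_apply ℂ (preStar q c) (fun _ _ h => preStar_rel q c h) _

instance (q : QParam) (c : ℝ≥0∞) : Star (CrossAlg q c) :=
  ⟨fun x => (toConj _).symm (starHom q c x)⟩

theorem star_def {q : QParam} {c : ℝ≥0∞} (x : CrossAlg q c) :
    star x = (toConj _).symm (starHom q c x) := rfl

theorem toConj_star {q : QParam} {c : ℝ≥0∞} (x : CrossAlg q c) :
    toConj _ (star x) = starHom q c x := by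
  rw [star_def, AddEquiv.apply_symm_apply]

theorem star_mul' {q : QParam} {c : ℝ≥0∞} (x y : CrossAlg q c) :
    star (x * y) = star y * star x := by
  apply (toConj _).injective
  rw [toConj_star, toConj_mul, toConj_star, toConj_star, map_mul]

theorem star_add' {q : QParam} {c : ℝ≥0∞} (x y : CrossAlg q c) :
    star (x + y) = star x + star y := by
  apply (toConj _).injective
  rw [toConj_star, map_add, map_add, toConj_star, toConj_star]

theorem star_smul' {q : QParam} {c : ℝ≥0∞} (z : ℂ) (x : CrossAlg q c) :
    star (z • x) = star z • star x := by
  apply (toConj _).injective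
  rw [toConj_star, map_smul, toConj_smul, toConj_star]
  simp

theorem star_one' {q : QParam} {c : ℝ≥0∞} : star (1 : CrossAlg q c) = 1 := by
  apply (toConj _).injective
  rw [toConj_star, map_one, toConj_one]

/-- On generators the involution is the prescribed one. -/
theorem star_gen {q : QParam} {c : ℝ≥0∞} (g : Gen) :
    star (gen q c g) = gen q c (starGen g) := by
  rw [star_def, starHom_gen, AddEquiv.symm_apply_apply]

/-- The square of the involution, as an algebra endomorphism. -/
def starStar (q : QParam) (c : ℝ≥0∞) : CrossAlg q c →ₐ[ℂ] CrossAlg q c :=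
  AlgHom.ofLinearMap
    { toFun := fun x => star (star x)
      map_add' := fun x y => by rw [star_add', star_add']
      map_smul' := fun z x => by rw [star_smul', star_smul', star_star]; rfl }
    (by change star (star 1) = 1; rw [star_one', star_one'])
    (fun x y => by change star (star (x * y)) = _; rw [star_mul', star_mul']; rfl)

theorem starStar_eq (q : QParam) (c : ℝ≥0∞) : starStar q c = AlgHom.id ℂ _ := by
  apply crossAlg_hom_ext
  intro g
  change star (star (gen q c g)) = gen q c g
  rw [star_gen, star_gen]
  cases g <;> rfl

instance (q : QParam) (c : ℝ≥0∞) : StarRing (CrossAlg q c) where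
  star_involutive x := DFunLike.congr_fun (starStar_eq q c) x
  star_mul := star_mul'
  star_add := star_add'

instance (q : QParam) (c : ℝ≥0∞) : StarModule ℂ (CrossAlg q c) := ⟨star_smul'⟩

/-! ### The Podles sphere inside the cross product, and the left action on it -/

/-- The `*`-subalgebra `O(S²_{qc})`, generated by `A, B, B*`. -/
def podles (q : QParam) (c : ℝ≥0∞) : Subalgebra ℂ (CrossAlg q c) :=
  Algebra.adjoin ℂ {gen q c .A, gen q c .B, gen q c .Bs}

/-- The left adjoint action `f ▷ x = f₍₁₎ x S(f₍₂₎)` of the generators of `U_q(su₂)`, where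
`Δ(E) = E ⊗ K + K⁻¹ ⊗ E`, `Δ(F) = F ⊗ K + K⁻¹ ⊗ F`, `Δ(K) = K ⊗ K`,
`S(E) = -q E`, `S(F) = -q⁻¹ F`, `S(K) = K⁻¹`.  The cross relation `f x = (f₍₁₎ ▷ x) f₍₂₎` says
that on `O(S²_{qc})` this is the action that defines the cross product.
(The generators `A, B, B*` are given the value `0`; they are not used.) -/
def adj (q : QParam) (c : ℝ≥0∞) : Gen → CrossAlg q c → CrossAlg q c
  | .E, x => gen q c .E * x * gen q c .Ki
      - ((q : ℝ) : ℂ) • (gen q c .Ki * x * gen q c .E)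
  | .F, x => gen q c .F * x * gen q c .Ki
      - (((q : ℝ)⁻¹ : ℝ) : ℂ) • (gen q c .Ki * x * gen q c .F)
  | .K, x => gen q c .K * x * gen q c .Ki
  | .Ki, x => gen q c .Ki * x * gen q c .K
  | _, _ => 0

/-- The counit on the generators of `U_q(su₂)`. -/
def counit : Gen → ℂ
  | .K => 1
  | .Ki => 1
  | _ => 0

section Adjoint

variable {q : QParam} {c : ℝ≥0∞}

theorem K_Ki : gen q c .K * gen q c .Ki = 1 := by
  simpa only [map_mul, map_one, mk_fgen] using mk_rel (Rel.K_Ki (q := q) (c := c))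

theorem Ki_K : gen q c .Ki * gen q c .K = 1 := by
  simpa only [map_mul, map_one, mk_fgen] using mk_rel (Rel.Ki_K (q := q) (c := c))

/-- Moving `K⁻¹` to the right. -/
theorem Ki_move {x : CrossAlg q c} {r s : ℝ} (hrs : r * s = 1)
    (h : gen q c .K * x = (r : ℂ) • (x * gen q c .K)) :
    gen q c .Ki * x = (s : ℂ) • (x * gen q c .Ki) := by
  have h2 : x * gen q c .Ki = (r : ℂ) • (gen q c .Ki * x) := by
    calc x * gen q c .Ki = gen q c .Ki * (gen q c .K * x) * gen q c .Ki := by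
          rw [← mul_assoc, Ki_K, one_mul]
      _ = (r : ℂ) • (gen q c .Ki * x * (gen q c .K * gen q c .Ki)) := by
          rw [h]; simp only [mul_smul_comm, smul_mul_assoc, mul_assoc]
      _ = _ := by rw [K_Ki, mul_one]
  rw [h2, smul_smul, ← Complex.ofReal_mul, mul_comm s r, hrs, Complex.ofReal_one, one_smul]

theorem Ki_K_cancel (z : CrossAlg q c) : gen q c .Ki * (gen q c .K * z) = z := by
  rw [← mul_assoc, Ki_K, one_mul]

theorem K_E_move (z : CrossAlg q c) : gen q c .K * (gen q c .E * z)
    = ((q : ℝ) : ℂ) • (gen q c .E * (gen q c .K * z)) := by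
  have h := mk_rel (Rel.K_E (q := q) (c := c))
  simp only [map_mul, map_smul, mk_fgen] at h
  rw [← mul_assoc, h, smul_mul_assoc, mul_assoc]

theorem F_K_move (z : CrossAlg q c) : gen q c .K * (gen q c .F * z)
    = (((q : ℝ)⁻¹ : ℝ) : ℂ) • (gen q c .F * (gen q c .K * z)) := by
  have hq0 : (q : ℝ) ≠ 0 := q.2.1.ne'
  have h := mk_rel (Rel.F_K (q := q) (c := c))
  simp only [map_mul, map_smul, mk_fgen] at h
  rw [← mul_assoc (gen q c .F), h, smul_mul_assoc, smul_smul, ← Complex.ofReal_mul,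
    inv_mul_cancel₀ hq0, Complex.ofReal_one, one_smul, mul_assoc]

theorem adj_mul_K (x y : CrossAlg q c) :
    adj q c .K (x * y) = adj q c .K x * adj q c .K y := by
  simp only [adj, mul_assoc, Ki_K_cancel]

theorem adj_mul_Ki (x y : CrossAlg q c) :
    adj q c .Ki (x * y) = adj q c .Ki x * adj q c .Ki y := by
  have a2 : ∀ z : CrossAlg q c, gen q c .K * (gen q c .Ki * z) = z :=
    fun z => by rw [← mul_assoc, K_Ki, one_mul]
  simp only [adj, mul_assoc, a2]

theorem adj_mul_E (x y : CrossAlg q c) : adj q c .E (x * y)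
    = adj q c .E x * adj q c .K y + adj q c .Ki x * adj q c .E y := by
  have a2 : ∀ z : CrossAlg q c, gen q c .K * (gen q c .Ki * z) = z :=
    fun z => by rw [← mul_assoc, K_Ki, one_mul]
  simp only [adj, mul_assoc, sub_mul, mul_sub, smul_mul_assoc, mul_smul_comm, Ki_K_cancel, a2,
    K_E_move]
  abel

theorem adj_mul_F (x y : CrossAlg q c) : adj q c .F (x * y)
    = adj q c .F x * adj q c .K y + adj q c .Ki x * adj q c .F y := by
  have a2 : ∀ z : CrossAlg q c, gen q c .K * (gen q c .Ki * z) = z :=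
    fun z => by rw [← mul_assoc, K_Ki, one_mul]
  simp only [adj, mul_assoc, sub_mul, mul_sub, smul_mul_assoc, mul_smul_comm, Ki_K_cancel, a2,
    F_K_move]
  abel

theorem adj_add (g : Gen) (x y : CrossAlg q c) :
    adj q c g (x + y) = adj q c g x + adj q c g y := by
  cases g <;> simp only [adj, mul_add, add_mul, smul_add, add_zero] <;> abel

theorem adj_smul (g : Gen) (z : ℂ) (x : CrossAlg q c) :
    adj q c g (z • x) = z • adj q c g x := by
  cases g <;> simp only [adj, mul_smul_comm, smul_mul_assoc, smul_sub, smul_zero,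
    smul_comm z (_ : ℂ) (_ : CrossAlg q c)]

theorem Ki_E : gen q c .Ki * gen q c .E = (((q : ℝ)⁻¹ : ℝ) : ℂ) • (gen q c .E * gen q c .Ki) := by
  refine Ki_move (r := q) (mul_inv_cancel₀ q.2.1.ne') ?_
  simpa only [mul_one] using K_E_move (q := q) (c := c) 1

theorem Ki_F : gen q c .Ki * gen q c .F = ((q : ℝ) : ℂ) • (gen q c .F * gen q c .Ki) := by
  refine Ki_move (r := (q : ℝ)⁻¹) (inv_mul_cancel₀ q.2.1.ne') ?_
  simpa only [mul_one] using F_K_move (q := q) (c := c) 1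

theorem adj_one (g : Gen) : adj q c g 1 = counit g • 1 := by
  have hq0 : (q : ℝ) ≠ 0 := q.2.1.ne'
  cases g <;> simp only [adj, counit, mul_one, K_Ki, Ki_K, one_smul, zero_smul, Ki_E, Ki_F,
    smul_smul, ← Complex.ofReal_mul, mul_inv_cancel₀ hq0, inv_mul_cancel₀ hq0, Complex.ofReal_one,
    sub_self]

theorem adj_K_of {x : CrossAlg q c} {r : ℝ}
    (h : gen q c .K * x = (r : ℂ) • (x * gen q c .K)) : adj q c .K x = (r : ℂ) • x := by
  simp only [adj]
  rw [h, smul_mul_assoc, mul_assoc, K_Ki, mul_one]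

theorem adj_Ki_of {x : CrossAlg q c} {r s : ℝ} (hrs : r * s = 1)
    (h : gen q c .K * x = (r : ℂ) • (x * gen q c .K)) : adj q c .Ki x = (s : ℂ) • x := by
  simp only [adj]
  rw [Ki_move hrs h, smul_mul_assoc, mul_assoc, Ki_K, mul_one]

theorem adj_E_of {x z : CrossAlg q c} {r s : ℝ} (hrs : r * s = 1)
    (h : gen q c .K * x = (r : ℂ) • (x * gen q c .K))
    (h' : gen q c .E * x = (s : ℂ) • (x * gen q c .E) + z * gen q c .K) : adj q c .E x = z := by
  have hq0 : (q : ℝ) ≠ 0 := q.2.1.ne'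
  simp only [adj]
  rw [Ki_move hrs h, h']
  simp only [add_mul, smul_mul_assoc, mul_assoc, K_Ki, mul_one, Ki_E, mul_smul_comm, smul_smul,
    ← Complex.ofReal_mul]
  rw [show (q : ℝ) * (s * (q : ℝ)⁻¹) = s by field_simp]
  abel

theorem adj_F_of {x z : CrossAlg q c} {r s : ℝ} (hrs : r * s = 1)
    (h : gen q c .K * x = (r : ℂ) • (x * gen q c .K))
    (h' : gen q c .F * x = (s : ℂ) • (x * gen q c .F) + z * gen q c .K) : adj q c .F x = z := by
  have hq0 : (q : ℝ) ≠ 0 := q.2.1.ne'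
  simp only [adj]
  rw [Ki_move hrs h, h']
  simp only [add_mul, smul_mul_assoc, mul_assoc, K_Ki, mul_one, Ki_F, mul_smul_comm, smul_smul,
    ← Complex.ofReal_mul]
  rw [show (q : ℝ)⁻¹ * (s * (q : ℝ)) = s by field_simp]
  abel

/-- The left adjoint action of `U_q(su₂)` maps the generators of `O(S²_{qc})` into
`O(S²_{qc})`. -/
theorem adj_gen_mem (g : Gen) {x : CrossAlg q c}
    (hx : x ∈ ({gen q c .A, gen q c .B, gen q c .Bs} : Set (CrossAlg q c))) :
    adj q c g x ∈ podles q c := by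
  have hq0 : (q : ℝ) ≠ 0 := q.2.1.ne'
  have mA : gen q c .A ∈ podles q c := Algebra.subset_adjoin (by simp)
  have mB : gen q c .B ∈ podles q c := Algebra.subset_adjoin (by simp)
  have mBs : gen q c .Bs ∈ podles q c := Algebra.subset_adjoin (by simp)
  have r10 := mk_rel (Rel.K_A (q := q) (c := c))
  have r11 := mk_rel (Rel.E_A (q := q) (c := c))
  have r12 := mk_rel (Rel.F_A (q := q) (c := c))
  have r13 := mk_rel (Rel.K_B (q := q) (c := c))
  have r14 := mk_rel (Rel.E_B (q := q) (c := c))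
  have r15 := mk_rel (Rel.F_B (q := q) (c := c))
  have r16 := mk_rel (Rel.K_Bs (q := q) (c := c))
  have r17 := mk_rel (Rel.E_Bs (q := q) (c := c))
  have r18 := mk_rel (Rel.F_Bs (q := q) (c := c))
  simp only [map_mul, map_add, map_sub, map_smul, mk_fgen] at r10 r11 r12 r13 r14 r15 r16 r17 r18
  have kA : gen q c .K * gen q c .A = ((1 : ℝ) : ℂ) • (gen q c .A * gen q c .K) := by
    rw [r10, Complex.ofReal_one, one_smul]
  have q1 : (1 : ℝ) * 1 = 1 := one_mul 1
  have q2 : (q : ℝ)⁻¹ * (q : ℝ) = 1 := inv_mul_cancel₀ hq0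
  have q3 : (q : ℝ) * (q : ℝ)⁻¹ = 1 := mul_inv_cancel₀ hq0
  simp only [Set.mem_insert_iff, Set.mem_singleton_iff] at hx
  rcases hx with rfl | rfl | rfl
  · cases g
    case E =>
      rw [adj_E_of (z := (((q : ℝ) ^ (-(1 / 2) : ℝ) : ℝ) : ℂ) • gen q c .Bs) q1 kA (by
        rw [r11, Complex.ofReal_one, one_smul, smul_mul_assoc])]
      exact (podles q c).smul_mem mBs _
    case F =>
      rw [adj_F_of (z := -((((q : ℝ) ^ (-(3 / 2) : ℝ) : ℝ) : ℂ) • gen q c .B)) q1 kA (by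
        rw [r12, Complex.ofReal_one, one_smul, neg_mul, smul_mul_assoc, sub_eq_add_neg])]
      exact (podles q c).neg_mem ((podles q c).smul_mem mB _)
    case K => rw [adj_K_of kA]; exact (podles q c).smul_mem mA _
    case Ki => rw [adj_Ki_of q1 kA]; exact (podles q c).smul_mem mA _
    all_goals exact (podles q c).zero_mem
  · cases g
    case E =>
      rw [adj_E_of (z := -((((q : ℝ) ^ (1 / 2 : ℝ) * (1 + (q : ℝ) ^ 2) : ℝ) : ℂ) • gen q c .A)
          + (((q : ℝ) ^ (1 / 2 : ℝ) * linCoeff c : ℝ) : ℂ) • 1) q2 r13 (by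
        rw [r14, add_mul, neg_mul, smul_mul_assoc, smul_mul_assoc, one_mul]; abel)]
      exact (podles q c).add_mem ((podles q c).neg_mem ((podles q c).smul_mem mA _))
        ((podles q c).smul_mem (podles q c).one_mem _)
    case F =>
      rw [adj_F_of (z := 0) q2 r13 (by rw [r15, zero_mul, add_zero])]
      exact (podles q c).zero_mem
    case K => rw [adj_K_of r13]; exact (podles q c).smul_mem mB _
    case Ki => rw [adj_Ki_of q2 r13]; exact (podles q c).smul_mem mB _
    all_goals exact (podles q c).zero_mem
  · cases g
    case E =>
      rw [adj_E_of (z := 0) q3 r16 (by rw [r17, zero_mul, add_zero])]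
      exact (podles q c).zero_mem
    case F =>
      rw [adj_F_of (z := (((q : ℝ) ^ (-(1 / 2) : ℝ) * (1 + (q : ℝ) ^ 2) : ℝ) : ℂ) • gen q c .A
          - (((q : ℝ) ^ (-(1 / 2) : ℝ) * linCoeff c : ℝ) : ℂ) • 1) q3 r16 (by
        rw [r18, sub_mul, smul_mul_assoc, smul_mul_assoc, one_mul]; abel)]
      exact (podles q c).sub_mem ((podles q c).smul_mem mA _)
        ((podles q c).smul_mem (podles q c).one_mem _)
    case K => rw [adj_K_of r16]; exact (podles q c).smul_mem mBs _
    case Ki => rw [adj_Ki_of q3 r16]; exact (podles q c).smul_mem mBs _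
    all_goals exact (podles q c).zero_mem

/-- The left adjoint action of `U_q(su₂)` leaves `O(S²_{qc})` invariant. -/
theorem adj_mem {x : CrossAlg q c} (hx : x ∈ podles q c) : ∀ g, adj q c g x ∈ podles q c := by
  induction hx using Algebra.adjoin_induction with
  | mem x hx => exact fun g => adj_gen_mem g hx
  | algebraMap r =>
    intro g
    rw [Algebra.algebraMap_eq_smul_one, adj_smul, adj_one]
    exact (podles q c).smul_mem ((podles q c).smul_mem (podles q c).one_mem _) _
  | add x y _ _ hx hy =>
    intro g
    rw [adj_add]
    exact (podles q c).add_mem (hx g) (hy g)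
  | mul x y _ _ hx hy =>
    intro g
    cases g
    case E =>
      rw [adj_mul_E]
      exact (podles q c).add_mem ((podles q c).mul_mem (hx _) (hy _))
        ((podles q c).mul_mem (hx _) (hy _))
    case F =>
      rw [adj_mul_F]
      exact (podles q c).add_mem ((podles q c).mul_mem (hx _) (hy _))
        ((podles q c).mul_mem (hx _) (hy _))
    case K => rw [adj_mul_K]; exact (podles q c).mul_mem (hx _) (hy _)
    case Ki => rw [adj_mul_Ki]; exact (podles q c).mul_mem (hx _) (hy _)
    all_goals exact (podles q c).zero_mem

/-- `O(S²_{qc})` is closed under the involution. -/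
theorem star_mem_podles {x : CrossAlg q c} (hx : x ∈ podles q c) : star x ∈ podles q c := by
  induction hx using Algebra.adjoin_induction with
  | mem x hx =>
    simp only [Set.mem_insert_iff, Set.mem_singleton_iff] at hx
    rcases hx with rfl | rfl | rfl <;> rw [star_gen] <;>
      exact Algebra.subset_adjoin (by simp [starGen])
  | algebraMap r =>
    rw [Algebra.algebraMap_eq_smul_one, star_smul, star_one]
    exact (podles q c).smul_mem (podles q c).one_mem _
  | add x y _ _ hx hy => rw [star_add]; exact (podles q c).add_mem hx hy
  | mul x y _ _ hx hy => rw [star_mul]; exact (podles q c).mul_mem hy hx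

/-- The left action `f ▷ x` of a generator `f` of `U_q(su₂)` on `O(S²_{qc})`. -/
def act (g : Gen) (x : podles q c) : podles q c := ⟨adj q c g x, adj_mem x.2 g⟩

/-- The involution of `O(S²_{qc})`. -/
def pstar (x : podles q c) : podles q c := ⟨star (x : CrossAlg q c), star_mem_podles x.2⟩

end Adjoint

/-! ### `*`-representations -/

universe u

/-- A `*`-representation of the cross product `*`-algebra on the pre-Hilbert space `D`
(the invariant dense domain in the Hilbert space completion of `D`). -/
@[ext]
structure StarRep (q : QParam) (c : ℝ≥0∞) (D : Type u) [NormedAddCommGroup D]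
    [InnerProductSpace ℂ D] where
  /-- the unital algebra homomorphism into the operators on the domain -/
  toHom : CrossAlg q c →ₐ[ℂ] Module.End ℂ D
  inner_star : ∀ (a : CrossAlg q c) (x y : D), ⟪toHom a x, y⟫_ℂ = ⟪x, toHom (star a) y⟫_ℂ

section Representations

variable {q : QParam} {c : ℝ≥0∞} {D : Type u} [NormedAddCommGroup D] [InnerProductSpace ℂ D]

/-- Unitary equivalence of `*`-representations. -/
def StarRep.UnitarilyEquiv {D' : Type*} [NormedAddCommGroup D'] [InnerProductSpace ℂ D']
    (π : StarRep q c D) (π' : StarRep q c D') : Prop :=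
  ∃ U : D ≃ₗᵢ[ℂ] D', ∀ (a : CrossAlg q c) (x : D), U (π.toHom a x) = π'.toHom a (U x)

/-- Irreducibility: the domain is nonzero and has no nontrivial invariant subspaces at all
(in particular no nontrivial reducing ones). -/
def StarRep.Irreducible (π : StarRep q c D) : Prop :=
  Nontrivial D ∧ ∀ W : Submodule ℂ D, (∀ (a : CrossAlg q c), ∀ x ∈ W, π.toHom a x ∈ W) →
    W = ⊥ ∨ W = ⊤

/-- The operator of a generator. -/
def StarRep.op (π : StarRep q c D) (g : Gen) : Module.End ℂ D := π.toHom (gen q c g)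

/-- The generators of `U_q(su₂)`. -/
def IsUGen : Gen → Prop
  | .E | .F | .K | .Ki => True
  | _ => False

/-- `h` is a `U_q(su₂)`-invariant state on `O(S²_{qc})`. -/
structure IsInvariantState (h : podles q c →ₗ[ℂ] ℂ) : Prop where
  map_one : h 1 = 1
  nonneg : ∀ x, 0 ≤ (h (pstar x * x)).re ∧ (h (pstar x * x)).im = 0
  invariant : ∀ g, IsUGen g → ∀ x, h (act g x) = counit g * h x

/-- `π` is (unitarily equivalent to) the Heisenberg representation: its domain is the
pre-Hilbert space obtained from `O(S²_{qc})` with the (semi-)inner product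
`⟨x, y⟩ = h(x* y)` of an invariant state `h`, `O(S²_{qc})` acts by left multiplication, and
`U_q(su₂)` acts by the left action `▷`. -/
def StarRep.IsHeisenberg (π : StarRep q c D) : Prop :=
  ∃ (h : podles q c →ₗ[ℂ] ℂ) (Λ : podles q c →ₗ[ℂ] D),
    IsInvariantState h ∧ Function.Surjective Λ ∧
    (∀ x y, ⟪Λ x, Λ y⟫_ℂ = h (pstar x * y)) ∧
    (∀ x y : podles q c, π.toHom x (Λ y) = Λ (x * y)) ∧
    (∀ g, IsUGen g → ∀ y, π.op g (Λ y) = Λ (act g y))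

/-! ### The direct sum of the spin representations `T_{l₀+n}` -/

/-- Labels of the vectors `v^l_j`, with `l = l₀ + n`, `l₀ = N₀ / 2`, and `j = -l + k`,
`0 ≤ k ≤ 2l = N₀ + 2n`. -/
abbrev SpinIndex (N₀ : ℕ) : Type := Σ n : ℕ, Fin (N₀ + 2 * n + 1)

/-- The vector `v^l_j` for arbitrary integers `n` (`l = l₀ + n`) and `k` (`j = -l + k`);
it is `0` if `n < 0` or `j` is not one of `-l, …, l`. -/
def vec {N₀ : ℕ} (v : SpinIndex N₀ → D) (n k : ℤ) : D :=
  if h : 0 ≤ n ∧ 0 ≤ k ∧ k ≤ N₀ + 2 * n then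
    v ⟨n.toNat, ⟨k.toNat, by omega⟩⟩
  else 0

/-- The spin `l = l₀ + n`. -/
def spin (N₀ : ℕ) (n : ℤ) : ℝ := (N₀ : ℝ) / 2 + n

/-- The weight `j = -l + k`. -/
def weight (N₀ : ℕ) (n k : ℤ) : ℝ := k - spin N₀ n

/-- `v` is an orthonormal family on which `E, F, K` act as in the direct sum of the spin
representations `T_{l₀+n}`, `n ≥ 0`. -/
structure IsSpinSum (N₀ : ℕ) (π : StarRep q c D) (v : SpinIndex N₀ → D) : Prop where
  orthonormal : Orthonormal ℂ v
  K_apply : ∀ (n : ℕ) (k : Fin (N₀ + 2 * n + 1)),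
    let j := weight N₀ n k
    π.op .K (vec v n k) = (((q : ℝ) ^ j : ℝ) : ℂ) • vec v n k
  E_apply : ∀ (n : ℕ) (k : Fin (N₀ + 2 * n + 1)),
    let l := spin N₀ n
    let j := weight N₀ n k
    π.op .E (vec v n k) = ((√(qnum q (l - j)) * √(qnum q (l + j + 1)) : ℝ) : ℂ) • vec v n (k + 1)
  F_apply : ∀ (n : ℕ) (k : Fin (N₀ + 2 * n + 1)),
    let l := spin N₀ n
    let j := weight N₀ n k
    π.op .F (vec v n k) = ((√(qnum q (l - j + 1)) * √(qnum q (l + j)) : ℝ) : ℂ) • vec v n (k - 1)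

/-- The family `v` spans the domain. -/
def Spans {ι : Type*} (v : ι → D) : Prop := Submodule.span ℂ (Set.range v) = ⊤

/-- The span of the family `v` is dense in the domain (hence in its completion). -/
def SpansDense {ι : Type*} (v : ι → D) : Prop :=
  (Submodule.span ℂ (Set.range v)).topologicalClosure = ⊤

/-- The restriction of `π` to `U_q(su₂)` is (unitarily equivalent to) `⨁_{n ≥ 0} T_{l₀+n}`. -/
def RestrictsToSpinSum (N₀ : ℕ) (π : StarRep q c D) : Prop :=
  ∃ v : SpinIndex N₀ → D, IsSpinSum N₀ π v ∧ Spans v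

/-! ### The explicit formulas -/

/-- `λ_± = 1/2 ± (c + 1/4)^{1/2}`, for `c < ∞`. -/
def lamPM (c : ℝ≥0∞) (ε : ℤˣ) : ℝ := 1 / 2 + ((ε : ℤ) : ℝ) * √(c.toReal + 1 / 4)

/-- The coefficient `β⁰(l,l)_±`, as a function of `l₀` and `l`. -/
def beta (q : QParam) (c : ℝ≥0∞) (ε : ℤˣ) (l₀ l : ℝ) : ℝ :=
  if c = ⊤ then
    (qnum q (2 * l + 2))⁻¹ * (((ε : ℤ) : ℝ) * (q : ℝ)⁻¹ * qnum q 2 * qnum q (2 * l₀))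
  else
    (qnum q (2 * l + 2))⁻¹ *
      (qnum q (2 * l₀) * (((q : ℝ) ^ 2)⁻¹ * lamPM c ε - lamPM c (-ε))
        - (1 - ((q : ℝ) ^ 2)⁻¹) * qnum q (l - l₀) * qnum q (l + l₀ + 1))

/-- The coefficient `α⁺(l,l)_±`, as a function of `l₀` and `l`. -/
def alpha (q : QParam) (c : ℝ≥0∞) (ε : ℤˣ) (l₀ l : ℝ) : ℝ :=
  if c = ⊤ then
    √(qnum q 2) * (√(qnum q (2 * l + 3)))⁻¹ * (√(qnum q (2 * l + 2)))⁻¹ *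
      √(qnum q (2 * l + 2) ^ 2 - qnum q (2 * l₀) ^ 2)
  else
    √(qnum q 2) * (√(qnum q (2 * l + 3)))⁻¹ * (√(qnum q (2 * l + 2)))⁻¹ *
      √(qnum q (2 * l + 2) ^ 2 * (c.toReal + 1 / 4)
        - (((q : ℝ)⁻¹ - q) / 2 * qnum q (l - l₀ + 1) * qnum q (l + l₀ + 1)
            + ((ε : ℤ) : ℝ) * qnum q (2 * l₀) * √(c.toReal + 1 / 4)) ^ 2)

/-- The spin-one generator `x_1` of `O(S²_{qc})`. -/
def xPlus (q : QParam) (c : ℝ≥0∞) : CrossAlg q c :=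
  -((√(1 + (q : ℝ) ^ 2) : ℝ) : ℂ) • gen q c .Bs

/-- The spin-one generator `x_0` of `O(S²_{qc})`. -/
def xZero (q : QParam) (c : ℝ≥0∞) : CrossAlg q c :=
  (linCoeff c : ℂ) • 1 - ((1 + (q : ℝ) ^ 2 : ℝ) : ℂ) • gen q c .A

/-- The spin-one generator `x_{-1}` of `O(S²_{qc})`. -/
def xMinus (q : QParam) (c : ℝ≥0∞) : CrossAlg q c :=
  (((q : ℝ)⁻¹ * √(1 + (q : ℝ) ^ 2) : ℝ) : ℂ) • gen q c .B

/-- The explicit formulas, with sign `ε`, for the action of `x_1, x_0, x_{-1}` on the vectors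
`v^l_j`.  Note that `v^{l'}_{j'} = vec v n' k'` with `n' = l' - l₀` and `k' = j' + l'`. -/
structure HasFormulas (N₀ : ℕ) (ε : ℤˣ) (π : StarRep q c D) (v : SpinIndex N₀ → D) : Prop where
  xPlus_apply : ∀ (n : ℕ) (k : Fin (N₀ + 2 * n + 1)),
    let l₀ := spin N₀ 0
    let l := spin N₀ n
    let j := weight N₀ n k
    π.toHom (xPlus q c) (vec v n k) =
      (((q : ℝ) ^ (-l + j) * √(qnum q (l + j + 1)) * √(qnum q (l + j + 2))
          * (√(qnum q (2 * l + 1)))⁻¹ * (√(qnum q (2 * l + 2)))⁻¹ * alpha q c ε l₀ l : ℝ) : ℂ)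
          • vec v (n + 1) (k + 2)
      - (((q : ℝ) ^ (j + 2) * √(qnum q (l - j)) * √(qnum q (l + j + 1))
          * √(qnum q 2) * (qnum q (2 * l))⁻¹ * beta q c ε l₀ l : ℝ) : ℂ)
          • vec v n (k + 1)
      - (((q : ℝ) ^ (l + j + 1) * √(qnum q (l - j - 1)) * √(qnum q (l - j))
          * (√(qnum q (2 * l - 1)))⁻¹ * (√(qnum q (2 * l)))⁻¹ * alpha q c ε l₀ (l - 1) : ℝ) : ℂ)
          • vec v (n - 1) k
  xZero_apply : ∀ (n : ℕ) (k : Fin (N₀ + 2 * n + 1)),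
    let l₀ := spin N₀ 0
    let l := spin N₀ n
    let j := weight N₀ n k
    π.toHom (xZero q c) (vec v n k) =
      (((q : ℝ) ^ j * √(qnum q (l - j + 1)) * √(qnum q (l + j + 1)) * √(qnum q 2)
          * (√(qnum q (2 * l + 1)))⁻¹ * (√(qnum q (2 * l + 2)))⁻¹ * alpha q c ε l₀ l : ℝ) : ℂ)
          • vec v (n + 1) (k + 1)
      + (((1 - (q : ℝ) ^ (l + j + 1) * qnum q (l - j) * qnum q 2 * (qnum q (2 * l))⁻¹)
          * beta q c ε l₀ l : ℝ) : ℂ)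
          • vec v n k
      + (((q : ℝ) ^ j * √(qnum q (l - j)) * √(qnum q (l + j)) * √(qnum q 2)
          * (√(qnum q (2 * l - 1)))⁻¹ * (√(qnum q (2 * l)))⁻¹ * alpha q c ε l₀ (l - 1) : ℝ) : ℂ)
          • vec v (n - 1) (k - 1)
  xMinus_apply : ∀ (n : ℕ) (k : Fin (N₀ + 2 * n + 1)),
    let l₀ := spin N₀ 0
    let l := spin N₀ n
    let j := weight N₀ n k
    π.toHom (xMinus q c) (vec v n k) =
      (((q : ℝ) ^ (l + j) * √(qnum q (l - j + 1)) * √(qnum q (l - j + 2))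
          * (√(qnum q (2 * l + 1)))⁻¹ * (√(qnum q (2 * l + 2)))⁻¹ * alpha q c ε l₀ l : ℝ) : ℂ)
          • vec v (n + 1) k
      + (((q : ℝ) ^ j * √(qnum q (l - j + 1)) * √(qnum q (l + j))
          * √(qnum q 2) * (qnum q (2 * l))⁻¹ * beta q c ε l₀ l : ℝ) : ℂ)
          • vec v n (k - 1)
      - (((q : ℝ) ^ (-l + j - 1) * √(qnum q (l + j - 1)) * √(qnum q (l + j))
          * (√(qnum q (2 * l - 1)))⁻¹ * (√(qnum q (2 * l)))⁻¹ * alpha q c ε l₀ (l - 1) : ℝ) : ℂ)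
          • vec v (n - 1) (k - 2)

end Representations

end PodlesCross

end

noncomputable section

namespace PodlesCross

/-! ### Quantum integers -/

/-! By the cross relations, `x_1, x_0, x_{-1}` form a spin one tensor operator for `U_q(su_2)`. On a
multiplicity free sum of spin representations the Wigner-Eckart theorem therefore leaves, for every
`l`, only three unknown numbers: the reduced matrix elements `a` (from `l` to `l + 1`), `b` (from
`l` to `l`) and `d` (from `l` to `l - 1`). Hermiticity of `x_0` makes `b` real and `d` the conjugate
of the preceding `a`, and a choice of phases for the multiplets makes `a ≥ 0`. This is
`exists_plusVec`, `exists_hasSeqForm` and `HasSeqForm.exists_phase`.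

The relations of the sphere are then tested on extremal vectors only. Put `N = 2l`, `τ = tauShift q
c`, `ρ = discr c`. The relation of `x_0` and `x_1` gives the recursion `q²[N+4] b(n+1) = [N+2](q²
b(n) + 2τ)` (`inner_zero_plus_top`). The relation for `x_{-1} x_1` expresses `a(n)²` through `b(n)`
(`inner_minus_plus`). The relation for `x_1 x_{-1}`, after elimination of `a(n)²`, expresses
`a(n-1)²` through `b(n)` (`inner_plus_minus`, `quadratic_iff`). At `l = l₀` there is no lower
multiplet, so `a(-1) = 0` and the last equation says that the square of an affine function of `b(0)`
is prescribed. This is the origin of the sign; the recursion determines everything else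
(`exists_sign`). The sequence `gammaCoef`, the term in braces in the formula for `α⁺`, brings both
equations for `a²` to the same form (`gammaCoef_eq`, `gammaCoef_sub_one_eq`), and `|γ| < [N+2] ρ`
makes the radicand positive (`abs_gammaCoef_lt`).

Conversely, define operators by the formulas. The cross relations hold entrywise, half of them by
taking adjoints. The defects of the sphere relations are again tensor operators, so they vanish as
soon as their reduced matrix elements do (`family_eq_zero`), and these are the equations just
listed, which the explicit `α⁺` and `β⁰` satisfy.

Irreducibility holds because `K` and `FE` separate the basis vectors, so that a nonzero invariant
subspace contains one of them, and all `α⁺` are nonzero. For `l₀ > 0` the signs are distinguished by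
the value `β⁰(l₀,l₀)` of `x_0` at the highest weight vector of spin `l₀`. For `l₀ = 0` the vector
`v^0_0` is `U_q(su_2)`-invariant and cyclic, and its vector state gives the Heisenberg
representation.

Throughout, vectors and coefficients are indexed by the integers `n = l - l₀` and `k = l + j`, with
zero outside the range; `s = linCoeff c` and `κ = constCoeff c` treat `c < ∞` and `c = ∞` together.
-/

/-- The quantum integer `[m]`. -/
def qint (q : ℝ) (m : ℤ) : ℝ := qnum q m

/-- The square root of a quantum integer. -/
def qrt (q : ℝ) (m : ℤ) : ℝ := √(qint q m)

/-- The weight `q^j` of the vector with `2l = N` and `j = -l + k`. -/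
def wt (q : ℝ) (N k : ℤ) : ℝ := q ^ ((k : ℝ) - (N : ℝ) / 2)

section QInt

variable {q : ℝ}

/-- With integer powers, identities between quantum integers become rational identities in `q`, `q ^
N`, `q ^ k` that `field_simp` and `ring` can decide. -/
theorem qint_eq (q : ℝ) (m : ℤ) : qint q m = (q ^ m - (q ^ m)⁻¹) / (q - q⁻¹) := by
  rw [qint, qnum, ← zpow_neg, ← Real.rpow_intCast q m, ← Real.rpow_intCast q (-m)]
  push_cast
  rfl

theorem sub_inv_neg (h0 : 0 < q) (h1 : q < 1) : q - q⁻¹ < 0 := by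
  have : 1 < q⁻¹ := (one_lt_inv₀ h0).2 h1
  linarith

theorem qint_zero (q : ℝ) : qint q 0 = 0 := by simp [qint_eq]

theorem qint_one (h0 : 0 < q) (h1 : q < 1) : qint q 1 = 1 := by
  rw [qint_eq, zpow_one, div_self (sub_inv_neg h0 h1).ne]

theorem qint_two (h0 : 0 < q) (h1 : q < 1) : qint q 2 = q + q⁻¹ := by
  rw [qint_eq, div_eq_iff (sub_inv_neg h0 h1).ne]
  have := h0.ne'
  norm_cast
  field_simp
  ring

theorem qint_strictMono (h0 : 0 < q) (h1 : q < 1) : StrictMono (qint q) := by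
  intro a b hab
  rw [qint_eq, qint_eq, div_lt_div_right_of_neg (sub_inv_neg h0 h1)]
  have h : q ^ b < q ^ a := zpow_lt_zpow_right_of_lt_one₀ h0 h1 hab
  have h' : (q ^ a)⁻¹ < (q ^ b)⁻¹ := inv_strictAnti₀ (zpow_pos h0 b) h
  linarith

theorem qint_pos (h0 : 0 < q) (h1 : q < 1) {m : ℤ} (hm : 0 < m) : 0 < qint q m := by
  rw [← qint_zero q]
  exact qint_strictMono h0 h1 hm

theorem qint_nonneg (h0 : 0 < q) (h1 : q < 1) {m : ℤ} (hm : 0 ≤ m) : 0 ≤ qint q m := by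
  rw [← qint_zero q]
  exact (qint_strictMono h0 h1).monotone hm

theorem qrt_zero (q : ℝ) : qrt q 0 = 0 := by simp [qrt, qint_zero]

theorem qrt_one (h0 : 0 < q) (h1 : q < 1) : qrt q 1 = 1 := by simp [qrt, qint_one h0 h1]

theorem qrt_pos (h0 : 0 < q) (h1 : q < 1) {m : ℤ} (hm : 0 < m) : 0 < qrt q m :=
  Real.sqrt_pos.2 (qint_pos h0 h1 hm)

/-- The real square root of a negative number is `0`. This truncation makes the coefficients vanish
beyond the ends of a multiplet, but it also restricts `qrt_sq` to nonnegative arguments. -/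
theorem qrt_of_nonpos (h0 : 0 < q) (h1 : q < 1) {m : ℤ} (hm : m ≤ 0) : qrt q m = 0 := by
  apply Real.sqrt_eq_zero_of_nonpos
  rw [← qint_zero q]
  exact (qint_strictMono h0 h1).monotone hm

theorem qrt_sq (h0 : 0 < q) (h1 : q < 1) {m : ℤ} (hm : 0 ≤ m) : qrt q m ^ 2 = qint q m :=
  Real.sq_sqrt (qint_nonneg h0 h1 hm)

theorem wt_pos (h0 : 0 < q) (N k : ℤ) : 0 < wt q N k := Real.rpow_pos_of_pos h0 _

theorem wt_add_one (h0 : 0 < q) (N k : ℤ) : wt q N (k + 1) = wt q N k * q := by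
  rw [wt, wt, ← Real.rpow_add_one h0.ne']
  congr 1; push_cast; ring

theorem wt_sub_one (h0 : 0 < q) (N k : ℤ) : wt q N (k - 1) = wt q N k * q⁻¹ := by
  rw [wt, wt, ← div_eq_mul_inv, ← Real.rpow_sub_one h0.ne']
  congr 1; push_cast; ring

/-- Passing from `l` to `l + 1` at fixed `j` raises `N = 2l` by two and `k = l + j` by one. -/
theorem wt_add_two (q : ℝ) (N k : ℤ) : wt q (N + 2) (k + 1) = wt q N k := by
  rw [wt, wt]
  congr 1; push_cast; ring

theorem wt_sub_two (q : ℝ) (N k : ℤ) : wt q (N - 2) (k - 1) = wt q N k := by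
  rw [wt, wt]
  congr 1; push_cast; ring

theorem wt_sq (h0 : 0 < q) (N k : ℤ) : wt q N k ^ 2 = q ^ k * q ^ k * (q ^ N)⁻¹ := by
  rw [wt, ← Real.rpow_mul_natCast h0.le, ← zpow_neg, ← zpow_add₀ h0.ne', ← zpow_add₀ h0.ne',
    ← Real.rpow_intCast]
  congr 1; push_cast; ring

end QInt

/-! ### The Clebsch-Gordan coefficients

Here `N = 2l` and `k = l + j`. -/

/-- Coefficient of `E`. -/
def eCoef (q : ℝ) (N k : ℤ) : ℝ := qrt q (N - k) * qrt q (k + 1)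

/-- Coefficient of `F`. -/
def fCoef (q : ℝ) (N k : ℤ) : ℝ := qrt q (N - k + 1) * qrt q k

/-- Coefficient of `x_1`, from `l` to `l + 1`. -/
def upPlus (q : ℝ) (N k : ℤ) : ℝ :=
  q ^ (k - N) * qrt q (k + 1) * qrt q (k + 2) * (qrt q (N + 1))⁻¹ * (qrt q (N + 2))⁻¹

/-- Coefficient of `x_1`, from `l` to `l`, up to the sign. -/
def midPlus (q : ℝ) (N k : ℤ) : ℝ :=
  q ^ 2 * wt q N k * qrt q (N - k) * qrt q (k + 1) * qrt q 2 * (qint q N)⁻¹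

/-- Coefficient of `x_1`, from `l` to `l - 1`, up to the sign. -/
def downPlus (q : ℝ) (N k : ℤ) : ℝ :=
  q ^ (k + 1) * qrt q (N - k - 1) * qrt q (N - k) * (qrt q (N - 1))⁻¹ * (qrt q N)⁻¹

/-- Coefficient of `x_0`, from `l` to `l + 1`. -/
def upZero (q : ℝ) (N k : ℤ) : ℝ :=
  wt q N k * qrt q (N - k + 1) * qrt q (k + 1) * qrt q 2 * (qrt q (N + 1))⁻¹ * (qrt q (N + 2))⁻¹

/-- Coefficient of `x_0`, from `l` to `l`. -/
def midZero (q : ℝ) (N k : ℤ) : ℝ :=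
  1 - q ^ (k + 1) * qint q (N - k) * qint q 2 * (qint q N)⁻¹

/-- Coefficient of `x_0`, from `l` to `l - 1`. -/
def downZero (q : ℝ) (N k : ℤ) : ℝ :=
  wt q N k * qrt q (N - k) * qrt q k * qrt q 2 * (qrt q (N - 1))⁻¹ * (qrt q N)⁻¹

/-- Coefficient of `x_{-1}`, from `l` to `l + 1`. -/
def upMinus (q : ℝ) (N k : ℤ) : ℝ :=
  q ^ k * qrt q (N - k + 1) * qrt q (N - k + 2) * (qrt q (N + 1))⁻¹ * (qrt q (N + 2))⁻¹

/-- Coefficient of `x_{-1}`, from `l` to `l`. -/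
def midMinus (q : ℝ) (N k : ℤ) : ℝ :=
  wt q N k * qrt q (N - k + 1) * qrt q k * qrt q 2 * (qint q N)⁻¹

/-- Coefficient of `x_{-1}`, from `l` to `l - 1`, up to the sign. -/
def downMinus (q : ℝ) (N k : ℤ) : ℝ :=
  q ^ (k - N - 1) * qrt q (k - 1) * qrt q k * (qrt q (N - 1))⁻¹ * (qrt q N)⁻¹

section Coefficients

variable {q : ℝ}

theorem eCoef_sub_one (q : ℝ) (N k : ℤ) : eCoef q N (k - 1) = fCoef q N k := by
  rw [eCoef, fCoef]; ring_nf

theorem fCoef_add_one (q : ℝ) (N k : ℤ) : fCoef q N (k + 1) = eCoef q N k := by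
  rw [eCoef, fCoef]; ring_nf

/-! Adjoints. -/

/-- This and the next three identities are the entries of `x_1* = -q x_{-1}` and `x_0* = x_0`; the
minus sign is absorbed by the signs in `plusVec` and `minusVec`. -/
theorem upPlus_eq (h0 : 0 < q) (N k : ℤ) : upPlus q N k = q * downMinus q (N + 2) (k + 2) := by
  have := h0.ne'
  rw [upPlus, downMinus, show k + 2 - (N + 2) - 1 = k - N - 1 by ring,
    show k + 2 - 1 = k + 1 by ring, show N + 2 - 1 = N + 1 by ring, zpow_sub_one₀ this]
  field_simp

theorem midPlus_eq (h0 : 0 < q) (N k : ℤ) : midPlus q N k = q * midMinus q N (k + 1) := by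
  rw [midPlus, midMinus, show N - (k + 1) + 1 = N - k by ring, wt_add_one h0]
  ring

theorem downPlus_eq (h0 : 0 < q) (N k : ℤ) : downPlus q N k = q * upMinus q (N - 2) k := by
  rw [downPlus, upMinus, show N - 2 - k + 1 = N - k - 1 by ring,
    show N - 2 - k + 2 = N - k by ring, show N - 2 + 1 = N - 1 by ring,
    show N - 2 + 2 = N by ring, zpow_add_one₀ h0.ne']
  ring

theorem upZero_eq (q : ℝ) (N k : ℤ) : upZero q N k = downZero q (N + 2) (k + 1) := by
  rw [upZero, downZero, wt_add_two, show N + 2 - (k + 1) = N - k + 1 by ring,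
    show N + 2 - 1 = N + 1 by ring]

/-! Relations with `E` and `F`. -/

/-- The three components, `l` to `l + 1`, `l`, `l - 1`, of `E x_1 = q⁻¹ x_1 E`. The same square
roots occur on both sides, so no identity between quantum integers is needed. -/
theorem eCoef_upPlus (h0 : 0 < q) (N k : ℤ) :
    eCoef q (N + 2) (k + 2) * upPlus q N k = q⁻¹ * (eCoef q N k * upPlus q N (k + 1)) := by
  have := h0.ne'
  rw [eCoef, eCoef, upPlus, upPlus, show N + 2 - (k + 2) = N - k by ring,
    show k + 1 - N = k - N + 1 by ring, show k + 2 + 1 = k + 3 by ring,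
    show k + 1 + 1 = k + 2 by ring, show k + 1 + 2 = k + 3 by ring, zpow_add_one₀ this]
  field_simp

theorem eCoef_midPlus (h0 : 0 < q) (N k : ℤ) :
    eCoef q N (k + 1) * midPlus q N k = q⁻¹ * (eCoef q N k * midPlus q N (k + 1)) := by
  have := h0.ne'
  rw [eCoef, eCoef, midPlus, midPlus, wt_add_one h0]
  field_simp

theorem eCoef_downPlus (h0 : 0 < q) (N k : ℤ) :
    eCoef q (N - 2) k * downPlus q N k = q⁻¹ * (eCoef q N k * downPlus q N (k + 1)) := by
  have := h0.ne'
  rw [eCoef, eCoef, downPlus, downPlus, show N - (k + 1) - 1 = N - 2 - k by ring,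
    show N - (k + 1) = N - k - 1 by ring, zpow_add_one₀ this (k + 1)]
  field_simp

/-- The three components of `F x_1 - q⁻¹ x_1 F = [2]^{1/2} x_0 K`; the lemmas on `upZero`,
`midZero`, `downZero` treat `F x_0 - x_0 F = [2]^{1/2} x_{-1} K` in the same way. Each time the
common square roots factor out and the rational identity `id1` remains. -/
theorem fCoef_upPlus (h0 : 0 < q) (h1 : q < 1) {N k : ℤ} (hk : 0 ≤ k) :
    fCoef q (N + 2) (k + 2) * upPlus q N k - q⁻¹ * (fCoef q N k * upPlus q N (k - 1))
      = qrt q 2 * wt q N k * upZero q N k := by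
  have e1 := qrt_sq h0 h1 (m := k + 2) (by omega)
  have e2 := qrt_sq h0 h1 hk
  have e3 := qrt_sq h0 h1 (m := 2) (by omega)
  have e4 := wt_sq h0 N k
  have hq := h0.ne'
  have hl := (sub_inv_neg h0 h1).ne
  have id1 : q ^ (k - N) * qint q (k + 2) - q⁻¹ * (q ^ (k - 1 - N) * qint q k)
      = qint q 2 * (q ^ k * q ^ k * (q ^ N)⁻¹) := by
    have hk := zpow_ne_zero k hq
    have hN := zpow_ne_zero N hq
    rw [qint_two h0 h1]
    simp only [qint_eq, zpow_add₀ hq, zpow_sub₀ hq, zpow_one, zpow_ofNat]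
    have hl' : q ^ 2 - 1 ≠ 0 := by nlinarith
    field_simp
    ring
  rw [fCoef, fCoef, upPlus, upPlus, upZero, show N + 2 - (k + 2) = N - k by ring,
    show k - 1 + 1 = k by ring, show k - 1 + 2 = k + 1 by ring]
  rw [← e1, ← e2, ← e3, ← e4] at id1
  linear_combination (qrt q (N - k + 1) * qrt q (k + 1) * (qrt q (N + 1))⁻¹ *
    (qrt q (N + 2))⁻¹) * id1

/-- For `N = 0` the identity fails, since the inverse of `[0]` is read as `0` and `midZero` becomes
`1`. This is why the condition `b 0 = 0` for `l₀ = 0` is carried along later. -/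
theorem fCoef_midPlus (h0 : 0 < q) (h1 : q < 1) {N k : ℤ} (hk : 0 ≤ k) (hkN : k ≤ N)
    (hN : 0 < N) :
    fCoef q N (k + 1) * midPlus q N k - q⁻¹ * (fCoef q N k * midPlus q N (k - 1))
      = -(qrt q 2 * wt q N k * midZero q N k) := by
  have e1 := qrt_sq h0 h1 (m := k + 1) (by omega)
  have e2 := qrt_sq h0 h1 hk
  have e3 := qrt_sq h0 h1 (m := N - k) (by omega)
  have e4 := qrt_sq h0 h1 (m := N - k + 1) (by omega)
  have hq := h0.ne'
  have hNN := (qint_pos h0 h1 hN).ne'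
  have id1 : q ^ 2 * qint q (N - k) * qint q (k + 1) - qint q (N - k + 1) * qint q k
      = q ^ (k + 1) * qint q (N - k) * qint q 2 - qint q N := by
    have hk := zpow_ne_zero k hq
    have hN := zpow_ne_zero N hq
    rw [qint_two h0 h1]
    simp only [qint_eq, zpow_add₀ hq, zpow_sub₀ hq, zpow_one, zpow_ofNat]
    have hl' : q ^ 2 - 1 ≠ 0 := by nlinarith
    field_simp
    ring
  rw [fCoef, fCoef, midPlus, midPlus, midZero, wt_sub_one h0, show N - (k + 1) + 1 = N - k by ring,
    show k - 1 + 1 = k by ring, show N - (k - 1) = N - k + 1 by ring]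
  rw [← e1, ← e2, ← e3, ← e4] at id1
  rw [← e3]
  field_simp
  linear_combination (wt q N k * qrt q 2) * id1

theorem fCoef_downPlus (h0 : 0 < q) (h1 : q < 1) {N k : ℤ} (hkN : k ≤ N) :
    fCoef q (N - 2) k * downPlus q N k - q⁻¹ * (fCoef q N k * downPlus q N (k - 1))
      = -(qrt q 2 * wt q N k * downZero q N k) := by
  have hq := h0.ne'
  -- For `k = N` the argument `N - k - 1` is `-1`, where `qrt` does not square to `qint`; all terms
  -- vanish because they contain `qrt 0`.
  rcases hkN.eq_or_lt with rfl | hlt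
  · simp [downPlus, downZero, qrt_zero]
  have e1 := qrt_sq h0 h1 (m := N - k + 1) (by omega)
  have e2 := qrt_sq h0 h1 (m := N - k - 1) (by omega)
  have e3 := qrt_sq h0 h1 (m := 2) (by omega)
  have e4 := wt_sq h0 N k
  have id1 : q ^ (k + 1) * qint q (N - k - 1) - q⁻¹ * (q ^ k * qint q (N - k + 1))
      = - (qint q 2 * (q ^ k * q ^ k * (q ^ N)⁻¹)) := by
    have hk := zpow_ne_zero k hq
    have hN := zpow_ne_zero N hq
    rw [qint_two h0 h1]
    simp only [qint_eq, zpow_add₀ hq, zpow_sub₀ hq, zpow_one, zpow_ofNat]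
    have hl' : q ^ 2 - 1 ≠ 0 := by nlinarith
    field_simp
    ring
  rw [fCoef, fCoef, downPlus, downPlus, downZero, show N - 2 - k + 1 = N - k - 1 by ring,
    show k - 1 + 1 = k by ring, show N - (k - 1) - 1 = N - k by ring,
    show N - (k - 1) = N - k + 1 by ring]
  rw [← e1, ← e2, ← e3, ← e4] at id1
  linear_combination (qrt q (N - k) * qrt q k * (qrt q (N - 1))⁻¹ * (qrt q N)⁻¹) * id1

theorem fCoef_upZero (h0 : 0 < q) (h1 : q < 1) {N k : ℤ} (hk : 0 ≤ k) :
    fCoef q (N + 2) (k + 1) * upZero q N k - fCoef q N k * upZero q N (k - 1)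
      = qrt q 2 * wt q N k * upMinus q N k := by
  have hq := h0.ne'
  have e1 := qrt_sq h0 h1 (m := k + 1) (by omega)
  have e2 := qrt_sq h0 h1 hk
  have id1 : qint q (k + 1) - q⁻¹ * qint q k = q ^ k := by
    have hk := zpow_ne_zero k hq
    simp only [qint_eq, zpow_add₀ hq, zpow_one]
    have hl' : q ^ 2 - 1 ≠ 0 := by nlinarith
    field_simp
    ring
  rw [fCoef, fCoef, upZero, upZero, upMinus, wt_sub_one h0,
    show N + 2 - (k + 1) + 1 = N - k + 2 by ring,
    show k - 1 + 1 = k by ring, show N - (k - 1) + 1 = N - k + 2 by ring]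
  rw [← e1, ← e2] at id1
  linear_combination (wt q N k * qrt q 2 * qrt q (N - k + 1) * qrt q (N - k + 2) *
    (qrt q (N + 1))⁻¹ * (qrt q (N + 2))⁻¹) * id1

theorem fCoef_midZero (h0 : 0 < q) (h1 : q < 1) {N k : ℤ} :
    fCoef q N k * midZero q N k - fCoef q N k * midZero q N (k - 1)
      = qrt q 2 * wt q N k * midMinus q N k := by
  have hq := h0.ne'
  have e1 := qrt_sq h0 h1 (m := 2) (by omega)
  have e4 := wt_sq h0 N k
  have id1 : q ^ k * qint q (N - k + 1) - q ^ (k + 1) * qint q (N - k)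
      = q ^ k * q ^ k * (q ^ N)⁻¹ := by
    have hk := zpow_ne_zero k hq
    have hN := zpow_ne_zero N hq
    simp only [qint_eq, zpow_add₀ hq, zpow_sub₀ hq, zpow_one]
    have hl' : q ^ 2 - 1 ≠ 0 := by nlinarith
    field_simp
    ring
  rw [fCoef, midZero, midZero, midMinus, show k - 1 + 1 = k by ring,
    show N - (k - 1) = N - k + 1 by ring]
  rw [← e4] at id1
  rw [← e1]
  linear_combination (qrt q (N - k + 1) * qrt q k * qrt q 2 ^ 2 * (qint q N)⁻¹) * id1

theorem fCoef_downZero (h0 : 0 < q) (h1 : q < 1) {N k : ℤ} (hkN : k ≤ N) :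
    fCoef q (N - 2) (k - 1) * downZero q N k - fCoef q N k * downZero q N (k - 1)
      = -(qrt q 2 * wt q N k * downMinus q N k) := by
  have hq := h0.ne'
  have e1 := qrt_sq h0 h1 (m := N - k + 1) (by omega)
  have e2 := qrt_sq h0 h1 (m := N - k) (by omega)
  have id1 : qint q (N - k) - q⁻¹ * qint q (N - k + 1) = -q ^ (k - N - 1) := by
    have hk := zpow_ne_zero k hq
    have hN := zpow_ne_zero N hq
    simp only [qint_eq, zpow_add₀ hq, zpow_sub₀ hq, zpow_one]
    have hl' : q ^ 2 - 1 ≠ 0 := by nlinarith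
    field_simp
    ring
  rw [fCoef, fCoef, downZero, downZero, downMinus, wt_sub_one h0,
    show N - 2 - (k - 1) + 1 = N - k by ring, show N - (k - 1) = N - k + 1 by ring]
  rw [← e1, ← e2] at id1
  linear_combination (wt q N k * qrt q 2 * qrt q k * qrt q (k - 1) *
    (qrt q (N - 1))⁻¹ * (qrt q N)⁻¹) * id1

end Coefficients

/-! ### The reduced matrix elements -/

/-- The square root of the discriminant, `(κ + s²/4)^{1/2}`. -/
def discr (c : ℝ≥0∞) : ℝ := √(constCoeff c + linCoeff c ^ 2 / 4)

/-- The signed square root of the discriminant. -/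
def sgnDiscr (c : ℝ≥0∞) (ε : ℤˣ) : ℝ := ((ε : ℤ) : ℝ) * discr c

/-- The shift `(1 - q²) s / 2` that completes the square in the sphere relations. -/
def tauShift (q : ℝ) (c : ℝ≥0∞) : ℝ := (1 - q ^ 2) * linCoeff c / 2

/-- The term in braces in the formula for `α⁺(l,l)`, with `l = l₀ + n`. -/
def gammaCoef (q : ℝ) (c : ℝ≥0∞) (ε : ℤˣ) (N₀ : ℕ) (n : ℤ) : ℝ :=
  linCoeff c * ((q⁻¹ - q) / 2) * qint q (n + 1) * qint q (N₀ + n + 1)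
    + qint q N₀ * sgnDiscr c ε

/-- `β⁰(l,l)` for `l = l₀ + n`. -/
def betaCoef (q : QParam) (c : ℝ≥0∞) (ε : ℤˣ) (N₀ : ℕ) (n : ℤ) : ℝ :=
  beta q c ε (spin N₀ 0) (spin N₀ n)

/-- `α⁺(l,l)` for `l = l₀ + n`. -/
def alphaCoef (q : QParam) (c : ℝ≥0∞) (ε : ℤˣ) (N₀ : ℕ) (n : ℤ) : ℝ :=
  alpha q c ε (spin N₀ 0) (spin N₀ n)

section Scalars

variable {c : ℝ≥0∞} {ε : ℤˣ} {N₀ : ℕ}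

theorem linCoeff_nonneg (c : ℝ≥0∞) : 0 ≤ linCoeff c := by
  rw [linCoeff]; split_ifs <;> norm_num

theorem constCoeff_nonneg (c : ℝ≥0∞) : 0 ≤ constCoeff c := by
  rw [constCoeff]; split_ifs <;> simp

theorem discr_sq (c : ℝ≥0∞) : discr c ^ 2 = constCoeff c + linCoeff c ^ 2 / 4 :=
  Real.sq_sqrt (by have := constCoeff_nonneg c; positivity)

theorem discr_pos (c : ℝ≥0∞) : 0 < discr c := by
  apply Real.sqrt_pos.2
  have := constCoeff_nonneg c
  by_cases h : c = ⊤
  · simp [constCoeff, linCoeff, h]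
  · simp only [linCoeff, h, if_false]; positivity

/-- Only `κ ≥ 0` enters; this is the comparison of `s` and `ρ` used for positivity of the radicand
of `α⁺`. -/
theorem linCoeff_le_discr (c : ℝ≥0∞) : linCoeff c / 2 ≤ discr c := by
  apply Real.le_sqrt_of_sq_le
  have := constCoeff_nonneg c
  linarith [div_pow (linCoeff c) 2 2]

theorem sign_sq (ε : ℤˣ) : ((ε : ℤ) : ℝ) ^ 2 = 1 := by
  rcases Int.units_eq_one_or ε with rfl | rfl <;> norm_num

theorem sgnDiscr_sq (c : ℝ≥0∞) (ε : ℤˣ) : sgnDiscr c ε ^ 2 = discr c ^ 2 := by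
  rw [sgnDiscr, mul_pow, sign_sq, one_mul]

theorem abs_sgnDiscr (c : ℝ≥0∞) (ε : ℤˣ) : |sgnDiscr c ε| = discr c := by
  rw [← abs_of_pos (discr_pos c)]
  exact (sq_eq_sq_iff_abs_eq_abs _ _).1 (sgnDiscr_sq c ε)

theorem qint_mul_sum {q : ℝ} (h0 : 0 < q) (h1 : q < 1) (a b : ℤ) :
    (q⁻¹ - q) * (qint q a * qint q b) * (q⁻¹ - q)
      = q ^ (a + b) + (q ^ (a + b))⁻¹ - q ^ (a - b) - (q ^ (a - b))⁻¹ := by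
  have hq := h0.ne'
  have ha := zpow_ne_zero a hq
  have hb := zpow_ne_zero b hq
  have hl' : q ^ 2 - 1 ≠ 0 := by nlinarith
  simp only [qint_eq, zpow_add₀ hq, zpow_sub₀ hq]
  field_simp
  ring

/-- This telescoping identity is the reason why the explicit `β⁰` solves a first order recursion. -/
theorem qint_succ_mul_sub {q : ℝ} (h0 : 0 < q) (h1 : q < 1) (N : ℤ) (n : ℤ) :
    qint q (n + 1) * qint q (N + n + 1 + 1) - qint q n * qint q (N + n + 1)
      = qint q (N + 2 * n + 2) := by
  have hq := h0.ne'
  have hN := zpow_ne_zero N hq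
  have hn := zpow_ne_zero n hq
  have hl' : q ^ 2 - 1 ≠ 0 := by nlinarith
  simp only [qint_eq, zpow_add₀ hq, zpow_ofNat, two_mul]
  field_simp
  ring

variable {q : QParam}

/-- Both cases of `beta` have one form in `s` and `ρ`: `q⁻² λ_± - λ_∓ = (q⁻² - 1)/2 ± (q⁻² + 1) ρ`
for `c < ∞`, while `s = 0`, `ρ = 1` and `q⁻¹ [2] = q⁻² + 1` for `c = ∞`. -/
theorem betaCoef_eq (q : QParam) (c : ℝ≥0∞) (ε : ℤˣ) (N₀ : ℕ) (n : ℤ) :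
    betaCoef q c ε N₀ n = (qint q (N₀ + 2 * n + 2))⁻¹ *
      (qint q N₀ * ((((q : ℝ) ^ 2)⁻¹ - 1) * linCoeff c / 2 + (((q : ℝ) ^ 2)⁻¹ + 1) * sgnDiscr c ε)
        + linCoeff c * (((q : ℝ) ^ 2)⁻¹ - 1) * qint q n * qint q (N₀ + n + 1)) := by
  have a1 : qnum q (2 * spin N₀ n + 2) = qint q (N₀ + 2 * n + 2) := by
    rw [qint]; congr 1; simp only [spin]; push_cast; ring
  have a2 : qnum q (2 * spin N₀ 0) = qint q N₀ := by
    rw [qint]; congr 1; simp only [spin]; push_cast; ring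
  have a3 : qnum q (spin N₀ n - spin N₀ 0) = qint q n := by
    rw [qint]; congr 1; simp only [spin]; push_cast; ring
  have a4 : qnum q (spin N₀ n + spin N₀ 0 + 1) = qint q (N₀ + n + 1) := by
    rw [qint]; congr 1; simp only [spin]; push_cast; ring
  have a5 : qnum q 2 = (q : ℝ) + (q : ℝ)⁻¹ := by
    rw [← qint_two q.2.1 q.2.2, qint]; norm_num
  have hq : (q : ℝ) ≠ 0 := q.2.1.ne'
  rw [betaCoef, beta, a1, a2, a3, a4, a5]
  by_cases h : c = ⊤
  · simp only [h, if_true, linCoeff, constCoeff, sgnDiscr, discr]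
    norm_num
    left
    field_simp
    ring
  · simp only [h, if_false, linCoeff, constCoeff, sgnDiscr, discr, lamPM]
    norm_num
    left
    ring

theorem alphaCoef_eq (q : QParam) (c : ℝ≥0∞) (ε : ℤˣ) (N₀ : ℕ) (n : ℤ) :
    alphaCoef q c ε N₀ n = qrt q 2 * (qrt q (N₀ + 2 * n + 3))⁻¹ * (qrt q (N₀ + 2 * n + 2))⁻¹ *
      √(qint q (N₀ + 2 * n + 2) ^ 2 * discr c ^ 2 - gammaCoef q c ε N₀ n ^ 2) := by
  have a0 : qnum q (2 * spin N₀ n + 3) = qint q (N₀ + 2 * n + 3) := by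
    rw [qint]; congr 1; simp only [spin]; push_cast; ring
  have a1 : qnum q (2 * spin N₀ n + 2) = qint q (N₀ + 2 * n + 2) := by
    rw [qint]; congr 1; simp only [spin]; push_cast; ring
  have a2 : qnum q (2 * spin N₀ 0) = qint q N₀ := by
    rw [qint]; congr 1; simp only [spin]; push_cast; ring
  have a3 : qnum q (spin N₀ n - spin N₀ 0 + 1) = qint q (n + 1) := by
    rw [qint]; congr 1; simp only [spin]; push_cast; ring
  have a4 : qnum q (spin N₀ n + spin N₀ 0 + 1) = qint q (N₀ + n + 1) := by
    rw [qint]; congr 1; simp only [spin]; push_cast; ring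
  have a5 : qnum q 2 = qint q 2 := by
    rw [qint]; norm_num
  rw [alphaCoef, alpha, a0, a1, a2, a3, a4, a5]
  simp only [qrt]
  by_cases h : c = ⊤
  · simp only [h, if_true, gammaCoef, linCoeff]
    rw [zero_mul, zero_mul, zero_mul, zero_add, mul_pow, sgnDiscr_sq]
    simp [discr, constCoeff, linCoeff]
  · rw [discr_sq]
    simp only [h, if_false, gammaCoef, linCoeff, constCoeff, sgnDiscr, discr]
    norm_num
    left
    congr 1
    ring

/-- Here `γ = ± [N₀] ρ`, so the radicand is zero. Hence the terms towards `l₀ - 1` disappear by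
themselves. -/
theorem alphaCoef_neg_one (q : QParam) (c : ℝ≥0∞) (ε : ℤˣ) (N₀ : ℕ) :
    alphaCoef q c ε N₀ (-1) = 0 := by
  rw [alphaCoef_eq, show (N₀ : ℤ) + 2 * (-1) + 2 = N₀ by ring, gammaCoef,
    show (-1 : ℤ) + 1 = 0 by ring, qint_zero, mul_zero, zero_mul, zero_add, mul_pow, sgnDiscr_sq,
    sub_self, Real.sqrt_zero, mul_zero]

/-- By `s / 2 ≤ ρ` and the triangle inequality, `|γ|` is at most `ρ` times the left side of `key`.
-/
theorem abs_gammaCoef_lt (q : QParam) (c : ℝ≥0∞) (ε : ℤˣ) (N₀ : ℕ) {n : ℤ} (hn : 0 ≤ n) :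
    |gammaCoef q c ε N₀ n| < qint q (N₀ + 2 * n + 2) * discr c := by
  have h0 : (0 : ℝ) < q := q.2.1
  have h1 : (q : ℝ) < 1 := q.2.2
  have hd := discr_pos c
  have hl := linCoeff_le_discr c
  have hl0 := linCoeff_nonneg c
  have hneg : 0 < (q : ℝ)⁻¹ - q := by have := sub_inv_neg h0 h1; linarith
  have p1 := qint_nonneg h0 h1 (m := n + 1) (by omega)
  have p2 := qint_nonneg h0 h1 (m := N₀ + n + 1) (by omega)
  have p3 := qint_nonneg h0 h1 (m := N₀) (by omega)
  have p4 : (q : ℝ) ^ ((N₀ : ℤ) + 2 * n + 2) < (q : ℝ) ^ (N₀ : ℤ) :=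
    zpow_lt_zpow_right_of_lt_one₀ h0 h1 (by omega)
  -- After multiplication by `q⁻¹ - q` the right side exceeds the left one by `2 (q ^ N₀ - q ^ (N₀ +
  -- 2n + 2))`.
  have key : ((q : ℝ)⁻¹ - q) * (qint q (n + 1) * qint q (N₀ + n + 1)) + qint q N₀
      < qint q (N₀ + 2 * n + 2) := by
    have e := qint_mul_sum h0 h1 (n + 1) (N₀ + n + 1)
    rw [show n + 1 + ((N₀ : ℤ) + n + 1) = N₀ + 2 * n + 2 by ring,
      show n + 1 - ((N₀ : ℤ) + n + 1) = -(N₀ : ℤ) by ring, zpow_neg, inv_inv] at e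
    have e2 : qint q N₀ * ((q : ℝ)⁻¹ - q) = ((q : ℝ) ^ (N₀ : ℤ))⁻¹ - (q : ℝ) ^ (N₀ : ℤ) := by
      rw [qint_eq, show (q : ℝ)⁻¹ - q = -(q - (q : ℝ)⁻¹) by ring, mul_neg,
        div_mul_cancel₀ _ (sub_inv_neg h0 h1).ne]
      ring
    have e3 : qint q (N₀ + 2 * n + 2) * ((q : ℝ)⁻¹ - q)
        = ((q : ℝ) ^ ((N₀ : ℤ) + 2 * n + 2))⁻¹ - (q : ℝ) ^ ((N₀ : ℤ) + 2 * n + 2) := by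
      rw [qint_eq, show (q : ℝ)⁻¹ - q = -(q - (q : ℝ)⁻¹) by ring, mul_neg,
        div_mul_cancel₀ _ (sub_inv_neg h0 h1).ne]
      ring
    refine lt_of_mul_lt_mul_right ?_ hneg.le
    rw [add_mul, e, e2, e3]
    linarith
  calc |gammaCoef q c ε N₀ n|
      ≤ |linCoeff c * (((q : ℝ)⁻¹ - q) / 2) * qint q (n + 1) * qint q (N₀ + n + 1)|
        + |qint q N₀ * sgnDiscr c ε| := abs_add_le _ _
    _ = linCoeff c / 2 * (((q : ℝ)⁻¹ - q) * (qint q (n + 1) * qint q (N₀ + n + 1)))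
        + qint q N₀ * discr c := by
        rw [abs_mul (qint q N₀), abs_sgnDiscr, abs_of_nonneg p3, abs_of_nonneg (by positivity)]
        ring
    _ ≤ discr c * (((q : ℝ)⁻¹ - q) * (qint q (n + 1) * qint q (N₀ + n + 1)))
        + qint q N₀ * discr c := by gcongr
    _ = (((q : ℝ)⁻¹ - q) * (qint q (n + 1) * qint q (N₀ + n + 1)) + qint q N₀) * discr c := by ring
    _ < _ := by gcongr

theorem radicand_pos (q : QParam) (c : ℝ≥0∞) (ε : ℤˣ) (N₀ : ℕ) {n : ℤ} (hn : 0 ≤ n) :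
    0 < qint q (N₀ + 2 * n + 2) ^ 2 * discr c ^ 2 - gammaCoef q c ε N₀ n ^ 2 := by
  rw [← mul_pow, sub_pos]
  exact sq_lt_sq' (by linarith [neg_abs_le (gammaCoef q c ε N₀ n), abs_gammaCoef_lt q c ε N₀ hn])
    (lt_of_le_of_lt (le_abs_self _) (abs_gammaCoef_lt q c ε N₀ hn))

theorem alphaCoef_pos (q : QParam) (c : ℝ≥0∞) (ε : ℤˣ) (N₀ : ℕ) {n : ℤ} (hn : 0 ≤ n) :
    0 < alphaCoef q c ε N₀ n := by
  rw [alphaCoef_eq]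
  have p1 := qrt_pos q.2.1 q.2.2 (m := 2) (by omega)
  have p2 := qrt_pos q.2.1 q.2.2 (m := N₀ + 2 * n + 3) (by omega)
  have p3 := qrt_pos q.2.1 q.2.2 (m := N₀ + 2 * n + 2) (by omega)
  have p4 := Real.sqrt_pos.2 (radicand_pos q c ε N₀ hn)
  positivity

theorem alphaCoef_sq (q : QParam) (c : ℝ≥0∞) (ε : ℤˣ) (N₀ : ℕ) {n : ℤ} (hn : 0 ≤ n) :
    alphaCoef q c ε N₀ n ^ 2 * (qint q (N₀ + 2 * n + 3) * qint q (N₀ + 2 * n + 2)) =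
      qint q 2 * (qint q (N₀ + 2 * n + 2) ^ 2 * discr c ^ 2 - gammaCoef q c ε N₀ n ^ 2) := by
  have e1 := qrt_sq q.2.1 q.2.2 (m := 2) (by omega)
  have e2 := qrt_sq q.2.1 q.2.2 (m := N₀ + 2 * n + 3) (by omega)
  have e3 := qrt_sq q.2.1 q.2.2 (m := N₀ + 2 * n + 2) (by omega)
  have p2 := (qrt_pos q.2.1 q.2.2 (m := N₀ + 2 * n + 3) (by omega)).ne'
  have p3 := (qrt_pos q.2.1 q.2.2 (m := N₀ + 2 * n + 2) (by omega)).ne'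
  rw [alphaCoef_eq, mul_pow, Real.sq_sqrt (radicand_pos q c ε N₀ hn).le, ← e1, ← e2, ← e3]
  field_simp

/-- In terms of `γ(n)`, the equation from `x_{-1} x_1` becomes the defining formula for `α⁺(n)²`. -/
theorem gammaCoef_eq (q : QParam) (c : ℝ≥0∞) (ε : ℤˣ) (N₀ : ℕ) {n : ℤ} (hn : 0 ≤ n) :
    (q : ℝ) * qint q 2 * gammaCoef q c ε N₀ n
      = qint q (N₀ + 2 * n + 2) * ((q : ℝ) ^ 2 * betaCoef q c ε N₀ n + tauShift q c) := by
  have h0 : (0 : ℝ) < q := q.2.1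
  have h1 : (q : ℝ) < 1 := q.2.2
  have hq := h0.ne'
  have hne := (qint_pos h0 h1 (m := N₀ + 2 * n + 2) (by omega)).ne'
  have id1 : ((q : ℝ) + (q : ℝ)⁻¹) * (qint q (n + 1) * qint q (N₀ + n + 1))
      = 2 * (qint q n * qint q (N₀ + n + 1)) + qint q N₀ + qint q (N₀ + 2 * n + 2) := by
    have hN := zpow_ne_zero N₀ hq
    have hn := zpow_ne_zero n hq
    have hl' : (q : ℝ) ^ 2 - 1 ≠ 0 := by nlinarith
    simp only [qint_eq, zpow_add₀ hq, zpow_ofNat, zpow_natCast, two_mul]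
    field_simp
    ring
  rw [betaCoef_eq, mul_add, mul_left_comm, mul_inv_cancel_left₀ hne, gammaCoef, tauShift,
    qint_two h0 h1]
  field_simp at id1 ⊢
  linear_combination (linCoeff c * (1 - (q : ℝ) ^ 2)) * id1

/-- The right side is the expression squared in the equation from `x_1 x_{-1}`. So that equation is
the formula for `α⁺` at `n - 1`, and the two sphere relations are compatible. -/
theorem gammaCoef_sub_one_eq (q : QParam) (c : ℝ≥0∞) (ε : ℤˣ) (N₀ : ℕ) {n : ℤ} (hn : 0 ≤ n) :
    (q : ℝ) * qint q 2 * gammaCoef q c ε N₀ (n - 1)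
      = qint q (N₀ + 2 * n + 2) * ((q : ℝ) ^ 2 * betaCoef q c ε N₀ n)
        - tauShift q c * qint q (N₀ + 2 * n) := by
  have h0 : (0 : ℝ) < q := q.2.1
  have h1 : (q : ℝ) < 1 := q.2.2
  have hq := h0.ne'
  have hne := (qint_pos h0 h1 (m := N₀ + 2 * n + 2) (by omega)).ne'
  have id1 : ((q : ℝ) + (q : ℝ)⁻¹) * (qint q n * qint q (N₀ + n))
      = 2 * (qint q n * qint q (N₀ + n + 1)) + qint q N₀ - qint q (N₀ + 2 * n) := by
    have hN := zpow_ne_zero N₀ hq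
    have hn := zpow_ne_zero n hq
    have hl' : (q : ℝ) ^ 2 - 1 ≠ 0 := by nlinarith
    simp only [qint_eq, zpow_add₀ hq, zpow_ofNat, zpow_natCast, two_mul]
    field_simp
    ring
  rw [betaCoef_eq, mul_left_comm, mul_inv_cancel_left₀ hne, gammaCoef, tauShift,
    qint_two h0 h1, sub_add_cancel, show (N₀ : ℤ) + (n - 1) + 1 = N₀ + n by ring]
  field_simp at id1 ⊢
  linear_combination (linCoeff c * (1 - (q : ℝ) ^ 2)) * id1

theorem betaCoef_succ (q : QParam) (c : ℝ≥0∞) (ε : ℤˣ) (N₀ : ℕ) {n : ℤ} (hn : 0 ≤ n) :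
    (q : ℝ) ^ 2 * qint q (N₀ + 2 * n + 4) * betaCoef q c ε N₀ (n + 1)
      = qint q (N₀ + 2 * n + 2) * ((q : ℝ) ^ 2 * betaCoef q c ε N₀ n + 2 * tauShift q c) := by
  have h0 : (0 : ℝ) < q := q.2.1
  have h1 : (q : ℝ) < 1 := q.2.2
  have hq := h0.ne'
  have hne := (qint_pos h0 h1 (m := N₀ + 2 * n + 2) (by omega)).ne'
  have hne' := (qint_pos h0 h1 (m := N₀ + 2 * n + 4) (by omega)).ne'
  have id1 := qint_succ_mul_sub h0 h1 N₀ n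
  have e1 := eq_inv_mul_iff_mul_eq₀ hne |>.1 (betaCoef_eq q c ε N₀ n)
  have e2 := betaCoef_eq q c ε N₀ (n + 1)
  rw [show (N₀ : ℤ) + 2 * (n + 1) + 2 = N₀ + 2 * n + 4 by ring,
    show (N₀ : ℤ) + (n + 1) + 1 = N₀ + n + 1 + 1 by ring, eq_inv_mul_iff_mul_eq₀ hne'] at e2
  rw [mul_assoc, e2, mul_add (qint q (N₀ + 2 * n + 2)), mul_left_comm (qint q (N₀ + 2 * n + 2)),
    e1, tauShift]
  field_simp
  linear_combination (linCoeff c * 2 * (1 - (q : ℝ) ^ 2)) * id1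

/-- Elimination of `a²` between the two relations on the highest weight vector. -/
theorem quadratic_iff {q : ℝ} (h0 : 0 < q) (h1 : q < 1) {N : ℤ} (hN : 0 < N) {b τ ρ a2 a2' : ℝ}
    (hH : (q ^ 2 * b + τ) ^ 2 + q ^ 2 * qint q 2 * qint q (N + 3) * (qint q (N + 2))⁻¹ * a2
      = q ^ 2 * qint q 2 ^ 2 * ρ ^ 2) :
    (b - τ) ^ 2 + q ^ N * qint q 2 * (qint q (N + 2))⁻¹ * a2
      + q ^ 3 * qint q 2 * (q ^ N * q ^ N * qint q 2 * (qint q (N + 1))⁻¹ * (qint q (N + 2))⁻¹ * a2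
        + q ^ N * qint q 2 * (qint q N)⁻¹ * b ^ 2 + (q ^ 2)⁻¹ * a2') = q ^ 2 * qint q 2 ^ 2 * ρ ^ 2
    ↔ q ^ 2 * qint q 2 ^ 2 * (qint q N * qint q (N + 1)) * a2' =
      qint q 2 * (q ^ 2 * qint q 2 ^ 2 * qint q N ^ 2 * ρ ^ 2
        - (qint q (N + 2) * (q ^ 2 * b) - τ * qint q N) ^ 2) := by
  have p2 := (qint_pos h0 h1 (m := N + 2) (by omega)).ne'
  have p3 := (qint_pos h0 h1 (m := N + 3) (by omega)).ne'
  have p1 := (qint_pos h0 h1 (m := N + 1) (by omega)).ne'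
  have p0 := (qint_pos h0 h1 hN).ne'
  have pp := (qint_pos h0 h1 (m := 2) (by omega)).ne'
  have hq := h0.ne'
  -- The hypothesis is linear in `a2`, so it can be solved and substituted.
  have ha : a2 = (q ^ 2 * qint q 2 ^ 2 * ρ ^ 2 - (q ^ 2 * b + τ) ^ 2) * qint q (N + 2) /
      (q ^ 2 * qint q 2 * qint q (N + 3)) := by
    field_simp
    field_simp at hH
    linarith
  -- After the substitution the two equations differ by an explicit nonzero factor.
  have key : (b - τ) ^ 2 + q ^ N * qint q 2 * (qint q (N + 2))⁻¹ * a2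
      + q ^ 3 * qint q 2 * (q ^ N * q ^ N * qint q 2 * (qint q (N + 1))⁻¹ * (qint q (N + 2))⁻¹ * a2
        + q ^ N * qint q 2 * (qint q N)⁻¹ * b ^ 2 + (q ^ 2)⁻¹ * a2') - q ^ 2 * qint q 2 ^ 2 * ρ ^ 2
      = (q ^ 2 * qint q 2 ^ 2 * (qint q N * qint q (N + 1)) * a2' -
      qint q 2 * (q ^ 2 * qint q 2 ^ 2 * qint q N ^ 2 * ρ ^ 2
        - (qint q (N + 2) * (q ^ 2 * b) - τ * qint q N) ^ 2)) *
        (q * qint q 2 / (q ^ 2 * qint q 2 ^ 2 * (qint q N * qint q (N + 1)))) := by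
    have hN := zpow_ne_zero N hq
    have hl' : q ^ 2 - 1 ≠ 0 := by nlinarith
    rw [ha]
    field_simp
    simp only [qint_eq, zpow_add₀ hq, zpow_one, zpow_ofNat]
    field_simp
    ring
  have hk : q * qint q 2 / (q ^ 2 * qint q 2 ^ 2 * (qint q N * qint q (N + 1))) ≠ 0 := by
    positivity
  rw [← sub_eq_zero, key, mul_eq_zero, or_iff_left hk, sub_eq_zero]

end Scalars

/-! ### Operators of Wigner-Eckart form -/

section Forms

variable {D : Type*} [NormedAddCommGroup D] [InnerProductSpace ℂ D] {N₀ : ℕ}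

/-- The pair `(n, k)` labels one of the vectors `v^l_j`. -/
def IsLabel (N₀ : ℕ) (n k : ℤ) : Prop := 0 ≤ n ∧ 0 ≤ k ∧ k ≤ N₀ + 2 * n

theorem vec_natCast (v : SpinIndex N₀ → D) (n : ℕ) (k : Fin (N₀ + 2 * n + 1)) :
    vec v n k = v ⟨n, k⟩ := by
  have hk := k.2
  rw [vec, dif_pos ⟨by omega, by omega, by omega⟩]
  rfl

theorem vec_eq_zero (v : SpinIndex N₀ → D) {n k : ℤ} (h : ¬ IsLabel N₀ n k) : vec v n k = 0 :=
  dif_neg h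

theorem IsLabel.exists_nat {n k : ℤ} (h : IsLabel N₀ n k) :
    ∃ (m : ℕ) (p : Fin (N₀ + 2 * m + 1)), n = m ∧ k = p := by
  obtain ⟨h1, h2, h3⟩ := h
  refine ⟨n.toNat, ⟨k.toNat, by omega⟩, by omega, ?_⟩
  simp only [Int.toNat_of_nonneg h2]

theorem isLabel_natCast (n : ℕ) (k : Fin (N₀ + 2 * n + 1)) : IsLabel N₀ n k := by
  have hk := k.2
  exact ⟨by omega, by omega, by omega⟩

/-- One of the two index pairs has to be a label: two equal pairs outside the range give the inner
product `0`, not `1`. `inner_vec'` has the condition on the other side. -/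
theorem inner_vec {v : SpinIndex N₀ → D} (hv : Orthonormal ℂ v) {n k n' k' : ℤ}
    (h : IsLabel N₀ n k) :
    ⟪vec v n k, vec v n' k'⟫_ℂ = if n = n' ∧ k = k' then 1 else 0 := by
  by_cases h' : IsLabel N₀ n' k'
  · obtain ⟨m, p, rfl, rfl⟩ := h.exists_nat
    obtain ⟨m', p', rfl, rfl⟩ := h'.exists_nat
    rw [vec_natCast, vec_natCast, orthonormal_iff_ite.1 hv]
    congr 1
    apply propext
    constructor
    · intro e
      cases e
      exact ⟨rfl, rfl⟩
    · rintro ⟨e1, e2⟩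
      have e1 : m = m' := by exact_mod_cast e1
      subst e1
      have : p = p' := Fin.ext (by exact_mod_cast e2)
      rw [this]
  · rw [vec_eq_zero v h', inner_zero_right, if_neg]
    rintro ⟨rfl, rfl⟩
    exact h' h

theorem inner_vec' {v : SpinIndex N₀ → D} (hv : Orthonormal ℂ v) {n k n' k' : ℤ}
    (h : IsLabel N₀ n' k') :
    ⟪vec v n k, vec v n' k'⟫_ℂ = if n = n' ∧ k = k' then 1 else 0 := by
  rw [← inner_conj_symm, inner_vec hv h, apply_ite (starRingEnd ℂ), map_one, map_zero]
  congr 1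
  exact propext ⟨fun h => ⟨h.1.symm, h.2.symm⟩, fun h => ⟨h.1.symm, h.2.symm⟩⟩

/-- Identities can be checked on matrix elements even when the `v^l_j` only have dense span in the
domain, as in the last part of the theorem. -/
theorem eq_zero_of_inner_vec {v : SpinIndex N₀ → D} (hd : SpansDense v) {x : D}
    (h : ∀ n k : ℤ, IsLabel N₀ n k → ⟪vec v n k, x⟫_ℂ = 0) : x = 0 := by
  have hK : Dense ((Submodule.span ℂ (Set.range v) : Submodule ℂ D) : Set D) :=
    Submodule.dense_iff_topologicalClosure_eq_top.2 hd
  refine hK.eq_zero_of_mem_orthogonal (𝕜 := ℂ) ?_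
  rw [Submodule.mem_orthogonal]
  intro u hu
  induction hu using Submodule.span_induction with
  | mem u hu =>
    obtain ⟨⟨n, k⟩, rfl⟩ := hu
    rw [← vec_natCast v n k]
    exact h _ _ (isLabel_natCast n k)
  | zero => exact inner_zero_left _
  | add u w _ _ hu hw => rw [inner_add_left, hu, hw, add_zero]
  | smul z u _ hu => rw [inner_smul_left, hu, mul_zero]

theorem Spans.dense {v : SpinIndex N₀ → D} (h : Spans v) : SpansDense v := by
  rw [SpansDense, show Submodule.span ℂ (Set.range v) = ⊤ from h]
  exact top_unique (Submodule.le_topologicalClosure _)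

theorem Spans.hom_ext {v : SpinIndex N₀ → D} (hs : Spans v) {M : Type*} [AddCommGroup M]
    [Module ℂ M] {S T : D →ₗ[ℂ] M}
    (h : ∀ n k : ℤ, IsLabel N₀ n k → S (vec v n k) = T (vec v n k)) : S = T := by
  refine LinearMap.ext_on_range hs ?_
  rintro ⟨n, k⟩
  rw [← vec_natCast v n k]
  exact h _ _ (isLabel_natCast n k)

/-- The operators `E, F, K` act on `v` as in the sum of the spin representations. -/
structure IsLadder (q : ℝ) (v : SpinIndex N₀ → D) (E F K : Module.End ℂ D) : Prop where
  E_vec : ∀ n k : ℤ, E (vec v n k) = (eCoef q (N₀ + 2 * n) k : ℂ) • vec v n (k + 1)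
  F_vec : ∀ n k : ℤ, F (vec v n k) = (fCoef q (N₀ + 2 * n) k : ℂ) • vec v n (k - 1)
  K_vec : ∀ n k : ℤ, K (vec v n k) = (wt q (N₀ + 2 * n) k : ℂ) • vec v n k

/-- The image of `v^l_j` under `x_1`, with reduced matrix elements `a, b, d`. -/
def plusVec (q : ℝ) (a b d : ℤ → ℂ) (v : SpinIndex N₀ → D) (n k : ℤ) : D :=
  ((upPlus q (N₀ + 2 * n) k : ℂ) * a n) • vec v (n + 1) (k + 2)
    - ((midPlus q (N₀ + 2 * n) k : ℂ) * b n) • vec v n (k + 1)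
    - ((downPlus q (N₀ + 2 * n) k : ℂ) * d n) • vec v (n - 1) k

/-- The image of `v^l_j` under `x_0`, with reduced matrix elements `a, b, d`. -/
def zeroVec (q : ℝ) (a b d : ℤ → ℂ) (v : SpinIndex N₀ → D) (n k : ℤ) : D :=
  ((upZero q (N₀ + 2 * n) k : ℂ) * a n) • vec v (n + 1) (k + 1)
    + ((midZero q (N₀ + 2 * n) k : ℂ) * b n) • vec v n k
    + ((downZero q (N₀ + 2 * n) k : ℂ) * d n) • vec v (n - 1) (k - 1)

/-- The image of `v^l_j` under `x_{-1}`, with reduced matrix elements `a, b, d`. -/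
def minusVec (q : ℝ) (a b d : ℤ → ℂ) (v : SpinIndex N₀ → D) (n k : ℤ) : D :=
  ((upMinus q (N₀ + 2 * n) k : ℂ) * a n) • vec v (n + 1) k
    + ((midMinus q (N₀ + 2 * n) k : ℂ) * b n) • vec v n (k - 1)
    - ((downMinus q (N₀ + 2 * n) k : ℂ) * d n) • vec v (n - 1) (k - 2)

variable {q : ℝ} {a b d : ℤ → ℂ} {v : SpinIndex N₀ → D} {n k : ℤ}

/-- The formulas thus hold for all integers `n` and `k`, without boundary cases. A term whose target
is a label while its source is not has a vanishing coefficient; for `n = -1` this coefficient is `a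
(-1)`. -/
theorem plusVec_eq_zero (h0 : 0 < q) (h1 : q < 1) (ha : a (-1) = 0) (h : ¬ IsLabel N₀ n k) :
    plusVec q a b d v n k = 0 := by
  have z : ∀ m : ℤ, m ≤ 0 → qrt q m = 0 := fun m => qrt_of_nonpos h0 h1
  have e1 : ((upPlus q (N₀ + 2 * n) k : ℂ) * a n) • vec v (n + 1) (k + 2) = 0 := by
    by_cases h' : IsLabel N₀ (n + 1) (k + 2)
    · obtain ⟨h1, h2, h3⟩ := h'
      rcases h1.eq_or_lt with hn | hn
      · obtain rfl : n = -1 := by omega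
        rw [ha, mul_zero, zero_smul]
      · have hk : k + 1 ≤ 0 := by
          by_contra hk
          exact h ⟨by omega, by omega, by omega⟩
        rw [upPlus, z _ hk]; simp
    · rw [vec_eq_zero v h', smul_zero]
  have e2 : ((midPlus q (N₀ + 2 * n) k : ℂ) * b n) • vec v n (k + 1) = 0 := by
    by_cases h' : IsLabel N₀ n (k + 1)
    · obtain ⟨h1, h2, h3⟩ := h'
      have hk : k + 1 ≤ 0 := by
        by_contra hk
        exact h ⟨by omega, by omega, by omega⟩
      rw [midPlus, z _ hk]; simp
    · rw [vec_eq_zero v h', smul_zero]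
  have e3 : vec v (n - 1) k = 0 :=
    vec_eq_zero v fun ⟨h1, h2, h3⟩ => h ⟨by omega, by omega, by omega⟩
  rw [plusVec, e1, e2, e3, smul_zero, sub_zero, sub_zero]

theorem zeroVec_eq_zero (h0 : 0 < q) (h1 : q < 1) (ha : a (-1) = 0) (h : ¬ IsLabel N₀ n k) :
    zeroVec q a b d v n k = 0 := by
  have z : ∀ m : ℤ, m ≤ 0 → qrt q m = 0 := fun m => qrt_of_nonpos h0 h1
  have e1 : ((upZero q (N₀ + 2 * n) k : ℂ) * a n) • vec v (n + 1) (k + 1) = 0 := by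
    by_cases h' : IsLabel N₀ (n + 1) (k + 1)
    · obtain ⟨h1, h2, h3⟩ := h'
      rcases h1.eq_or_lt with hn | hn
      · obtain rfl : n = -1 := by omega
        rw [ha, mul_zero, zero_smul]
      · rcases le_or_gt (k + 1) 0 with hk | hk
        · rw [upZero, z _ hk]; simp
        · have hk : (N₀ : ℤ) + 2 * n - k + 1 ≤ 0 := by
            by_contra hk'
            exact h ⟨by omega, by omega, by omega⟩
          rw [upZero, z _ hk]; simp
    · rw [vec_eq_zero v h', smul_zero]
  have e3 : vec v (n - 1) (k - 1) = 0 :=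
    vec_eq_zero v fun ⟨h1, h2, h3⟩ => h ⟨by omega, by omega, by omega⟩
  rw [zeroVec, e1, vec_eq_zero v h, e3, smul_zero, smul_zero, add_zero, add_zero]

theorem minusVec_eq_zero (h0 : 0 < q) (h1 : q < 1) (ha : a (-1) = 0) (h : ¬ IsLabel N₀ n k) :
    minusVec q a b d v n k = 0 := by
  have z : ∀ m : ℤ, m ≤ 0 → qrt q m = 0 := fun m => qrt_of_nonpos h0 h1
  have e1 : ((upMinus q (N₀ + 2 * n) k : ℂ) * a n) • vec v (n + 1) k = 0 := by
    by_cases h' : IsLabel N₀ (n + 1) k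
    · obtain ⟨h1, h2, h3⟩ := h'
      rcases h1.eq_or_lt with hn | hn
      · obtain rfl : n = -1 := by omega
        rw [ha, mul_zero, zero_smul]
      · have hk : (N₀ : ℤ) + 2 * n - k + 1 ≤ 0 := by
          by_contra hk'
          exact h ⟨by omega, by omega, by omega⟩
        rw [upMinus, z _ hk]; simp
    · rw [vec_eq_zero v h', smul_zero]
  have e2 : ((midMinus q (N₀ + 2 * n) k : ℂ) * b n) • vec v n (k - 1) = 0 := by
    by_cases h' : IsLabel N₀ n (k - 1)
    · obtain ⟨h1, h2, h3⟩ := h'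
      have hk : (N₀ : ℤ) + 2 * n - k + 1 ≤ 0 := by
        by_contra hk
        exact h ⟨by omega, by omega, by omega⟩
      rw [midMinus, z _ hk]; simp
    · rw [vec_eq_zero v h', smul_zero]
  have e3 : vec v (n - 1) (k - 2) = 0 :=
    vec_eq_zero v fun ⟨h1, h2, h3⟩ => h ⟨by omega, by omega, by omega⟩
  rw [minusVec, e1, e2, e3, smul_zero, add_zero, sub_zero]

variable {E F K T : Module.End ℂ D}

/-- `x_1` commutes with `E` up to a factor. -/
theorem E_plusVec (h0 : 0 < q) (hL : IsLadder q v E F K) (a b d : ℤ → ℂ) (n k : ℤ) :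
    E (plusVec q a b d v n k)
      = ((q⁻¹ * eCoef q (N₀ + 2 * n) k : ℝ) : ℂ) • plusVec q a b d v n (k + 1) := by
  have c1 := congrArg Complex.ofReal (eCoef_upPlus h0 (N₀ + 2 * n) k)
  have c2 := congrArg Complex.ofReal (eCoef_midPlus h0 (N₀ + 2 * n) k)
  have c3 := congrArg Complex.ofReal (eCoef_downPlus h0 (N₀ + 2 * n) k)
  push_cast at c1 c2 c3
  simp only [plusVec, map_sub, map_smul, hL.E_vec,
    show (N₀ : ℤ) + 2 * (n + 1) = N₀ + 2 * n + 2 by ring,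
    show (N₀ : ℤ) + 2 * (n - 1) = N₀ + 2 * n - 2 by ring,
    show k + 1 + 2 = k + 2 + 1 by ring]
  push_cast
  match_scalars
  · linear_combination (a n) * c1
  · linear_combination (-b n) * c2
  · linear_combination (-d n) * c3

/-- The vectors `x_1 v^l_j` are weight vectors. -/
theorem K_plusVec (h0 : 0 < q) (hL : IsLadder q v E F K) (a b d : ℤ → ℂ) (n k : ℤ) :
    K (plusVec q a b d v n k)
      = ((q * wt q (N₀ + 2 * n) k : ℝ) : ℂ) • plusVec q a b d v n k := by
  have c1 : wt q (N₀ + 2 * n + 2) (k + 2) = q * wt q (N₀ + 2 * n) k := by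
    rw [show k + 2 = k + 1 + 1 by ring, wt_add_two, wt_add_one h0, mul_comm]
  have c2 : wt q (N₀ + 2 * n) (k + 1) = q * wt q (N₀ + 2 * n) k := by
    rw [wt_add_one h0, mul_comm]
  have c3 : wt q (N₀ + 2 * n - 2) k = q * wt q (N₀ + 2 * n) k := by
    rw [← c2, ← wt_sub_two q _ (k + 1), add_sub_cancel_right]
  simp only [plusVec, map_sub, map_smul, hL.K_vec,
    show (N₀ : ℤ) + 2 * (n + 1) = N₀ + 2 * n + 2 by ring,
    show (N₀ : ℤ) + 2 * (n - 1) = N₀ + 2 * n - 2 by ring, c1, c2, c3]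
  push_cast
  module

/-- The cross relation of `F` and `x_1` gives the action of `x_0`. -/
theorem F_plusVec (h0 : 0 < q) (h1 : q < 1) (hL : IsLadder q v E F K)
    (hT : ∀ n k, T (vec v n k) = plusVec q a b d v n k) (hb : N₀ = 0 → b 0 = 0)
    (h : IsLabel N₀ n k) :
    F (T (vec v n k)) = ((q⁻¹ : ℝ) : ℂ) • T (F (vec v n k))
      + ((qrt q 2 * wt q (N₀ + 2 * n) k : ℝ) : ℂ) • zeroVec q a b d v n k := by
  obtain ⟨hn, hk, hkN⟩ := h
  have c1 := congrArg Complex.ofReal (fCoef_upPlus h0 h1 (N := N₀ + 2 * n) hk)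
  have c2 : (fCoef q (N₀ + 2 * n) (k + 1) : ℂ) * (midPlus q (N₀ + 2 * n) k : ℂ) * b n
      - (q : ℂ)⁻¹ * ((fCoef q (N₀ + 2 * n) k : ℂ) * (midPlus q (N₀ + 2 * n) (k - 1) : ℂ)) * b n
      = -((qrt q 2 : ℂ) * (wt q (N₀ + 2 * n) k : ℂ) * (midZero q (N₀ + 2 * n) k : ℂ)) * b n := by
    rcases Nat.eq_zero_or_pos N₀ with h | h
    · rcases hn.eq_or_lt with rfl | hn
      · rw [hb h]; simp
      · have := congrArg Complex.ofReal (fCoef_midPlus h0 h1 (N := N₀ + 2 * n) hk hkN (by omega))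
        push_cast at this
        linear_combination (b n) * this
    · have := congrArg Complex.ofReal (fCoef_midPlus h0 h1 (N := N₀ + 2 * n) hk hkN (by omega))
      push_cast at this
      linear_combination (b n) * this
  have c3 := congrArg Complex.ofReal (fCoef_downPlus h0 h1 (N := N₀ + 2 * n) hkN)
  push_cast at c1 c3
  rw [hL.F_vec, map_smul, hT, hT]
  simp only [plusVec, zeroVec, map_sub, map_smul, hL.F_vec,
    show (N₀ : ℤ) + 2 * (n + 1) = N₀ + 2 * n + 2 by ring,
    show (N₀ : ℤ) + 2 * (n - 1) = N₀ + 2 * n - 2 by ring,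
    show k + 2 - 1 = k + 1 by ring, show k - 1 + 2 = k + 1 by ring,
    show k - 1 + 1 = k by ring, show k + 1 - 1 = k by ring]
  push_cast
  match_scalars
  · linear_combination (a n) * c1
  · linear_combination -c2
  · linear_combination (-d n) * c3

/-- The cross relation of `F` and `x_0` gives the action of `x_{-1}`. -/
theorem F_zeroVec (h0 : 0 < q) (h1 : q < 1) (hL : IsLadder q v E F K)
    (hT : ∀ n k, T (vec v n k) = zeroVec q a b d v n k) (h : IsLabel N₀ n k) :
    F (T (vec v n k)) = T (F (vec v n k))
      + ((qrt q 2 * wt q (N₀ + 2 * n) k : ℝ) : ℂ) • minusVec q a b d v n k := by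
  obtain ⟨hn, hk, hkN⟩ := h
  have c1 := congrArg Complex.ofReal (fCoef_upZero h0 h1 (N := N₀ + 2 * n) hk)
  have c2 := congrArg Complex.ofReal (fCoef_midZero h0 h1 (N := N₀ + 2 * n) (k := k))
  have c3 := congrArg Complex.ofReal (fCoef_downZero h0 h1 (N := N₀ + 2 * n) hkN)
  push_cast at c1 c2 c3
  rw [hL.F_vec, map_smul, hT, hT]
  simp only [zeroVec, minusVec, map_add, map_smul, hL.F_vec,
    show (N₀ : ℤ) + 2 * (n + 1) = N₀ + 2 * n + 2 by ring,
    show (N₀ : ℤ) + 2 * (n - 1) = N₀ + 2 * n - 2 by ring,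
    show k - 1 + 1 = k by ring, show k + 1 - 1 = k by ring, show k - 1 - 1 = k - 2 by ring]
  push_cast
  match_scalars
  · linear_combination (a n) * c1
  · linear_combination (b n) * c2
  · linear_combination (d n) * c3

end Forms

/-! ### Vanishing of tensor operators from their reduced matrix elements -/

section WignerEckart

variable {D : Type*} [NormedAddCommGroup D] [InnerProductSpace ℂ D] {N₀ : ℕ}
  {q : ℝ} {v : SpinIndex N₀ → D} {E F K : Module.End ℂ D}

theorem eCoef_ne_zero (h0 : 0 < q) (h1 : q < 1) {N k : ℤ} (hk : 0 ≤ k) (hkN : k < N) :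
    eCoef q N k ≠ 0 :=
  (mul_pos (qrt_pos h0 h1 (by omega)) (qrt_pos h0 h1 (by omega))).ne'

/-- The recursion for the matrix elements of the highest component of a tensor operator. -/
theorem matrix_recursion (hL : IsLadder q v E F K) (hEF : ∀ x y, ⟪F x, y⟫_ℂ = ⟪x, E y⟫_ℂ)
    {μ : ℂ} {y : ℤ → ℤ → D}
    (hyE : ∀ n k, E (y n k) = (μ * (eCoef q (N₀ + 2 * n) k : ℂ)) • y n (k + 1)) (n n' k k' : ℤ) :
    (eCoef q (N₀ + 2 * n') k' : ℂ) * ⟪vec v n' k', y n k⟫_ℂ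
      = μ * (eCoef q (N₀ + 2 * n) k : ℂ) * ⟪vec v n' (k' + 1), y n (k + 1)⟫_ℂ := by
  have h := hEF (vec v n' (k' + 1)) (y n k)
  rwa [hL.F_vec, hyE, inner_smul_left, inner_smul_right, Complex.conj_ofReal, fCoef_add_one,
    add_sub_cancel_right] at h

/-- A tensor operator of rank `r` whose reduced matrix elements vanish is zero. -/
theorem family_eq_zero (h0 : 0 < q) (h1 : q < 1) (hd : SpansDense v)
    (hL : IsLadder q v E F K) (hEF : ∀ x y, ⟪F x, y⟫_ℂ = ⟪x, E y⟫_ℂ)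
    (hK : ∀ x y, ⟪K x, y⟫_ℂ = ⟪x, K y⟫_ℂ) {r : ℕ} {μ : ℂ} (hμ : μ ≠ 0) {y : ℤ → ℤ → D}
    (hy0 : ∀ n k, ¬ IsLabel N₀ n k → y n k = 0)
    (hyK : ∀ n k, K (y n k) = ((q ^ r * wt q (N₀ + 2 * n) k : ℝ) : ℂ) • y n k)
    (hyE : ∀ n k, E (y n k) = (μ * (eCoef q (N₀ + 2 * n) k : ℂ)) • y n (k + 1))
    (htop : ∀ n e : ℤ, 0 ≤ n → 0 ≤ e → e ≤ r →
      ⟪vec v (n + e) (N₀ + 2 * n + 2 * e), y n (N₀ + 2 * n + e - r)⟫_ℂ = 0)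
    (hbot : ∀ n e : ℤ, 0 ≤ n → e < 0 → -r ≤ e → ⟪vec v (n + e) (e + r), y n 0⟫_ℂ = 0)
    (n k : ℤ) : y n k = 0 := by
  by_cases hnk : IsLabel N₀ n k
  swap
  · exact hy0 n k hnk
  have hrec := fun n' k k' => matrix_recursion hL hEF hyE n n' k k'
  -- For fixed `e`, weights allow only the entries `k' = k + e + r`, and `matrix_recursion` links
  -- neighbours. Going down, the factor to be cancelled belongs to the target multiplet and is
  -- nonzero below its highest weight.
  have down : ∀ e k₀ : ℤ, k₀ + e + r ≤ N₀ + 2 * (n + e) →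
      (∀ k, k₀ ≤ k → ⟪vec v (n + e) (k + e + r), y n k⟫_ℂ = 0) →
      ∀ k, ⟪vec v (n + e) (k + e + r), y n k⟫_ℂ = 0 := by
    intro e k₀ hk₀ hbase
    have : ∀ m : ℕ, ⟪vec v (n + e) (k₀ - m + e + r), y n (k₀ - m)⟫_ℂ = 0 := by
      intro m
      induction m with
      | zero => exact hbase _ (by simp)
      | succ m ih =>
        have h := hrec (n + e) (k₀ - (m + 1)) (k₀ - (m + 1) + e + r)
        rw [show k₀ - ((m : ℤ) + 1) + e + r + 1 = k₀ - m + e + r by ring,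
          show k₀ - ((m : ℤ) + 1) + 1 = k₀ - m by ring, ih, mul_zero, mul_eq_zero] at h
        push_cast
        rcases h with h | h
        · rw [vec_eq_zero, inner_zero_left]
          rintro ⟨_, h3, h4⟩
          exact eCoef_ne_zero h0 h1 (N := N₀ + 2 * (n + e)) h3 (by omega) (by exact_mod_cast h)
        · exact h
    intro k
    rcases le_total k₀ k with h | h
    · exact hbase k h
    · have := this (k₀ - k).toNat
      rwa [Int.toNat_of_nonneg (by omega), sub_sub_cancel] at this
  -- Going up, the factor to be cancelled belongs to the source multiplet.
  have up : ∀ e k₀ : ℤ, 0 ≤ k₀ →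
      (∀ k, k ≤ k₀ → ⟪vec v (n + e) (k + e + r), y n k⟫_ℂ = 0) →
      ∀ k, ⟪vec v (n + e) (k + e + r), y n k⟫_ℂ = 0 := by
    intro e k₀ hk₀ hbase
    have : ∀ m : ℕ, ⟪vec v (n + e) (k₀ + m + e + r), y n (k₀ + m)⟫_ℂ = 0 := by
      intro m
      induction m with
      | zero => exact hbase _ (by simp)
      | succ m ih =>
        have h := hrec (n + e) (k₀ + m) (k₀ + m + e + r)
        rw [ih, mul_zero, eq_comm, mul_eq_zero, mul_eq_zero, or_iff_right hμ] at h
        push_cast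
        rw [show k₀ + ((m : ℤ) + 1) + e + r = k₀ + m + e + r + 1 by ring,
          show k₀ + ((m : ℤ) + 1) = k₀ + m + 1 by ring]
        rcases h with h | h
        · rw [hy0, inner_zero_right]
          rintro ⟨_, h3, h4⟩
          exact eCoef_ne_zero h0 h1 (N := N₀ + 2 * n) (k := k₀ + m) (by omega) (by omega)
            (by exact_mod_cast h)
        · exact h
    intro k
    rcases le_total k k₀ with h | h
    · exact hbase k h
    · have := this (k - k₀).toNat
      rwa [Int.toNat_of_nonneg (by omega), add_sub_cancel] at this
  -- For `|e| > r` the start of the recursion is trivial because one of the two vectors is out of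
  -- range. For `0 ≤ e ≤ r` it starts at the highest weight of the target, for `-r ≤ e < 0` at the
  -- lowest weight of the source.
  have main : ∀ e k : ℤ, ⟪vec v (n + e) (k + e + r), y n k⟫_ℂ = 0 := by
    intro e
    rcases lt_or_ge e 0 with he | he
    · rcases lt_or_ge e (-r) with her | her
      · refine up e (-e - r - 1) (by omega) fun k hk => ?_
        rw [vec_eq_zero, inner_zero_left]
        rintro ⟨_, h3, h4⟩
        omega
      · refine up e 0 le_rfl fun k hk => ?_
        rcases hk.eq_or_lt with rfl | hk
        · rw [zero_add]
          exact hbot n e hnk.1 he her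
        · rw [hy0, inner_zero_right]
          rintro ⟨_, h3, h4⟩
          omega
    · rcases lt_or_ge (r : ℤ) e with her | her
      · refine down e (N₀ + 2 * n + 1) (by omega) fun k hk => ?_
        rw [hy0, inner_zero_right]
        rintro ⟨_, h3, h4⟩
        omega
      · refine down e (N₀ + 2 * n + e - r) (by omega) fun k hk => ?_
        rcases hk.eq_or_lt with rfl | hk
        · rw [show (N₀ : ℤ) + 2 * n + e - r + e + r = N₀ + 2 * n + 2 * e by ring]
          exact htop n e hnk.1 he her
        · rw [vec_eq_zero, inner_zero_left]
          rintro ⟨_, h3, h4⟩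
          omega
  refine eq_zero_of_inner_vec hd fun n' k' _ => ?_
  -- All remaining entries connect different eigenvalues of `K` and vanish for that reason.
  by_cases hk : k' = k + (n' - n) + r
  · have := main (n' - n) k
    rwa [← hk, add_sub_cancel] at this
  · have h := hK (vec v n' k') (y n k)
    rw [hL.K_vec, hyK, inner_smul_left, inner_smul_right, Complex.conj_ofReal] at h
    by_contra hne
    have h := mul_right_cancel₀ hne h
    have h : wt q (N₀ + 2 * n') k' = q ^ r * wt q (N₀ + 2 * n) k := by exact_mod_cast h
    rw [wt, wt, ← Real.rpow_natCast, ← Real.rpow_add h0] at h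
    have h := (Real.rpow_right_inj h0 h1.ne).1 h
    push_cast at h
    apply hk
    have : (k' : ℝ) = k + (n' - n) + r := by linarith
    exact_mod_cast this

end WignerEckart

/-! ### The defining relations in terms of the spin one generators -/

section Presentation

/-- The relations of the cross product algebra in terms of `x_1, x_0, x_{-1}`. -/
structure IsSpinOneTriple (q : QParam) (c : ℝ≥0∞) {R : Type*} [Ring R] [Algebra ℂ R]
    (x₁ x₀ xₘ E F K : R) : Prop where
  K_plus : K * x₁ = ((q : ℝ) : ℂ) • (x₁ * K)
  K_zero : K * x₀ = x₀ * K
  K_minus : K * xₘ = (((q : ℝ)⁻¹ : ℝ) : ℂ) • (xₘ * K)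
  E_plus : E * x₁ = (((q : ℝ)⁻¹ : ℝ) : ℂ) • (x₁ * E)
  E_zero : E * x₀ = x₀ * E + (qrt q 2 : ℂ) • (x₁ * K)
  E_minus : E * xₘ = ((q : ℝ) : ℂ) • (xₘ * E) + (qrt q 2 : ℂ) • (x₀ * K)
  F_plus : F * x₁ = (((q : ℝ)⁻¹ : ℝ) : ℂ) • (x₁ * F) + (qrt q 2 : ℂ) • (x₀ * K)
  F_zero : F * x₀ = x₀ * F + (qrt q 2 : ℂ) • (xₘ * K)
  F_minus : F * xₘ = ((q : ℝ) : ℂ) • (xₘ * F)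
  zero_plus : x₀ * x₁ = (((q : ℝ) ^ 2 : ℝ) : ℂ) • (x₁ * x₀) + ((2 * tauShift q c : ℝ) : ℂ) • x₁
  minus_zero : xₘ * x₀ = (((q : ℝ) ^ 2 : ℝ) : ℂ) • (x₀ * xₘ) + ((2 * tauShift q c : ℝ) : ℂ) • xₘ
  plus_minus : (((q : ℝ) * (1 + (q : ℝ) ^ 2) : ℝ) : ℂ) • (x₁ * xₘ) =
    x₀ * x₀ - ((2 * tauShift q c : ℝ) : ℂ) • x₀
      + ((tauShift q c ^ 2 - (1 + (q : ℝ) ^ 2) ^ 2 * discr c ^ 2 : ℝ) : ℂ) • 1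
  minus_plus : (((q : ℝ) * (1 + (q : ℝ) ^ 2) : ℝ) : ℂ) • (xₘ * x₁) =
    (((q : ℝ) ^ 4 : ℝ) : ℂ) • (x₀ * x₀) + (((q : ℝ) ^ 2 * (2 * tauShift q c) : ℝ) : ℂ) • x₀
      + ((tauShift q c ^ 2 - (1 + (q : ℝ) ^ 2) ^ 2 * discr c ^ 2 : ℝ) : ℂ) • 1

/-- The left side is the constant obtained by completing the square, the right side the constant
that comes out of the relations for `B* B` and `B B*`. -/
theorem tauShift_sq_sub (q : ℝ) (c : ℝ≥0∞) : tauShift q c ^ 2 - (1 + q ^ 2) ^ 2 * discr c ^ 2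
    = -(q ^ 2 * linCoeff c ^ 2 + (1 + q ^ 2) ^ 2 * constCoeff c) := by
  rw [discr_sq, tauShift]; ring

/-- The values of the generators that correspond to given `x_1, x_0, x_{-1}`. -/
def genOfTriple (q : QParam) (c : ℝ≥0∞) {R : Type*} [Ring R] [Algebra ℂ R]
    (x₁ x₀ xₘ E F K Ki : R) : Gen → R
  | .A => (((1 + (q : ℝ) ^ 2)⁻¹ : ℝ) : ℂ) • ((linCoeff c : ℂ) • 1 - x₀)
  | .B => (((q : ℝ) * (√(1 + (q : ℝ) ^ 2))⁻¹ : ℝ) : ℂ) • xₘ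
  | .Bs => ((-(√(1 + (q : ℝ) ^ 2))⁻¹ : ℝ) : ℂ) • x₁
  | .E => E
  | .F => F
  | .K => K
  | .Ki => Ki

theorem rpow_neg_half {q : ℝ} (h0 : 0 < q) : q ^ (-(1 / 2) : ℝ) = (√q)⁻¹ := by
  rw [Real.rpow_neg h0.le, Real.sqrt_eq_rpow]

theorem rpow_neg_three_half {q : ℝ} (h0 : 0 < q) : q ^ (-(3 / 2) : ℝ) = (q * √q)⁻¹ := by
  rw [Real.rpow_neg h0.le, Real.sqrt_eq_rpow]
  congr 1
  nth_rewrite 2 [← Real.rpow_one q]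
  rw [← Real.rpow_add h0]
  norm_num

theorem qrt_two {q : ℝ} (h0 : 0 < q) (h1 : q < 1) : qrt q 2 = √(1 + q ^ 2) * (√q)⁻¹ := by
  rw [qrt, qint_two h0 h1, ← div_eq_mul_inv, ← Real.sqrt_div (by positivity)]
  congr 1
  have := h0.ne'
  field_simp
  ring

variable {R : Type*} [Ring R] [Algebra ℂ R]

/-- Converse to `isSpinOneTriple_gen`: a spin one triple together with the relations of `U_q(su_2)`
satisfies all relations in `Rel`, so it defines a representation. -/
theorem IsSpinOneTriple.lift_rel {q : QParam} {c : ℝ≥0∞} {x₁ x₀ xₘ E F K Ki : R}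
    (h : IsSpinOneTriple q c x₁ x₀ xₘ E F K) (hKKi : K * Ki = 1) (hKiK : Ki * K = 1)
    (hKE : K * E = ((q : ℝ) : ℂ) • (E * K)) (hFK : F * K = ((q : ℝ) : ℂ) • (K * F))
    (hEF : E * F - F * E = ((((q : ℝ) - (q : ℝ)⁻¹)⁻¹ : ℝ) : ℂ) • (K * K - Ki * Ki))
    {x y : FreeAlgebra ℂ Gen} (hxy : Rel q c x y) :
    FreeAlgebra.lift ℂ (genOfTriple q c x₁ x₀ xₘ E F K Ki) x
      = FreeAlgebra.lift ℂ (genOfTriple q c x₁ x₀ xₘ E F K Ki) y := by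
  have h0 : (0 : ℝ) < q := q.2.1
  have h1 : (q : ℝ) < 1 := q.2.2
  obtain ⟨k1, k0, km, e1, e0, em, f1, f0, fm, z1, mz, pm, mp⟩ := h
  rw [tauShift_sq_sub] at pm mp
  have s1 : √(q : ℝ) ^ 2 = q := Real.sq_sqrt h0.le
  have s2 : √(1 + (q : ℝ) ^ 2) ^ 2 = 1 + (q : ℝ) ^ 2 := Real.sq_sqrt (by positivity)
  have s1' : 0 < √(q : ℝ) := Real.sqrt_pos.2 h0
  have s2' : 0 < √(1 + (q : ℝ) ^ 2) := Real.sqrt_pos.2 (by positivity)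
  rw [qrt_two h0 h1] at e0 em f1 f0
  have hc : (((q : ℝ) * (1 + (q : ℝ) ^ 2) : ℝ) : ℂ) ≠ 0 := by
    exact_mod_cast (by positivity : (q : ℝ) * (1 + (q : ℝ) ^ 2) ≠ 0)
  rw [← eq_inv_smul_iff₀ hc, ← Complex.ofReal_inv] at pm mp
  cases hxy <;> simp only [fgen, map_mul, map_add, map_sub, map_smul, map_one,
    FreeAlgebra.lift_ι_apply, genOfTriple]
  case K_Ki => exact hKKi
  case Ki_K => exact hKiK
  case K_E => exact hKE
  case F_K => exact hFK
  case E_F => exact hEF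
  all_goals
    simp only [smul_mul_assoc, mul_smul_comm, smul_sub, smul_add, mul_sub, sub_mul, mul_one,
      one_mul, k1, k0, km, e1, e0, em, f1, f0, fm, z1, mz, pm, mp, rpow_neg_half h0,
      rpow_neg_three_half h0, ← Real.sqrt_eq_rpow, tauShift]
  -- With `t = √q` and `w = √(1 + q²)` every coefficient is rational in `t` and `w`, and the only
  -- relation to be used is `w² = 1 + t⁴`.
  all_goals
    generalize √(q : ℝ) = t at *
    generalize √(1 + (q : ℝ) ^ 2) = w at *
    have t0 : (t : ℂ) ≠ 0 := by exact_mod_cast s1'.ne'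
    have w0 : (w : ℂ) ≠ 0 := by exact_mod_cast s2'.ne'
    have w2 : (w : ℂ) ^ 2 = 1 + (t : ℂ) ^ 4 := by
      rw [← s1] at s2
      exact_mod_cast (by rw [s2]; ring : w ^ 2 = 1 + t ^ 4)
    have q2 : ((q : ℝ) : ℂ) = (t : ℂ) ^ 2 := by rw [← s1]; push_cast; rfl
    have w2' : 1 + ((q : ℝ) : ℂ) ^ 2 = (w : ℂ) ^ 2 := by rw [w2, q2]; ring
    match_scalars <;> push_cast <;> (try rw [w2']) <;> (try simp only [q2]) <;>
      field_simp <;> first | ring1 | (rw [w2]; ring1)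

theorem isSpinOneTriple_gen (q : QParam) (c : ℝ≥0∞) :
    IsSpinOneTriple q c (xPlus q c) (xZero q c) (xMinus q c)
      (gen q c .E) (gen q c .F) (gen q c .K) := by
  have h0 : (0 : ℝ) < q := q.2.1
  have h1 : (q : ℝ) < 1 := q.2.2
  have r6 := mk_rel (Rel.A_B (q := q) (c := c))
  have r7 := mk_rel (Rel.A_Bs (q := q) (c := c))
  have r8 := mk_rel (Rel.Bs_B (q := q) (c := c))
  have r9 := mk_rel (Rel.B_Bs (q := q) (c := c))
  have r10 := mk_rel (Rel.K_A (q := q) (c := c))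
  have r11 := mk_rel (Rel.E_A (q := q) (c := c))
  have r12 := mk_rel (Rel.F_A (q := q) (c := c))
  have r13 := mk_rel (Rel.K_B (q := q) (c := c))
  have r14 := mk_rel (Rel.E_B (q := q) (c := c))
  have r15 := mk_rel (Rel.F_B (q := q) (c := c))
  have r16 := mk_rel (Rel.K_Bs (q := q) (c := c))
  have r17 := mk_rel (Rel.E_Bs (q := q) (c := c))
  have r18 := mk_rel (Rel.F_Bs (q := q) (c := c))
  simp only [map_mul, map_add, map_sub, map_smul, map_one, mk_fgen, rpow_neg_half h0,
    rpow_neg_three_half h0, ← Real.sqrt_eq_rpow] at r6 r7 r8 r9 r10 r11 r12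
  simp only [map_mul, map_add, map_sub, map_smul, mk_fgen, rpow_neg_half h0,
    rpow_neg_three_half h0, ← Real.sqrt_eq_rpow] at r13 r14 r15 r16 r17 r18
  have s1 : √(q : ℝ) ^ 2 = q := Real.sq_sqrt h0.le
  have s2 : √(1 + (q : ℝ) ^ 2) ^ 2 = 1 + (q : ℝ) ^ 2 := Real.sq_sqrt (by positivity)
  have s1' : 0 < √(q : ℝ) := Real.sqrt_pos.2 h0
  have s2' : 0 < √(1 + (q : ℝ) ^ 2) := Real.sqrt_pos.2 (by positivity)
  constructor <;> simp only [tauShift_sq_sub, xPlus, xZero, xMinus, qrt_two h0 h1]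
  all_goals
    simp only [smul_mul_assoc, mul_smul_comm, smul_sub, smul_add, mul_sub, sub_mul, mul_one,
      one_mul, r6, r7, r8, r9, r10, r11, r12, r13, r14, r15, r16, r17, r18, tauShift]
  all_goals
    generalize √(q : ℝ) = t at *
    generalize √(1 + (q : ℝ) ^ 2) = w at *
    have t0 : (t : ℂ) ≠ 0 := by exact_mod_cast s1'.ne'
    have w0 : (w : ℂ) ≠ 0 := by exact_mod_cast s2'.ne'
    have w2 : (w : ℂ) ^ 2 = 1 + (t : ℂ) ^ 4 := by
      rw [← s1] at s2
      exact_mod_cast (by rw [s2]; ring : w ^ 2 = 1 + t ^ 4)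
    have q2 : ((q : ℝ) : ℂ) = (t : ℂ) ^ 2 := by rw [← s1]; push_cast; rfl
    have w2' : 1 + ((q : ℝ) : ℂ) ^ 2 = (w : ℂ) ^ 2 := by rw [w2, q2]; ring
    match_scalars <;> push_cast <;> (try simp only [w2']) <;> (try simp only [q2]) <;>
      (try field_simp) <;> first | ring1 | (rw [w2]; ring1)

end Presentation

/-! ### Adjoints of the spin one generators -/

section Star

variable (q : QParam) (c : ℝ≥0∞)

theorem star_xPlus : star (xPlus q c) = ((-(q : ℝ) : ℝ) : ℂ) • xMinus q c := by
  have hq : ((q : ℝ) : ℂ) ≠ 0 := by exact_mod_cast q.2.1.ne'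
  rw [xPlus, xMinus, star_smul, star_gen, starGen]
  match_scalars
  simp only [star_neg, Complex.star_def, Complex.conj_ofReal]
  field_simp

theorem star_xZero : star (xZero q c) = xZero q c := by
  simp only [xZero, star_sub, star_smul, star_one, star_gen, starGen, Complex.star_def,
    Complex.conj_ofReal]

end Star

/-! ### The formulas of the theorem in integer indices -/

section Formulas

variable {N₀ : ℕ}

theorem qnum_eq_qint (q : ℝ) {x : ℝ} {m : ℤ} (h : x = m) : qnum q x = qint q m := by
  rw [h, qint]

theorem sqrt_qnum_eq_qrt (q : ℝ) {x : ℝ} {m : ℤ} (h : x = m) : √(qnum q x) = qrt q m := by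
  rw [h, qrt, qint]

/-- The reduced matrix elements `α⁺(l,l)_±` as complex numbers. -/
def alphaSeq (q : QParam) (c : ℝ≥0∞) (ε : ℤˣ) (N₀ : ℕ) (n : ℤ) : ℂ := alphaCoef q c ε N₀ n

/-- The reduced matrix elements `β⁰(l,l)_±` as complex numbers. -/
def betaSeq (q : QParam) (c : ℝ≥0∞) (ε : ℤˣ) (N₀ : ℕ) (n : ℤ) : ℂ := betaCoef q c ε N₀ n

variable {q : QParam} {c : ℝ≥0∞} {D : Type*} [NormedAddCommGroup D] [InnerProductSpace ℂ D]
  {ε : ℤˣ} {v : SpinIndex N₀ → D}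

theorem alphaSeq_neg_one (q : QParam) (c : ℝ≥0∞) (ε : ℤˣ) (N₀ : ℕ) :
    alphaSeq q c ε N₀ (-1) = 0 := by
  rw [alphaSeq, alphaCoef_neg_one, Complex.ofReal_zero]

/-- The action of `x_1, x_0, x_{-1}` in terms of coefficients with integer arguments. -/
structure HasSeqForm (q : ℝ) (a b d : ℤ → ℂ) (v : SpinIndex N₀ → D)
    (x₁ x₀ xₘ : Module.End ℂ D) : Prop where
  plus_vec : ∀ n k, x₁ (vec v n k) = plusVec q a b d v n k
  zero_vec : ∀ n k, x₀ (vec v n k) = zeroVec q a b d v n k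
  minus_vec : ∀ n k, xₘ (vec v n k) = minusVec q a b d v n k

/-- Extends an identity from the labels to all integers, for families that vanish outside the
labels. -/
theorem forall_vec {P Q : ℤ → ℤ → D} (hP : ∀ n k, ¬ IsLabel N₀ n k → P n k = 0)
    (hQ : ∀ n k, ¬ IsLabel N₀ n k → Q n k = 0)
    (h : ∀ (n : ℕ) (k : Fin (N₀ + 2 * n + 1)), P n k = Q n k) (n k : ℤ) : P n k = Q n k := by
  by_cases hnk : IsLabel N₀ n k
  · obtain ⟨m, p, rfl, rfl⟩ := hnk.exists_nat
    exact h m p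
  · rw [hP _ _ hnk, hQ _ _ hnk]

theorem rpow_add_weight (q : QParam) (N₀ : ℕ) (n k : ℤ) {x : ℝ} {m : ℤ}
    (h : x = weight N₀ n k + m) : (q : ℝ) ^ x = wt q (N₀ + 2 * n) k * (q : ℝ) ^ m := by
  rw [h, wt, ← Real.rpow_intCast, ← Real.rpow_add q.2.1]
  congr 1
  simp only [weight, spin]
  push_cast
  ring

theorem rpow_eq_zpow (q : QParam) {x : ℝ} {m : ℤ} (h : x = m) : (q : ℝ) ^ x = (q : ℝ) ^ m := by
  rw [h, Real.rpow_intCast]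

/-- Passes from real exponents in `l` and `j`, on valid labels, to coefficients with integer
arguments, on all integers. The latter form is used in all later arguments. -/
theorem hasFormulas_iff {π : StarRep q c D} :
    HasFormulas N₀ ε π v ↔ HasSeqForm q (alphaSeq q c ε N₀) (betaSeq q c ε N₀)
      (fun n => alphaSeq q c ε N₀ (n - 1)) v
      (π.toHom (xPlus q c)) (π.toHom (xZero q c)) (π.toHom (xMinus q c)) := by
  have h0 : (0 : ℝ) < q := q.2.1
  have h1 : (q : ℝ) < 1 := q.2.2
  have hq := h0.ne'
  have hal : ∀ n : ℤ, alpha q c ε (spin N₀ 0) (spin N₀ n - 1) = alphaCoef q c ε N₀ (n - 1) := by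
    intro n
    rw [alphaCoef]
    congr 1
    simp only [spin]
    push_cast
    ring
  have hal' : ∀ n : ℤ, alpha q c ε (spin N₀ 0) (spin N₀ n) = alphaCoef q c ε N₀ n := fun n => rfl
  have hbe' : ∀ n : ℤ, beta q c ε (spin N₀ 0) (spin N₀ n) = betaCoef q c ε N₀ n := fun n => rfl
  have e1 : ∀ n k : ℤ, spin N₀ n + weight N₀ n k = k := by
    intro n k; simp only [weight]; ring
  have e2 : ∀ n k : ℤ, spin N₀ n - weight N₀ n k = ((N₀ + 2 * n - k : ℤ) : ℝ) := by
    intro n k; simp only [weight, spin]; push_cast; ring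
  have e3 : ∀ n : ℤ, 2 * spin N₀ n = ((N₀ + 2 * n : ℤ) : ℝ) := by
    intro n; simp only [spin]; push_cast; ring
  have e4 : ∀ n k : ℤ, -spin N₀ n + weight N₀ n k = ((k - (N₀ + 2 * n) : ℤ) : ℝ) := by
    intro n k; simp only [weight, spin]; push_cast; ring
  have g2 : qnum q 2 = qint q 2 := qnum_eq_qint q (by norm_num)
  have vz : ∀ T : Module.End ℂ D, ∀ n k, ¬ IsLabel N₀ n k → T (vec v n k) = 0 := by
    intro T n k h; rw [vec_eq_zero v h, map_zero]
  have p1 : ∀ n k : ℤ, (q : ℝ) ^ (weight N₀ n k) = wt q (N₀ + 2 * n) k := by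
    intro n k
    rw [rpow_add_weight q N₀ n k (m := 0) (by push_cast; ring), zpow_zero, mul_one]
  have p2 : ∀ n k : ℤ, (q : ℝ) ^ (weight N₀ n k + 2) = (q : ℝ) ^ 2 * wt q (N₀ + 2 * n) k := by
    intro n k
    rw [rpow_add_weight q N₀ n k (m := 2) (by push_cast; ring), mul_comm]
    rfl
  have s0 : ∀ m : ℤ, √(qnum q (m : ℝ)) = qrt q m := fun m => rfl
  have s1 : ∀ m : ℤ, √(qnum q ((m : ℝ) + 1)) = qrt q (m + 1) := fun m =>
    sqrt_qnum_eq_qrt q (by push_cast; ring)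
  have s2 : ∀ m : ℤ, √(qnum q ((m : ℝ) + 2)) = qrt q (m + 2) := fun m =>
    sqrt_qnum_eq_qrt q (by push_cast; ring)
  have s3 : ∀ m : ℤ, √(qnum q ((m : ℝ) - 1)) = qrt q (m - 1) := fun m =>
    sqrt_qnum_eq_qrt q (by push_cast; ring)
  have s4 : ∀ m : ℤ, √(qint q m) = qrt q m := fun _ => rfl
  have i0 : ∀ m : ℤ, qnum q (m : ℝ) = qint q m := fun m => rfl
  have z0 : ∀ m : ℤ, (q : ℝ) ^ (m : ℝ) = (q : ℝ) ^ m := fun m => Real.rpow_intCast _ m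
  have z1 : ∀ m : ℤ, (q : ℝ) ^ ((m : ℝ) + 1) = (q : ℝ) ^ (m + 1) := fun m =>
    rpow_eq_zpow q (by push_cast; ring)
  have z2 : ∀ m : ℤ, (q : ℝ) ^ ((m : ℝ) - 1) = (q : ℝ) ^ (m - 1) := fun m =>
    rpow_eq_zpow q (by push_cast; ring)
  constructor
  · rintro ⟨hp, hz, hm⟩
    refine ⟨forall_vec (vz _) (fun n k => plusVec_eq_zero h0 h1 (alphaSeq_neg_one ..)) ?_,
      forall_vec (vz _) (fun n k => zeroVec_eq_zero h0 h1 (alphaSeq_neg_one ..)) ?_,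
      forall_vec (vz _) (fun n k => minusVec_eq_zero h0 h1 (alphaSeq_neg_one ..)) ?_⟩ <;>
      intro n k
    all_goals first | rw [hp n k] | rw [hz n k] | rw [hm n k]
    all_goals
      simp only [hal, hal', hbe', e1, e2, e3, e4, g2, p1, p2, s0, s1, s2, s3, s4, i0,
        z0, z1, z2]
      simp only [plusVec, upPlus, midPlus, downPlus, zeroVec, upZero, midZero, downZero, minusVec,
        upMinus, midMinus, downMinus, alphaSeq, betaSeq]
      push_cast
      module
  · rintro ⟨hp, hz, hm⟩
    constructor <;> intro n k l₀ l j
    all_goals first | rw [hp] | rw [hz] | rw [hm]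
    all_goals
      simp only [l₀, l, j, hal, hal', hbe', e1, e2, e3, e4, g2, p1, p2, s0, s1, s2, s3, s4, i0,
        z0, z1, z2]
      simp only [plusVec, upPlus, midPlus, downPlus, zeroVec, upZero, midZero, downZero, minusVec,
        upMinus, midMinus, downMinus, alphaSeq, betaSeq]
      push_cast
      module

end Formulas

section Extremal

variable {q : ℝ}

/-! ### Coefficients at extremal weights -/

theorem upPlus_self (h0 : 0 < q) (h1 : q < 1) {N : ℤ} (hN : 0 ≤ N) : upPlus q N N = 1 := by
  have p1 := (qrt_pos h0 h1 (m := N + 1) (by omega)).ne'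
  have p2 := (qrt_pos h0 h1 (m := N + 2) (by omega)).ne'
  rw [upPlus, sub_self, zpow_zero]
  field_simp

theorem midPlus_self (q : ℝ) (N : ℤ) : midPlus q N N = 0 := by
  simp [midPlus, qrt_zero]

theorem downPlus_self (q : ℝ) (N : ℤ) : downPlus q N N = 0 := by
  simp [downPlus, qrt_zero]

theorem midZero_self (q : ℝ) (N : ℤ) : midZero q N N = 1 := by
  simp [midZero, qint_zero]

theorem downZero_self (q : ℝ) (N : ℤ) : downZero q N N = 0 := by
  simp [downZero, qrt_zero]

theorem upZero_self (h0 : 0 < q) (h1 : q < 1) {N : ℤ} (hN : 0 ≤ N) :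
    upZero q N N = wt q N N * qrt q 2 * (qrt q (N + 2))⁻¹ := by
  have p1 := (qrt_pos h0 h1 (m := N + 1) (by omega)).ne'
  rw [upZero, sub_self, zero_add, qrt_one h0 h1]
  field_simp

theorem wt_self_sq (h0 : 0 < q) (N : ℤ) : wt q N N ^ 2 = q ^ N := by
  rw [wt_sq h0]
  have := zpow_ne_zero N h0.ne'
  field_simp

theorem upZero_self_sq (h0 : 0 < q) (h1 : q < 1) {N : ℤ} (hN : 0 ≤ N) :
    upZero q N N ^ 2 = q ^ N * qint q 2 * (qint q (N + 2))⁻¹ := by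
  rw [upZero_self h0 h1 hN, mul_pow, mul_pow, inv_pow, qrt_sq h0 h1 (by omega),
    qrt_sq h0 h1 (by omega), wt_self_sq h0]

theorem upMinus_self_sq (h0 : 0 < q) (h1 : q < 1) {N : ℤ} (hN : 0 ≤ N) :
    upMinus q N N ^ 2
      = q ^ N * q ^ N * qint q 2 * (qint q (N + 1))⁻¹ * (qint q (N + 2))⁻¹ := by
  rw [upMinus, sub_self, zero_add, zero_add, qrt_one h0 h1, mul_pow, mul_pow, mul_pow, mul_pow,
    inv_pow, inv_pow, qrt_sq h0 h1 (by omega), qrt_sq h0 h1 (by omega), qrt_sq h0 h1 (by omega)]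
  ring

theorem midMinus_self_sq (h0 : 0 < q) (h1 : q < 1) {N : ℤ} (hN : 0 < N) :
    midMinus q N N ^ 2 = q ^ N * qint q 2 * (qint q N)⁻¹ := by
  have := (qint_pos h0 h1 hN).ne'
  rw [midMinus, sub_self, zero_add, qrt_one h0 h1, mul_pow, mul_pow, mul_pow, mul_pow,
    inv_pow, qrt_sq h0 h1 (by omega), qrt_sq h0 h1 (by omega), wt_self_sq h0]
  field_simp

theorem downMinus_self (h0 : 0 < q) (h1 : q < 1) {N : ℤ} (hN : 2 ≤ N) :
    downMinus q N N = q⁻¹ := by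
  have p1 := (qrt_pos h0 h1 (m := N - 1) (by omega)).ne'
  have p2 := (qrt_pos h0 h1 (m := N) (by omega)).ne'
  rw [downMinus, sub_self, zero_sub, zpow_neg_one]
  field_simp

theorem upMinus_zero (h0 : 0 < q) (h1 : q < 1) {N : ℤ} (hN : 0 ≤ N) : upMinus q N 0 = 1 := by
  have p1 := (qrt_pos h0 h1 (m := N + 1) (by omega)).ne'
  have p2 := (qrt_pos h0 h1 (m := N + 2) (by omega)).ne'
  rw [upMinus, zpow_zero, sub_zero]
  field_simp

theorem downPlus_zero (h0 : 0 < q) (h1 : q < 1) {N : ℤ} (hN : 2 ≤ N) : downPlus q N 0 = q := by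
  rw [downPlus_eq h0, upMinus_zero h0 h1 (by omega), mul_one]

theorem midZero_zero (h0 : 0 < q) (h1 : q < 1) {N : ℤ} (hN : 0 < N) :
    midZero q N 0 = -q ^ 2 := by
  have := (qint_pos h0 h1 hN).ne'
  have := h0.ne'
  rw [midZero, sub_zero, zero_add, zpow_one, qint_two h0 h1]
  field_simp
  ring

theorem downZero_zero (q : ℝ) (N : ℤ) : downZero q N 0 = 0 := by
  simp [downZero, qrt_zero]

theorem upZero_mul_midPlus_top (h0 : 0 < q) (h1 : q < 1) {N : ℤ} (hN : 0 ≤ N) :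
    upZero q N N * midPlus q (N + 2) (N + 1)
      = q ^ 2 * q ^ N * qint q 2 * (qint q (N + 2))⁻¹ := by
  have p2 := (qrt_pos h0 h1 (m := N + 2) (by omega)).ne'
  rw [upZero_self h0 h1 hN, midPlus, wt_add_two, show N + 2 - (N + 1) = 1 by ring,
    show N + 1 + 1 = N + 2 by ring, qrt_one h0 h1, ← wt_self_sq h0, ← qrt_sq h0 h1 (by omega : (0:ℤ) ≤ 2)]
  field_simp

theorem upZero_mul_midPlus_bot (h0 : 0 < q) (h1 : q < 1) {N : ℤ} (hN : 0 ≤ N) :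
    upZero q N 0 * midPlus q (N + 2) 0
      = q * (q ^ N)⁻¹ * qint q 2 * (qint q (N + 2))⁻¹ := by
  have p1 := (qrt_pos h0 h1 (m := N + 1) (by omega)).ne'
  have p2 := (qrt_pos h0 h1 (m := N + 2) (by omega)).ne'
  have e : wt q (N + 2) 0 = wt q N 0 * q⁻¹ := by
    rw [← wt_add_two q N 0, zero_add, ← wt_sub_one h0, sub_self]
  have e2 : wt q N 0 ^ 2 = (q ^ N)⁻¹ := by rw [wt_sq h0]; simp
  have := h0.ne'
  rw [upZero, midPlus, e, ← e2, sub_zero, sub_zero, zero_add, qrt_one h0 h1,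
    ← qrt_sq h0 h1 (by omega : (0:ℤ) ≤ 2)]
  field_simp

end Extremal

/-! ### Matrix elements of the sphere relations between extremal vectors -/

section Equations

/-- This expansion of `[N + 4]` serves the matrix element at the lowest weight, and `qint_add_four`
the one at the highest weight. Both matrix elements then yield the same recursion for `b`. -/
theorem qint_add_four' {q : ℝ} (h0 : 0 < q) (h1 : q < 1) (N : ℤ) :
    q ^ 2 * qint q (N + 4) = q ^ 4 * qint q (N + 2) + (q ^ N)⁻¹ * qint q 2 := by
  have hq := h0.ne'
  have hN := zpow_ne_zero N hq
  have hl' : q ^ 2 - 1 ≠ 0 := by nlinarith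
  rw [qint_two h0 h1]
  simp only [qint_eq, zpow_add₀ hq, zpow_ofNat]
  field_simp
  ring

theorem qint_add_four {q : ℝ} (h0 : 0 < q) (h1 : q < 1) (N : ℤ) :
    q ^ 2 * qint q (N + 4) = qint q (N + 2) + q ^ N * q ^ 4 * qint q 2 := by
  have hq := h0.ne'
  have hN := zpow_ne_zero N hq
  have hl' : q ^ 2 - 1 ≠ 0 := by nlinarith
  rw [qint_two h0 h1]
  simp only [qint_eq, zpow_add₀ hq, zpow_ofNat]
  field_simp
  ring

variable {N₀ : ℕ} {D : Type*} [NormedAddCommGroup D] [InnerProductSpace ℂ D]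
  {q : ℝ} {v : SpinIndex N₀ → D} {x₁ x₀ xₘ : Module.End ℂ D} {a b : ℤ → ℝ}

/-- The adjointness relations of `x_1, x_0, x_{-1}`. -/
structure IsAdjointTriple (q : ℝ) (x₁ x₀ xₘ : Module.End ℂ D) : Prop where
  plus : ∀ x y, ⟪x₁ x, y⟫_ℂ = ((-q : ℝ) : ℂ) * ⟪x, xₘ y⟫_ℂ
  zero : ∀ x y, ⟪x₀ x, y⟫_ℂ = ⟪x, x₀ y⟫_ℂ

theorem IsAdjointTriple.plus' (h : IsAdjointTriple q x₁ x₀ xₘ) (x y : D) :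
    ⟪x, x₁ y⟫_ℂ = ((-q : ℝ) : ℂ) * ⟪xₘ x, y⟫_ℂ := by
  rw [← inner_conj_symm, h.plus, map_mul, Complex.conj_ofReal, inner_conj_symm]

/-- A sequence of real numbers as a sequence of complex numbers. -/
abbrev cseq (a : ℤ → ℝ) (n : ℤ) : ℂ := (a n : ℂ)

variable {n : ℤ}

theorem plusVec_top (h0 : 0 < q) (h1 : q < 1) (a b d : ℤ → ℂ) (v : SpinIndex N₀ → D)
    (hn : 0 ≤ n) : plusVec q a b d v n (N₀ + 2 * n) = a n • vec v (n + 1) (N₀ + 2 * n + 2) := by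
  rw [plusVec, upPlus_self h0 h1 (by omega), midPlus_self, downPlus_self]
  simp

theorem zeroVec_top (a b d : ℤ → ℂ) (v : SpinIndex N₀ → D) :
    zeroVec q a b d v n (N₀ + 2 * n)
      = ((upZero q (N₀ + 2 * n) (N₀ + 2 * n) : ℂ) * a n) • vec v (n + 1) (N₀ + 2 * n + 1)
        + b n • vec v n (N₀ + 2 * n) := by
  rw [zeroVec, midZero_self, downZero_self]
  simp

theorem zeroVec_bot (a b d : ℤ → ℂ) (v : SpinIndex N₀ → D) :
    zeroVec q a b d v n 0
      = ((upZero q (N₀ + 2 * n) 0 : ℂ) * a n) • vec v (n + 1) 1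
        + ((midZero q (N₀ + 2 * n) 0 : ℂ) * b n) • vec v n 0 := by
  rw [zeroVec, downZero_zero]
  simp

/-- The matrix element of the spin one relation from `v^l_l` to `v^{l+1}_{l+1}`. -/
theorem inner_zero_plus_top (h0 : 0 < q) (h1 : q < 1) (hv : Orthonormal ℂ v)
    (hT : HasSeqForm q (cseq a) (cseq b) (fun n => cseq a (n - 1)) v x₁ x₀ xₘ)
    (hn : 0 ≤ n) (τ : ℝ) :
    ⟪vec v (n + 1) (N₀ + 2 * n + 2), x₀ (x₁ (vec v n (N₀ + 2 * n)))
      - ((q ^ 2 : ℝ) : ℂ) • x₁ (x₀ (vec v n (N₀ + 2 * n)))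
      - ((2 * τ : ℝ) : ℂ) • x₁ (vec v n (N₀ + 2 * n))⟫_ℂ
    = ((a n * (qint q (N₀ + 2 * n + 2))⁻¹ * (q ^ 2 * qint q (N₀ + 2 * n + 4) * b (n + 1)
      - qint q (N₀ + 2 * n + 2) * (q ^ 2 * b n + 2 * τ)) : ℝ) : ℂ) := by
  have i1 := fun n' k' => inner_vec hv (n := n + 1) (k := N₀ + 2 * n + 2) (n' := n') (k' := k')
    ⟨by omega, by omega, by omega⟩
  have hinv := congrArg Complex.ofReal
    (mul_inv_cancel₀ (qint_pos h0 h1 (m := N₀ + 2 * n + 2) (by omega)).ne')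
  have hq4 := congrArg Complex.ofReal (qint_add_four h0 h1 (N₀ + 2 * n))
  have key := congrArg Complex.ofReal (upZero_mul_midPlus_top h0 h1 (N := N₀ + 2 * n) (by omega))
  have hz := zeroVec_top (q := q) (n := n + 1) (cseq a) (cseq b) (fun n => cseq a (n - 1)) v
  rw [show (N₀ : ℤ) + 2 * (n + 1) = N₀ + 2 * n + 2 by ring] at hz
  rw [hT.plus_vec, hT.zero_vec, plusVec_top h0 h1 _ _ _ _ hn, zeroVec_top, map_add, map_smul,
    map_smul, map_smul, hT.zero_vec, hT.plus_vec, hT.plus_vec, plusVec_top h0 h1 _ _ _ _ hn, hz]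
  simp only [plusVec, inner_sub_right, inner_add_right, inner_smul_right, i1,
    show (N₀ : ℤ) + 2 * (n + 1) = N₀ + 2 * n + 2 by ring, cseq,
    true_and, and_true, if_true]
  split_ifs <;> try omega
  push_cast at hinv hq4 key ⊢
  linear_combination ((q : ℂ) ^ 2 * a n * b (n + 1)) * key
    - (a n * b (n + 1) - a n * ((q : ℂ) ^ 2 * b n + 2 * τ)) * hinv
    - (a n * b (n + 1) * (qint q (N₀ + 2 * n + 2) : ℂ)⁻¹) * hq4

/-- The matrix element of the spin one relation from `v^l_{-l}` to `v^{l-1}_{-l+1}`. -/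
theorem inner_zero_plus_bot (h0 : 0 < q) (h1 : q < 1) (hv : Orthonormal ℂ v)
    (hT : HasSeqForm q (cseq a) (cseq b) (fun n => cseq a (n - 1)) v x₁ x₀ xₘ)
    (hb : N₀ = 0 → b 0 = 0) (hn : 0 ≤ n) (τ : ℝ) :
    ⟪vec v n 0, x₀ (x₁ (vec v (n + 1) 0))
      - ((q ^ 2 : ℝ) : ℂ) • x₁ (x₀ (vec v (n + 1) 0))
      - ((2 * τ : ℝ) : ℂ) • x₁ (vec v (n + 1) 0)⟫_ℂ
    = ((-q * a n * (qint q (N₀ + 2 * n + 2))⁻¹ * (q ^ 2 * qint q (N₀ + 2 * n + 4) * b (n + 1)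
      - qint q (N₀ + 2 * n + 2) * (q ^ 2 * b n + 2 * τ)) : ℝ) : ℂ) := by
  have i1 := fun n' k' => inner_vec hv (n := n) (k := 0) (n' := n') (k' := k')
    ⟨by omega, by omega, by omega⟩
  have hinv := congrArg Complex.ofReal
    (mul_inv_cancel₀ (qint_pos h0 h1 (m := N₀ + 2 * n + 2) (by omega)).ne')
  have hq4 := congrArg Complex.ofReal (qint_add_four' h0 h1 (N₀ + 2 * n))
  have key := congrArg Complex.ofReal (upZero_mul_midPlus_bot h0 h1 (N := N₀ + 2 * n) (by omega))
  -- For `N = 0` the coefficient `midZero` is `1` and not `-q²`, but then `b 0 = 0`.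
  have hmz : (midZero q (N₀ + 2 * n) 0 : ℂ) * b n = -(q : ℂ) ^ 2 * b n := by
    rcases (show (0 : ℤ) ≤ N₀ + 2 * n by omega).eq_or_lt with h | h
    · obtain rfl : n = 0 := by omega
      rw [hb (by omega)]
      simp
    · rw [midZero_zero h0 h1 h]
      push_cast
      ring
  rw [hT.plus_vec, hT.zero_vec, plusVec, zeroVec_bot, map_add, map_sub, map_sub]
  simp only [map_smul, hT.zero_vec, hT.plus_vec]
  simp only [plusVec, zeroVec, inner_sub_right, inner_add_right, inner_smul_right, i1,
    show (N₀ : ℤ) + 2 * (n + 1) = N₀ + 2 * n + 2 by ring, cseq, add_sub_cancel_right,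
    true_and, and_true, if_true]
  split_ifs <;> try omega
  rw [downPlus_zero h0 h1 (N := N₀ + 2 * n + 2) (by omega),
    midZero_zero h0 h1 (N := N₀ + 2 * n + 2) (by omega),
    show (0 : ℤ) + 1 = 1 by norm_num, ← zero_add (1 : ℤ), ← upZero_eq]
  push_cast at hinv hq4 key ⊢
  linear_combination (-(a n : ℂ) * b (n + 1)) * key
    + ((q : ℂ) * a n * b (n + 1) * (qint q (N₀ + 2 * n + 2) : ℂ)⁻¹) * hq4
    + ((q : ℂ) ^ 5 * a n * b (n + 1) - (q : ℂ) * a n * ((q : ℂ) ^ 2 * b n + 2 * τ)) * hinv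
    - ((q : ℂ) * a n) * hmz

/-- The diagonal matrix element of the relation for `x_{-1} x_1` at `v^l_l`. -/
theorem inner_minus_plus (h0 : 0 < q) (h1 : q < 1) (hv : Orthonormal ℂ v)
    (hT : HasSeqForm q (cseq a) (cseq b) (fun n => cseq a (n - 1)) v x₁ x₀ xₘ)
    (hadj : IsAdjointTriple q x₁ x₀ xₘ) (hn : 0 ≤ n) (τ ρ : ℝ) :
    ⟪vec v n (N₀ + 2 * n),
      ((q * (1 + q ^ 2) : ℝ) : ℂ) • xₘ (x₁ (vec v n (N₀ + 2 * n)))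
      - (((q ^ 4 : ℝ) : ℂ) • x₀ (x₀ (vec v n (N₀ + 2 * n)))
      + ((q ^ 2 * (2 * τ) : ℝ) : ℂ) • x₀ (vec v n (N₀ + 2 * n))
      + ((τ ^ 2 - (1 + q ^ 2) ^ 2 * ρ ^ 2 : ℝ) : ℂ) • vec v n (N₀ + 2 * n))⟫_ℂ
    = ((q ^ 2 * qint q 2 ^ 2 * ρ ^ 2 - ((q ^ 2 * b n + τ) ^ 2 + q ^ 2 * qint q 2
      * qint q (N₀ + 2 * n + 3) * (qint q (N₀ + 2 * n + 2))⁻¹ * a n ^ 2) : ℝ) : ℂ) := by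
  have hlab : IsLabel N₀ n (N₀ + 2 * n) := ⟨by omega, by omega, by omega⟩
  have hlab1 : IsLabel N₀ (n + 1) (N₀ + 2 * n + 1) := ⟨by omega, by omega, by omega⟩
  have hlab2 : IsLabel N₀ (n + 1) (N₀ + 2 * n + 2) := ⟨by omega, by omega, by omega⟩
  -- Since `x_1* = -q x_{-1}`, this term is a multiple of the squared norm of `x_1 v^l_l`, which has
  -- a single component.
  have hm : ((q * (1 + q ^ 2) : ℝ) : ℂ) * ⟪vec v n (N₀ + 2 * n), xₘ (x₁ (vec v n (N₀ + 2 * n)))⟫_ℂ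
      = -((1 + q ^ 2 : ℝ) : ℂ) *
        ⟪x₁ (vec v n (N₀ + 2 * n)), x₁ (vec v n (N₀ + 2 * n))⟫_ℂ := by
    rw [hadj.plus]; push_cast; ring
  have hq3 : q ^ 2 * qint q 2 * qint q (N₀ + 2 * n + 3)
      = q ^ 2 * q ^ 2 * q ^ ((N₀ : ℤ) + 2 * n) * qint q 2
        + (1 + q ^ 2) * qint q (N₀ + 2 * n + 2) := by
    have hq := h0.ne'
    generalize (N₀ : ℤ) + 2 * n = N
    have hN := zpow_ne_zero N hq
    have hl' : q ^ 2 - 1 ≠ 0 := by nlinarith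
    rw [qint_two h0 h1]
    simp only [qint_eq, zpow_add₀ hq, zpow_ofNat]
    field_simp
    ring
  have hq2 : q * qint q 2 = 1 + q ^ 2 := by
    have hq := h0.ne'
    rw [qint_two h0 h1]; field_simp; ring
  have hinv := mul_inv_cancel₀ (qint_pos h0 h1 (m := N₀ + 2 * n + 2) (by omega)).ne'
  have hu := upZero_self_sq h0 h1 (N := N₀ + 2 * n) (by omega)
  rw [inner_sub_right, inner_add_right, inner_add_right, inner_smul_right, hm, inner_smul_right,
    ← hadj.zero, inner_smul_right, inner_smul_right, hT.plus_vec, hT.zero_vec,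
    plusVec_top h0 h1 _ _ _ _ hn, zeroVec_top]
  simp only [inner_add_right, inner_add_left, inner_smul_right, inner_smul_left, inner_vec hv hlab,
    inner_vec hv hlab1, inner_vec hv hlab2, map_mul, Complex.conj_ofReal, cseq,
    true_and, and_true, if_true]
  split_ifs <;> try omega
  have hq3 := congrArg Complex.ofReal hq3
  have hq2 := congrArg Complex.ofReal hq2
  have hinv := congrArg Complex.ofReal hinv
  have hu := congrArg Complex.ofReal hu
  push_cast at hq3 hq2 hinv hu ⊢
  linear_combination (-(q : ℂ) ^ 4 * a n ^ 2) * hu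
    + (qint q (N₀ + 2 * n + 2) : ℂ)⁻¹ * a n ^ 2 * hq3
    + ((1 + (q : ℂ) ^ 2) * a n ^ 2) * hinv
    - (ρ : ℂ) ^ 2 * ((q : ℂ) * qint q 2 + 1 + (q : ℂ) ^ 2) * hq2

/-- The diagonal matrix element of the relation for `x_1 x_{-1}` at `v^l_l`. -/
theorem inner_plus_minus (h0 : 0 < q) (h1 : q < 1) (hv : Orthonormal ℂ v)
    (hT : HasSeqForm q (cseq a) (cseq b) (fun n => cseq a (n - 1)) v x₁ x₀ xₘ)
    (hadj : IsAdjointTriple q x₁ x₀ xₘ) (ha : a (-1) = 0) (hn : 0 ≤ n) (hN : 0 < N₀ + 2 * n)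
    (τ ρ : ℝ) :
    ⟪vec v n (N₀ + 2 * n),
      ((q * (1 + q ^ 2) : ℝ) : ℂ) • x₁ (xₘ (vec v n (N₀ + 2 * n)))
      - (x₀ (x₀ (vec v n (N₀ + 2 * n)))
      - ((2 * τ : ℝ) : ℂ) • x₀ (vec v n (N₀ + 2 * n))
      + ((τ ^ 2 - (1 + q ^ 2) ^ 2 * ρ ^ 2 : ℝ) : ℂ) • vec v n (N₀ + 2 * n))⟫_ℂ
    = ((q ^ 2 * qint q 2 ^ 2 * ρ ^ 2 - ((b n - τ) ^ 2
      + q ^ ((N₀ : ℤ) + 2 * n) * qint q 2 * (qint q (N₀ + 2 * n + 2))⁻¹ * a n ^ 2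
      + q ^ 3 * qint q 2 * (q ^ ((N₀ : ℤ) + 2 * n) * q ^ ((N₀ : ℤ) + 2 * n) * qint q 2
          * (qint q (N₀ + 2 * n + 1))⁻¹ * (qint q (N₀ + 2 * n + 2))⁻¹ * a n ^ 2
        + q ^ ((N₀ : ℤ) + 2 * n) * qint q 2 * (qint q (N₀ + 2 * n))⁻¹ * b n ^ 2
        + (q ^ 2)⁻¹ * a (n - 1) ^ 2)) : ℝ) : ℂ) := by
  have hlab : IsLabel N₀ n (N₀ + 2 * n) := ⟨by omega, by omega, by omega⟩
  have hlab1 : IsLabel N₀ (n + 1) (N₀ + 2 * n + 1) := ⟨by omega, by omega, by omega⟩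
  have hlab2 : IsLabel N₀ (n + 1) (N₀ + 2 * n) := ⟨by omega, by omega, by omega⟩
  have hlab3 : IsLabel N₀ n (N₀ + 2 * n - 1) := ⟨by omega, by omega, by omega⟩
  have hm : ((q * (1 + q ^ 2) : ℝ) : ℂ) * ⟪vec v n (N₀ + 2 * n), x₁ (xₘ (vec v n (N₀ + 2 * n)))⟫_ℂ
      = -((q ^ 2 * (1 + q ^ 2) : ℝ) : ℂ) *
        ⟪xₘ (vec v n (N₀ + 2 * n)), xₘ (vec v n (N₀ + 2 * n))⟫_ℂ := by
    rw [hadj.plus']; push_cast; ring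
  have hq2 : q * qint q 2 = 1 + q ^ 2 := by
    have hq := h0.ne'
    rw [qint_two h0 h1]; field_simp; ring
  -- The value `q⁻¹` of `downMinus` is available only for `N ≥ 2`. This can fail for `n = 0`, where
  -- the factor `a (-1) = 0` repairs it.
  have hd : ((downMinus q (N₀ + 2 * n) (N₀ + 2 * n) : ℂ) * a (n - 1)) • vec v (n - 1) (N₀ + 2 * n - 2)
      = ((q⁻¹ : ℝ) * a (n - 1) : ℂ) • vec v (n - 1) (N₀ + 2 * n - 2) := by
    rcases hn.eq_or_lt with rfl | hn
    · rw [zero_sub, ha]; simp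
    · rw [downMinus_self h0 h1 (by omega)]
  have hdd : ((a (n - 1) : ℂ) * a (n - 1)) * ⟪vec v (n - 1) (N₀ + 2 * n - 2), vec v (n - 1) (N₀ + 2 * n - 2)⟫_ℂ
      = (a (n - 1) : ℂ) * a (n - 1) := by
    rcases hn.eq_or_lt with rfl | hn
    · rw [zero_sub, ha]; simp
    · rw [inner_vec hv ⟨by omega, by omega, by omega⟩]; simp
  have i3 : ⟪vec v n (N₀ + 2 * n - 1), vec v (n - 1) (N₀ + 2 * n - 2)⟫_ℂ = 0 := by
    rw [inner_vec hv hlab3, if_neg (by omega)]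
  have i4 : ⟪vec v (n + 1) (N₀ + 2 * n), vec v (n - 1) (N₀ + 2 * n - 2)⟫_ℂ = 0 := by
    rw [inner_vec hv hlab2, if_neg (by omega)]
  have hu := upZero_self_sq h0 h1 (N := N₀ + 2 * n) (by omega)
  have hum := upMinus_self_sq h0 h1 (N := N₀ + 2 * n) (by omega)
  have hmm := midMinus_self_sq h0 h1 hN
  rw [inner_sub_right, inner_add_right, inner_sub_right, inner_smul_right, hm,
    ← hadj.zero, inner_smul_right, inner_smul_right, hT.minus_vec, hT.zero_vec, zeroVec_top,
    minusVec, hd]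
  simp only [inner_add_right, inner_add_left, inner_smul_right, inner_smul_left,
    inner_sub_left, inner_sub_right, inner_vec hv hlab, i3, i4, inner_eq_zero_symm.1 i3,
    inner_eq_zero_symm.1 i4,
    inner_vec hv hlab1, inner_vec hv hlab2, inner_vec hv hlab3, map_mul, Complex.conj_ofReal, cseq,
    true_and, and_true, if_true]
  split_ifs <;> try omega
  have hq2 := congrArg Complex.ofReal hq2
  have hu := congrArg Complex.ofReal hu
  have hum := congrArg Complex.ofReal hum
  have hmm := congrArg Complex.ofReal hmm
  have hq : (q : ℂ) ≠ 0 := by exact_mod_cast h0.ne'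
  have hqi : (q : ℂ) * (q : ℂ)⁻¹ = 1 := mul_inv_cancel₀ hq
  push_cast at hq2 hu hum hmm ⊢
  linear_combination (-((q : ℂ) ^ 2 * (1 + (q : ℂ) ^ 2) * a n ^ 2)) * hum
    - ((q : ℂ) ^ 2 * (1 + (q : ℂ) ^ 2) * b n ^ 2) * hmm - (a n : ℂ) ^ 2 * hu
    - ((q : ℂ) ^ 2 * (1 + (q : ℂ) ^ 2) * (q : ℂ)⁻¹ * (q : ℂ)⁻¹) * hdd
    + ((q : ℂ) ^ 2 * ((q : ℂ) ^ ((N₀ : ℤ) + 2 * n) * (q : ℂ) ^ ((N₀ : ℤ) + 2 * n) * qint q 2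
          * (qint q (N₀ + 2 * n + 1) : ℂ)⁻¹ * (qint q (N₀ + 2 * n + 2) : ℂ)⁻¹ * a n ^ 2
        + (q : ℂ) ^ ((N₀ : ℤ) + 2 * n) * qint q 2 * (qint q (N₀ + 2 * n) : ℂ)⁻¹ * b n ^ 2
        + ((q : ℂ) ^ 2)⁻¹ * a (n - 1) ^ 2)
      - (ρ : ℂ) ^ 2 * ((q : ℂ) * qint q 2 + 1 + (q : ℂ) ^ 2)) * hq2

end Equations

/-! ### The explicit reduced matrix elements solve the equations -/

section ScalarRelations

variable {q : QParam} {c : ℝ≥0∞} {ε : ℤˣ} {N₀ : ℕ} {n : ℤ}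

theorem alphaCoef_relation (q : QParam) (c : ℝ≥0∞) (ε : ℤˣ) (N₀ : ℕ) (hn : 0 ≤ n) :
    ((q : ℝ) ^ 2 * betaCoef q c ε N₀ n + tauShift q c) ^ 2 + (q : ℝ) ^ 2 * qint q 2
      * qint q (N₀ + 2 * n + 3) * (qint q (N₀ + 2 * n + 2))⁻¹ * alphaCoef q c ε N₀ n ^ 2
      = (q : ℝ) ^ 2 * qint q 2 ^ 2 * discr c ^ 2 := by
  have h0 : (0 : ℝ) < q := q.2.1
  have h1 : (q : ℝ) < 1 := q.2.2
  have p2 := (qint_pos h0 h1 (m := N₀ + 2 * n + 2) (by omega)).ne'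
  have e1 := alphaCoef_sq q c ε N₀ hn
  have e2 := gammaCoef_eq q c ε N₀ hn
  have e3 : (qint q (N₀ + 2 * n + 2) * ((q : ℝ) ^ 2 * betaCoef q c ε N₀ n + tauShift q c)) ^ 2
      + (q : ℝ) ^ 2 * qint q 2 * (alphaCoef q c ε N₀ n ^ 2 *
        (qint q (N₀ + 2 * n + 3) * qint q (N₀ + 2 * n + 2)))
      = (q : ℝ) ^ 2 * qint q 2 ^ 2 * discr c ^ 2 * qint q (N₀ + 2 * n + 2) ^ 2 := by
    rw [e1, ← e2]; ring
  field_simp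
  have p3 := pow_ne_zero 1 p2
  apply mul_right_cancel₀ p2
  linear_combination e3

/-- By `gammaCoef_sub_one_eq` this is `alphaCoef_sq` at `n - 1`. For `n = 0` both sides vanish,
because `γ(-1)² = [N₀]² ρ²`. -/
theorem alphaCoef_pred_sq (q : QParam) (c : ℝ≥0∞) (ε : ℤˣ) (N₀ : ℕ) (hn : 0 ≤ n) :
    (q : ℝ) ^ 2 * qint q 2 ^ 2 * (qint q (N₀ + 2 * n) * qint q (N₀ + 2 * n + 1))
        * alphaCoef q c ε N₀ (n - 1) ^ 2
      = qint q 2 * ((q : ℝ) ^ 2 * qint q 2 ^ 2 * qint q (N₀ + 2 * n) ^ 2 * discr c ^ 2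
        - (qint q (N₀ + 2 * n + 2) * ((q : ℝ) ^ 2 * betaCoef q c ε N₀ n)
          - tauShift q c * qint q (N₀ + 2 * n)) ^ 2) := by
  rw [← gammaCoef_sub_one_eq q c ε N₀ hn]
  rcases hn.eq_or_lt with rfl | hn
  · have hγ : gammaCoef q c ε N₀ (-1) = qint q N₀ * sgnDiscr c ε := by
      simp [gammaCoef, qint_zero]
    rw [zero_sub, alphaCoef_neg_one, hγ, mul_zero, add_zero]
    linear_combination (qint q 2 * (q : ℝ) ^ 2 * qint q 2 ^ 2 * qint q N₀ ^ 2) * sgnDiscr_sq c ε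
  · have h := alphaCoef_sq q c ε N₀ (n := n - 1) (by omega)
    rw [show (N₀ : ℤ) + 2 * (n - 1) + 2 = N₀ + 2 * n by ring,
      show (N₀ : ℤ) + 2 * (n - 1) + 3 = N₀ + 2 * n + 1 by ring] at h
    linear_combination ((q : ℝ) ^ 2 * qint q 2 ^ 2) * h

theorem betaCoef_zero (q : QParam) (c : ℝ≥0∞) (ε : ℤˣ) : betaCoef q c ε 0 0 = 0 := by
  rw [betaCoef_eq]
  simp [qint_zero]

end ScalarRelations

/-! ### Formal adjoints on a pre-Hilbert space -/

section Adjoints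

variable {D : Type*} [NormedAddCommGroup D] [InnerProductSpace ℂ D]

/-- `T` is a formal adjoint of `S`. -/
def IsAdj (S T : Module.End ℂ D) : Prop := ∀ x y, ⟪S x, y⟫_ℂ = ⟪x, T y⟫_ℂ

variable {S S' T T' : Module.End ℂ D}

theorem IsAdj.symm (h : IsAdj S T) : IsAdj T S := fun x y => by
  rw [← inner_conj_symm, ← h, inner_conj_symm]

/-- Allows a relation between operators to be turned into the relation between their adjoints. -/
theorem IsAdj.unique (h : IsAdj S T) (h' : IsAdj S T') : T = T' := by
  refine LinearMap.ext fun y => ext_inner_left ℂ fun x => ?_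
  rw [← h, h']

theorem IsAdj.mul (h : IsAdj S S') (h' : IsAdj T T') : IsAdj (S * T) (T' * S') := fun x y => by
  rw [Module.End.mul_apply, h, h', Module.End.mul_apply]

theorem IsAdj.add (h : IsAdj S S') (h' : IsAdj T T') : IsAdj (S + T) (S' + T') := fun x y => by
  rw [LinearMap.add_apply, LinearMap.add_apply, inner_add_left, inner_add_right, h, h']

theorem IsAdj.smul (h : IsAdj S S') (r : ℝ) : IsAdj ((r : ℂ) • S) ((r : ℂ) • S') := fun x y => by
  rw [LinearMap.smul_apply, LinearMap.smul_apply, inner_smul_left, inner_smul_right,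
    Complex.conj_ofReal, h]

theorem isAdj_one : IsAdj (1 : Module.End ℂ D) 1 := fun _ _ => rfl

theorem isAdj_of_vec {N₀ : ℕ} {v : SpinIndex N₀ → D} (hs : Spans v)
    (h : ∀ n k n' k' : ℤ, IsLabel N₀ n k → IsLabel N₀ n' k' →
      ⟪S (vec v n k), vec v n' k'⟫_ℂ = ⟪vec v n k, T (vec v n' k')⟫_ℂ) : IsAdj S T := by
  intro x y
  have hx : x ∈ Submodule.span ℂ (Set.range v) := by rw [show _ = _ from hs]; trivial
  induction hx using Submodule.span_induction with
  | mem u hu =>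
    obtain ⟨⟨n, k⟩, rfl⟩ := hu
    rw [← vec_natCast v n k]
    have := Spans.hom_ext hs (S := ((innerSL ℂ (S (vec v n k))) : D →ₗ[ℂ] ℂ))
      (T := ((innerSL ℂ (vec v n k)) : D →ₗ[ℂ] ℂ) ∘ₗ T)
      (fun n' k' h' => h _ _ _ _ (isLabel_natCast n k) h')
    exact LinearMap.congr_fun this y
  | zero => simp
  | add u w _ _ hu hw => rw [map_add, inner_add_left, inner_add_left, hu, hw]
  | smul z u _ hu => rw [map_smul, inner_smul_left, inner_smul_left, hu]

end Adjoints

/-! ### Adjointness of the explicit operators -/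

section Construction

variable {N₀ : ℕ} {D : Type*} [NormedAddCommGroup D] [InnerProductSpace ℂ D]
  {q : ℝ} {v : SpinIndex N₀ → D} {E F K x₁ x₀ xₘ : Module.End ℂ D}

theorem IsLadder.isAdj_E_F (hL : IsLadder q v E F K) (hv : Orthonormal ℂ v) (hs : Spans v) :
    IsAdj F E := by
  refine isAdj_of_vec hs fun n k n' k' h h' => ?_
  rw [hL.F_vec, hL.E_vec, inner_smul_left, inner_smul_right, inner_vec hv h, inner_vec' hv h',
    Complex.conj_ofReal]
  by_cases hc : n = n' ∧ k = k' + 1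
  · obtain ⟨rfl, rfl⟩ := hc
    rw [fCoef_add_one]
    simp
  · rw [if_neg (by omega), if_neg hc, mul_zero, mul_zero]

theorem IsLadder.isAdj_K (hL : IsLadder q v E F K) (hv : Orthonormal ℂ v) (hs : Spans v) :
    IsAdj K K := by
  refine isAdj_of_vec hs fun n k n' k' h h' => ?_
  rw [hL.K_vec, hL.K_vec, inner_smul_left, inner_smul_right, inner_vec hv h, Complex.conj_ofReal]
  split_ifs with hc
  · obtain ⟨rfl, rfl⟩ := hc; rfl
  · rw [mul_zero, mul_zero]

/-- At most one of the three components contributes to a given matrix element, and there the claim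
is one of the entrywise identities such as `upPlus_eq`. The sequences are real, so conjugation is
invisible. -/
theorem HasSeqForm.isAdjointTriple (h0 : 0 < q) {a b : ℤ → ℝ}
    (hT : HasSeqForm q (cseq a) (cseq b) (fun n => cseq a (n - 1)) v x₁ x₀ xₘ)
    (hv : Orthonormal ℂ v) (hs : Spans v) : IsAdjointTriple q x₁ x₀ xₘ := by
  refine ⟨?_, ?_⟩
  · have : IsAdj x₁ (((-q : ℝ) : ℂ) • xₘ) := by
      refine isAdj_of_vec hs fun n k n' k' h h' => ?_
      rw [LinearMap.smul_apply, inner_smul_right, hT.plus_vec, hT.minus_vec, plusVec, minusVec]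
      simp only [inner_add_right, inner_sub_right, inner_sub_left, inner_smul_left,
        inner_smul_right, inner_vec hv h, inner_vec' hv h', map_mul, Complex.conj_ofReal, cseq]
      by_cases c1 : n' = n + 1 ∧ k' = k + 2
      · obtain ⟨rfl, rfl⟩ := c1
        split_ifs <;> try omega
        rw [upPlus_eq h0, show (N₀ : ℤ) + 2 * (n + 1) = N₀ + 2 * n + 2 by ring,
          show n + 1 - 1 = n by ring]
        push_cast
        ring
      by_cases c2 : n' = n ∧ k' = k + 1
      · obtain ⟨rfl, rfl⟩ := c2
        split_ifs <;> try omega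
        rw [midPlus_eq h0]
        push_cast
        ring
      by_cases c3 : n' = n - 1 ∧ k' = k
      · obtain ⟨rfl, rfl⟩ := c3
        split_ifs <;> try omega
        rw [downPlus_eq h0, show (N₀ : ℤ) + 2 * (n - 1) = N₀ + 2 * n - 2 by ring]
        push_cast
        ring
      rw [if_neg (by omega), if_neg (by omega), if_neg (by omega), if_neg (by omega),
        if_neg (by omega), if_neg (by omega)]
      ring
    intro x y
    rw [this x y, LinearMap.smul_apply, inner_smul_right]
  · refine isAdj_of_vec hs fun n k n' k' h h' => ?_
    rw [hT.zero_vec, hT.zero_vec, zeroVec, zeroVec]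
    simp only [inner_add_right, inner_add_left, inner_smul_left,
      inner_smul_right, inner_vec hv h, inner_vec' hv h', map_mul, Complex.conj_ofReal, cseq]
    by_cases c1 : n' = n + 1 ∧ k' = k + 1
    · obtain ⟨rfl, rfl⟩ := c1
      split_ifs <;> try omega
      rw [upZero_eq, show (N₀ : ℤ) + 2 * (n + 1) = N₀ + 2 * n + 2 by ring,
        show n + 1 - 1 = n by ring]
      ring
    by_cases c2 : n' = n ∧ k' = k
    · obtain ⟨rfl, rfl⟩ := c2
      split_ifs <;> try omega
      ring
    by_cases c3 : n' = n - 1 ∧ k' = k - 1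
    · obtain ⟨rfl, rfl⟩ := c3
      split_ifs <;> try omega
      rw [upZero_eq q ((N₀ : ℤ) + 2 * (n - 1)), show (N₀ : ℤ) + 2 * (n - 1) + 2 = N₀ + 2 * n by ring,
        show k - 1 + 1 = k by ring]
      ring
    split_ifs <;> try omega
    ring

theorem K_zeroVec (hL : IsLadder q v E F K) (a b d : ℤ → ℂ) (n k : ℤ) :
    K (zeroVec q a b d v n k)
      = (wt q (N₀ + 2 * n) k : ℂ) • zeroVec q a b d v n k := by
  simp only [zeroVec, map_add, map_smul, hL.K_vec,
    show (N₀ : ℤ) + 2 * (n + 1) = N₀ + 2 * n + 2 by ring,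
    show (N₀ : ℤ) + 2 * (n - 1) = N₀ + 2 * n - 2 by ring, wt_add_two, wt_sub_two]
  module

end Construction

/-! ### Covariance of the defects of the sphere relations -/

section CrossRelations

variable {R : Type*} [Ring R] [Algebra ℂ R]

/-- The relations of `x_1, x_0, x_{-1}` with `E, F, K`. -/
structure IsSpinOneVector (Q r : ℂ) (x₁ x₀ xₘ E F K : R) : Prop where
  K_plus : K * x₁ = Q • (x₁ * K)
  K_zero : K * x₀ = x₀ * K
  K_minus : K * xₘ = Q⁻¹ • (xₘ * K)
  E_plus : E * x₁ = Q⁻¹ • (x₁ * E)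
  E_zero : E * x₀ = x₀ * E + r • (x₁ * K)
  E_minus : E * xₘ = Q • (xₘ * E) + r • (x₀ * K)
  F_plus : F * x₁ = Q⁻¹ • (x₁ * F) + r • (x₀ * K)
  F_zero : F * x₀ = x₀ * F + r • (xₘ * K)
  F_minus : F * xₘ = Q • (xₘ * F)

/-- The defect of the relation of `x_0` and `x_1`. -/
def zeroPlusDefect (Q t : ℂ) (x₁ x₀ : R) : R := x₀ * x₁ - Q ^ 2 • (x₁ * x₀) - t • x₁

/-- The defect of the relation for `x_{-1} x_1`. -/
def minusPlusDefect (Q t z : ℂ) (x₁ x₀ xₘ : R) : R :=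
  (Q * (1 + Q ^ 2)) • (xₘ * x₁) - (Q ^ 4 • (x₀ * x₀) + (Q ^ 2 * t) • x₀ + z • 1)

/-- The defect of the relation for `x_1 x_{-1}`. -/
def plusMinusDefect (Q t z : ℂ) (x₁ x₀ xₘ : R) : R :=
  (Q * (1 + Q ^ 2)) • (x₁ * xₘ) - (x₀ * x₀ - t • x₀ + z • 1)

variable {Q r t z : ℂ} {x₁ x₀ xₘ E F K : R}

namespace IsSpinOneVector

theorem mul_left_relations (h : IsSpinOneVector Q r x₁ x₀ xₘ E F K) (w : R) :
    K * (x₁ * w) = Q • (x₁ * (K * w)) ∧ K * (x₀ * w) = x₀ * (K * w) ∧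
    K * (xₘ * w) = Q⁻¹ • (xₘ * (K * w)) ∧ E * (x₁ * w) = Q⁻¹ • (x₁ * (E * w)) ∧
    E * (x₀ * w) = x₀ * (E * w) + r • (x₁ * (K * w)) ∧
    E * (xₘ * w) = Q • (xₘ * (E * w)) + r • (x₀ * (K * w)) ∧
    F * (x₁ * w) = Q⁻¹ • (x₁ * (F * w)) + r • (x₀ * (K * w)) ∧
    F * (x₀ * w) = x₀ * (F * w) + r • (xₘ * (K * w)) ∧
    F * (xₘ * w) = Q • (xₘ * (F * w)) := by
  obtain ⟨k1, k0, km, e1, e0, em, f1, f0, fm⟩ := h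
  simp only [← mul_assoc, k1, k0, km, e1, e0, em, f1, f0, fm, add_mul, smul_mul_assoc, and_self]

theorem K_mul_zeroPlusDefect (h : IsSpinOneVector Q r x₁ x₀ xₘ E F K) :
    K * zeroPlusDefect Q t x₁ x₀ = Q • (zeroPlusDefect Q t x₁ x₀ * K) := by
  have h' := h.mul_left_relations
  simp only [zeroPlusDefect, mul_sub, sub_mul, mul_smul_comm, smul_mul_assoc, mul_assoc,
    h' _, h.K_plus, h.K_zero]
  module

/-- Together with `K_mul_zeroPlusDefect`, this is the commutation behaviour of `x_1` itself: the
defect is the highest component of a spin one tensor operator. -/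
theorem E_mul_zeroPlusDefect (hQ : Q ≠ 0) (h : IsSpinOneVector Q r x₁ x₀ xₘ E F K) :
    E * zeroPlusDefect Q t x₁ x₀ = Q⁻¹ • (zeroPlusDefect Q t x₁ x₀ * E) := by
  have h' := h.mul_left_relations
  simp only [zeroPlusDefect, mul_sub, sub_mul, mul_smul_comm, smul_mul_assoc, mul_assoc, mul_add,
    h' _, h.E_plus, h.E_zero, h.K_plus]
  match_scalars <;> field_simp <;> ring

/-- Lowering the spin one defect gives the difference of the two quadratic defects. The constant `z`
cancels, hence is arbitrary. -/
theorem F_mul_zeroPlusDefect (hQ : Q ≠ 0) (h : IsSpinOneVector Q r x₁ x₀ xₘ E F K) (z : ℂ) :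
    (1 + Q ^ 2) • (F * zeroPlusDefect Q t x₁ x₀ - Q⁻¹ • (zeroPlusDefect Q t x₁ x₀ * F))
      = r • ((minusPlusDefect Q t z x₁ x₀ xₘ - plusMinusDefect Q t z x₁ x₀ xₘ) * K) := by
  have h' := h.mul_left_relations
  simp only [zeroPlusDefect, minusPlusDefect, plusMinusDefect, mul_sub, sub_mul, mul_smul_comm,
    smul_mul_assoc, mul_assoc, mul_add, add_mul, one_mul,
    h' _, h.F_plus, h.F_zero, h.K_plus, h.K_zero]
  match_scalars <;> field_simp <;> ring

theorem K_mul_minusPlusDefect (hQ : Q ≠ 0) (h : IsSpinOneVector Q r x₁ x₀ xₘ E F K) :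
    K * minusPlusDefect Q t z x₁ x₀ xₘ = minusPlusDefect Q t z x₁ x₀ xₘ * K := by
  have h' := h.mul_left_relations
  simp only [minusPlusDefect, mul_sub, sub_mul, mul_smul_comm, smul_mul_assoc, mul_assoc, mul_add,
    add_mul, mul_one, one_mul, h' _, h.K_plus, h.K_zero]
  match_scalars <;> field_simp

/-- Once the spin one defect is zero, this quadratic defect commutes with `E`, so that it becomes a
tensor operator of rank `0`. -/
theorem E_mul_minusPlusDefect (hQ : Q ≠ 0) (h : IsSpinOneVector Q r x₁ x₀ xₘ E F K) :
    E * minusPlusDefect Q t z x₁ x₀ xₘ - minusPlusDefect Q t z x₁ x₀ xₘ * E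
      = (r * Q ^ 2) • (zeroPlusDefect Q t x₁ x₀ * K) := by
  have h' := h.mul_left_relations
  simp only [minusPlusDefect, zeroPlusDefect, mul_sub, sub_mul, mul_smul_comm, smul_mul_assoc,
    mul_assoc, mul_add, add_mul, mul_one, one_mul, h' _, h.E_plus, h.E_zero, h.K_plus, h.K_zero]
  match_scalars <;> field_simp <;> ring

end IsSpinOneVector

end CrossRelations

/-! ### The explicit operators satisfy the relations -/

section Existence

variable {N₀ : ℕ} {D : Type*} [NormedAddCommGroup D] [InnerProductSpace ℂ D]
  {v : SpinIndex N₀ → D} {E F K Ki x₁ x₀ xₘ : Module.End ℂ D}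

theorem IsAdjointTriple.isAdj_plus {q : ℝ} (h : IsAdjointTriple q x₁ x₀ xₘ) :
    IsAdj x₁ (((-q : ℝ) : ℂ) • xₘ) := fun x y => by
  rw [h.plus, LinearMap.smul_apply, inner_smul_right]

theorem IsAdjointTriple.isAdj_minus {q : ℝ} (h0 : 0 < q) (h : IsAdjointTriple q x₁ x₀ xₘ) :
    IsAdj xₘ (((-q⁻¹ : ℝ) : ℂ) • x₁) := fun x y => by
  have hq : (q : ℂ) ≠ 0 := by exact_mod_cast h0.ne'
  rw [LinearMap.smul_apply, inner_smul_right, h.plus']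
  push_cast
  field_simp

theorem HasSeqForm.isSpinOneVector {q : ℝ} (h0 : 0 < q) (h1 : q < 1) (hL : IsLadder q v E F K)
    (hv : Orthonormal ℂ v) (hs : Spans v) {a b : ℤ → ℝ}
    (hT : HasSeqForm q (cseq a) (cseq b) (fun n => cseq a (n - 1)) v x₁ x₀ xₘ)
    (hb : N₀ = 0 → b 0 = 0) : IsSpinOneVector (q : ℂ) (qrt q 2 : ℂ) x₁ x₀ xₘ E F K := by
  have hq : (q : ℂ) ≠ 0 := by exact_mod_cast h0.ne'
  have hadj := hT.isAdjointTriple h0 hv hs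
  have aK := hL.isAdj_K hv hs
  have aF := hL.isAdj_E_F hv hs
  have a1 := hadj.isAdj_plus
  have am := hadj.isAdj_minus h0
  have a0 : IsAdj x₀ x₀ := hadj.zero
  have k1 : K * x₁ = (q : ℂ) • (x₁ * K) := hs.hom_ext fun n k _ => by
    simp only [Module.End.mul_apply, LinearMap.smul_apply]
    rw [hT.plus_vec, K_plusVec h0 hL, hL.K_vec, map_smul, hT.plus_vec, smul_smul]
    push_cast
    rfl
  have k0 : K * x₀ = x₀ * K := hs.hom_ext fun n k _ => by
    simp only [Module.End.mul_apply]
    rw [hT.zero_vec, K_zeroVec hL, hL.K_vec, map_smul, hT.zero_vec]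
  have e1 : E * x₁ = (q : ℂ)⁻¹ • (x₁ * E) := hs.hom_ext fun n k _ => by
    simp only [Module.End.mul_apply, LinearMap.smul_apply]
    rw [hT.plus_vec, E_plusVec h0 hL, hL.E_vec, map_smul, hT.plus_vec, smul_smul]
    push_cast
    rfl
  have f1 : F * x₁ = (q : ℂ)⁻¹ • (x₁ * F) + (qrt q 2 : ℂ) • (x₀ * K) :=
    hs.hom_ext fun n k h => by
      simp only [Module.End.mul_apply, LinearMap.smul_apply, LinearMap.add_apply]
      rw [F_plusVec h0 h1 hL hT.plus_vec (fun h => by rw [cseq, hb h, Complex.ofReal_zero]) h,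
        hL.K_vec, map_smul, hT.zero_vec, smul_smul]
      push_cast
      rfl
  have f0 : F * x₀ = x₀ * F + (qrt q 2 : ℂ) • (xₘ * K) := hs.hom_ext fun n k h => by
    simp only [Module.End.mul_apply, LinearMap.smul_apply, LinearMap.add_apply]
    rw [F_zeroVec h0 h1 hL hT.zero_vec h, hL.K_vec, map_smul, hT.minus_vec, smul_smul]
    push_cast
    rfl
  have fold : ∀ r : ℝ, ((r : ℝ) : ℂ)⁻¹ = ((r⁻¹ : ℝ) : ℂ) := fun r => (Complex.ofReal_inv r).symm
  -- The relations of `K` with `x_{-1}`, of `E` with `x_0` and `x_{-1}`, and of `F` with `x_{-1}`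
  -- are the adjoints of `k1`, `f0`, `f1` and `e1`.
  refine ⟨k1, k0, ?_, e1, ?_, ?_, f1, f0, ?_⟩
  · have h := (aK.mul a1).unique (k1 ▸ (a1.mul aK).smul q)
    simp only [mul_smul_comm, smul_mul_assoc, Complex.ofReal_neg] at h
    linear_combination (norm := (match_scalars <;> field_simp <;> ring)) ((q : ℂ)⁻¹ ^ 2) • h
  · have h := (aF.mul a0).unique (f0 ▸ (a0.mul aF).add ((am.mul aK).smul (qrt q 2)))
    simp only [mul_smul_comm, Complex.ofReal_neg, Complex.ofReal_inv, k1] at h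
    linear_combination (norm := (match_scalars <;> field_simp <;> ring)) (-1 : ℂ) • h
  · have h := (aF.mul a1).unique
      (f1 ▸ fold q ▸ ((a1.mul aF).smul q⁻¹).add ((a0.mul aK).smul (qrt q 2)))
    simp only [mul_smul_comm, smul_mul_assoc, Complex.ofReal_neg, k0] at h
    linear_combination (norm := (match_scalars <;> field_simp <;> ring)) h
  · have h := (aF.symm.mul a1).unique (e1 ▸ fold q ▸ (a1.mul aF.symm).smul q⁻¹)
    simp only [mul_smul_comm, smul_mul_assoc, Complex.ofReal_neg] at h
    linear_combination (norm := (match_scalars <;> field_simp <;> ring)) h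

/-- The first relation holds if the reduced matrix elements satisfy the recursion. -/
theorem HasSeqForm.zeroPlusDefect_eq_zero {q : ℝ} (h0 : 0 < q) (h1 : q < 1)
    (hL : IsLadder q v E F K) (hv : Orthonormal ℂ v) (hs : Spans v) {a b : ℤ → ℝ}
    (hT : HasSeqForm q (cseq a) (cseq b) (fun n => cseq a (n - 1)) v x₁ x₀ xₘ)
    (ha : a (-1) = 0) (hb : N₀ = 0 → b 0 = 0) {τ ρ : ℝ}
    (hrec : ∀ n : ℤ, 0 ≤ n → q ^ 2 * qint q (N₀ + 2 * n + 4) * b (n + 1)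
      = qint q (N₀ + 2 * n + 2) * (q ^ 2 * b n + 2 * τ))
    (hH : ∀ n : ℤ, 0 ≤ n → (q ^ 2 * b n + τ) ^ 2 + q ^ 2 * qint q 2 * qint q (N₀ + 2 * n + 3)
      * (qint q (N₀ + 2 * n + 2))⁻¹ * a n ^ 2 = q ^ 2 * qint q 2 ^ 2 * ρ ^ 2)
    (hU : ∀ n : ℤ, 0 ≤ n → q ^ 2 * qint q 2 ^ 2 * (qint q (N₀ + 2 * n) * qint q (N₀ + 2 * n + 1))
        * a (n - 1) ^ 2 = qint q 2 * (q ^ 2 * qint q 2 ^ 2 * qint q (N₀ + 2 * n) ^ 2 * ρ ^ 2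
        - (qint q (N₀ + 2 * n + 2) * (q ^ 2 * b n) - τ * qint q (N₀ + 2 * n)) ^ 2)) :
    zeroPlusDefect (q : ℂ) ((2 * τ : ℝ) : ℂ) x₁ x₀ = 0 := by
  have hq : (q : ℂ) ≠ 0 := by exact_mod_cast h0.ne'
  have hadj := hT.isAdjointTriple h0 hv hs
  have aK := hL.isAdj_K hv hs
  have aF := hL.isAdj_E_F hv hs
  have hV := hT.isSpinOneVector h0 h1 hL hv hs hb
  have happ : ∀ w, zeroPlusDefect (q : ℂ) ((2 * τ : ℝ) : ℂ) x₁ x₀ w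
      = x₀ (x₁ w) - ((q ^ 2 : ℝ) : ℂ) • x₁ (x₀ w) - ((2 * τ : ℝ) : ℂ) • x₁ w := fun w => by
    rw [Complex.ofReal_pow]; rfl
  have hEX := hV.E_mul_zeroPlusDefect (t := ((2 * τ : ℝ) : ℂ)) hq
  have hKX := hV.K_mul_zeroPlusDefect (t := ((2 * τ : ℝ) : ℂ))
  have hFX := hV.F_mul_zeroPlusDefect (t := ((2 * τ : ℝ) : ℂ)) hq
    ((τ ^ 2 - (1 + q ^ 2) ^ 2 * ρ ^ 2 : ℝ) : ℂ)
  set X := zeroPlusDefect (q : ℂ) ((2 * τ : ℝ) : ℂ) x₁ x₀ with hX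
  -- `F_mul_zeroPlusDefect` is evaluated at the highest weight vector. The right side vanishes by
  -- the two quadratic equations, and the term with `F` on the left vanishes because `E v^l_l = 0`;
  -- what remains is a nonzero multiple of the wanted entry.
  have diag : ∀ n : ℤ, 0 ≤ n → 0 < N₀ + 2 * n →
      ⟪vec v n (N₀ + 2 * n), X (vec v n (N₀ + 2 * n - 1))⟫_ℂ = 0 := by
    intro n hn hN
    have h := congrArg (fun T : Module.End ℂ D => ⟪vec v n (N₀ + 2 * n), T (vec v n (N₀ + 2 * n))⟫_ℂ)
      hFX
    have hmp := inner_minus_plus h0 h1 hv hT hadj hn τ ρ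
    have hpm := inner_plus_minus h0 h1 hv hT hadj ha hn hN τ ρ
    rw [hH n hn, sub_self] at hmp
    rw [(quadratic_iff h0 h1 hN (hH n hn)).2 (hU n hn), sub_self] at hpm
    have hmp' : ⟪vec v n (N₀ + 2 * n), minusPlusDefect (q : ℂ) ((2 * τ : ℝ) : ℂ)
        ((τ ^ 2 - (1 + q ^ 2) ^ 2 * ρ ^ 2 : ℝ) : ℂ) x₁ x₀ xₘ (vec v n (N₀ + 2 * n))⟫_ℂ = 0 := by
      rw [← Complex.ofReal_zero, ← hmp]
      push_cast
      rfl
    have hpm' : ⟪vec v n (N₀ + 2 * n), plusMinusDefect (q : ℂ) ((2 * τ : ℝ) : ℂ)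
        ((τ ^ 2 - (1 + q ^ 2) ^ 2 * ρ ^ 2 : ℝ) : ℂ) x₁ x₀ xₘ (vec v n (N₀ + 2 * n))⟫_ℂ = 0 := by
      rw [← Complex.ofReal_zero, ← hpm]
      push_cast
      rfl
    simp only [LinearMap.smul_apply, Module.End.mul_apply, LinearMap.sub_apply, hL.K_vec, map_smul,
      inner_smul_right, inner_sub_right, hmp', hpm', sub_zero, mul_zero] at h
    rw [← aF.symm, hL.E_vec, hL.F_vec, map_smul, inner_smul_left, inner_smul_right,
      vec_eq_zero v (n := n) (k := N₀ + 2 * n + 1) (fun h => by have := h.2.2; omega),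
      inner_zero_left, mul_zero, zero_sub] at h
    have hf : (fCoef q (N₀ + 2 * n) (N₀ + 2 * n) : ℂ) ≠ 0 := by
      have := eCoef_ne_zero h0 h1 (N := N₀ + 2 * n) (k := N₀ + 2 * n - 1) (by omega) (by omega)
      rw [eCoef_sub_one] at this
      exact_mod_cast this
    have hq2 : (1 + (q : ℂ) ^ 2) ≠ 0 := by
      have : (1 + q ^ 2 : ℝ) ≠ 0 := by positivity
      exact_mod_cast this
    simpa [hq2, hf, hq] using h
  refine hs.hom_ext fun n k _ => ?_
  rw [LinearMap.zero_apply]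
  have key := family_eq_zero h0 h1 hs.dense hL aF aK (r := 1) (μ := (q : ℂ)⁻¹) (inv_ne_zero hq)
    (y := fun n k => X (vec v n k)) ?_ ?_ ?_ ?_ ?_
  · exact key n k
  · intro n k h
    rw [vec_eq_zero v h, map_zero]
  · intro n k
    have h := LinearMap.congr_fun hKX (vec v n k)
    simp only [LinearMap.smul_apply, Module.End.mul_apply, hL.K_vec, map_smul, smul_smul] at h
    rw [h]
    push_cast
    rw [pow_one]
  · intro n k
    have h := LinearMap.congr_fun hEX (vec v n k)
    simp only [LinearMap.smul_apply, Module.End.mul_apply, hL.E_vec, map_smul, smul_smul] at h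
    exact h
  · intro n e hn he her
    have : e = 0 ∨ e = 1 := by push_cast at her; omega
    rcases this with rfl | rfl
    · simp only [add_zero, mul_zero, Nat.cast_one]
      rcases (by omega : (0 : ℤ) = N₀ + 2 * n ∨ 0 < N₀ + 2 * n) with h | h
      · rw [vec_eq_zero v (n := n) (k := N₀ + 2 * n - 1) (fun h => by have := h.2.1; omega),
          map_zero, inner_zero_right]
      · exact diag n hn h
    · simp only [Nat.cast_one, mul_one, add_sub_cancel_right]
      rw [happ, inner_zero_plus_top h0 h1 hv hT hn, hrec n hn, sub_self, mul_zero,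
        Complex.ofReal_zero]
  · intro n e hn he her
    obtain rfl : e = -1 := by push_cast at her; omega
    simp only [Nat.cast_one, neg_add_cancel]
    rcases hn.eq_or_lt with rfl | hn
    · rw [vec_eq_zero v (fun h => by have := h.1; omega), inner_zero_left]
    · obtain ⟨m, rfl⟩ : ∃ m, n = m + 1 := ⟨n - 1, by ring⟩
      rw [happ, add_neg_cancel_right, inner_zero_plus_bot h0 h1 hv hT hb (by omega),
        hrec m (by omega), sub_self, mul_zero, Complex.ofReal_zero]

/-- As the spin one defect is zero, this is a tensor operator of rank `0`; only its diagonal entries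
at highest weights have to be checked, and these are `hH`. -/
theorem HasSeqForm.minusPlusDefect_eq_zero {q : ℝ} (h0 : 0 < q) (h1 : q < 1)
    (hL : IsLadder q v E F K) (hv : Orthonormal ℂ v) (hs : Spans v) {a b : ℤ → ℝ}
    (hT : HasSeqForm q (cseq a) (cseq b) (fun n => cseq a (n - 1)) v x₁ x₀ xₘ)
    (hb : N₀ = 0 → b 0 = 0) {τ ρ : ℝ}
    (hX : zeroPlusDefect (q : ℂ) ((2 * τ : ℝ) : ℂ) x₁ x₀ = 0)
    (hH : ∀ n : ℤ, 0 ≤ n → (q ^ 2 * b n + τ) ^ 2 + q ^ 2 * qint q 2 * qint q (N₀ + 2 * n + 3)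
      * (qint q (N₀ + 2 * n + 2))⁻¹ * a n ^ 2 = q ^ 2 * qint q 2 ^ 2 * ρ ^ 2) :
    minusPlusDefect (q : ℂ) ((2 * τ : ℝ) : ℂ) ((τ ^ 2 - (1 + q ^ 2) ^ 2 * ρ ^ 2 : ℝ) : ℂ) x₁ x₀ xₘ
      = 0 := by
  have hq : (q : ℂ) ≠ 0 := by exact_mod_cast h0.ne'
  have hadj := hT.isAdjointTriple h0 hv hs
  have hV := hT.isSpinOneVector h0 h1 hL hv hs hb
  have hE := hV.E_mul_minusPlusDefect (t := ((2 * τ : ℝ) : ℂ))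
    (z := ((τ ^ 2 - (1 + q ^ 2) ^ 2 * ρ ^ 2 : ℝ) : ℂ)) hq
  have hK := hV.K_mul_minusPlusDefect (t := ((2 * τ : ℝ) : ℂ))
    (z := ((τ ^ 2 - (1 + q ^ 2) ^ 2 * ρ ^ 2 : ℝ) : ℂ)) hq
  rw [hX, zero_mul, smul_zero, sub_eq_zero] at hE
  have htop : ∀ n : ℤ, 0 ≤ n → ⟪vec v n (N₀ + 2 * n), minusPlusDefect (q : ℂ) ((2 * τ : ℝ) : ℂ)
      ((τ ^ 2 - (1 + q ^ 2) ^ 2 * ρ ^ 2 : ℝ) : ℂ) x₁ x₀ xₘ (vec v n (N₀ + 2 * n))⟫_ℂ = 0 := by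
    intro n hn
    have hmp := inner_minus_plus h0 h1 hv hT hadj hn τ ρ
    rw [hH n hn, sub_self] at hmp
    rw [← Complex.ofReal_zero, ← hmp]
    push_cast
    rfl
  refine hs.hom_ext fun n k _ => ?_
  rw [LinearMap.zero_apply]
  have key := family_eq_zero h0 h1 hs.dense hL (hL.isAdj_E_F hv hs) (hL.isAdj_K hv hs) (r := 0)
    (μ := 1) one_ne_zero (y := fun n k => minusPlusDefect (q : ℂ) ((2 * τ : ℝ) : ℂ)
      ((τ ^ 2 - (1 + q ^ 2) ^ 2 * ρ ^ 2 : ℝ) : ℂ) x₁ x₀ xₘ (vec v n k)) ?_ ?_ ?_ ?_ ?_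
  · exact key n k
  · intro n k h
    rw [vec_eq_zero v h, map_zero]
  · intro n k
    have h := LinearMap.congr_fun hK (vec v n k)
    simp only [Module.End.mul_apply, hL.K_vec, map_smul] at h
    rw [h, pow_zero, one_mul]
  · intro n k
    have h := LinearMap.congr_fun hE (vec v n k)
    simp only [Module.End.mul_apply, hL.E_vec, map_smul] at h
    rw [h, one_mul]
  · intro n e hn he her
    obtain rfl : e = 0 := by push_cast at her; omega
    simp only [add_zero, mul_zero, Nat.cast_zero, sub_zero]
    exact htop n hn
  · intro n e _ he her
    push_cast at her
    omega

/-- The explicit operators satisfy the relations of the Podles sphere and the cross relations. -/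
theorem HasSeqForm.isSpinOneTriple {q : QParam} {c : ℝ≥0∞} {ε : ℤˣ}
    (hL : IsLadder q v E F K) (hKKi : K * Ki = 1)
    (hv : Orthonormal ℂ v) (hs : Spans v)
    (hT : HasSeqForm q (alphaSeq q c ε N₀) (betaSeq q c ε N₀) (fun n => alphaSeq q c ε N₀ (n - 1))
      v x₁ x₀ xₘ) : IsSpinOneTriple q c x₁ x₀ xₘ E F K := by
  have h0 : (0 : ℝ) < q := q.2.1
  have h1 : (q : ℝ) < 1 := q.2.2
  have hq : ((q : ℝ) : ℂ) ≠ 0 := by exact_mod_cast h0.ne'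
  have hT : HasSeqForm q (cseq (alphaCoef q c ε N₀)) (cseq (betaCoef q c ε N₀))
    (fun n => cseq (alphaCoef q c ε N₀) (n - 1)) v x₁ x₀ xₘ := hT
  have hb : N₀ = 0 → betaCoef q c ε N₀ 0 = 0 := by rintro rfl; exact betaCoef_zero q c ε
  have hV := hT.isSpinOneVector h0 h1 hL hv hs hb
  have hX := hT.zeroPlusDefect_eq_zero h0 h1 hL hv hs (alphaCoef_neg_one q c ε N₀) hb
    (fun n => betaCoef_succ q c ε N₀) (fun n => alphaCoef_relation q c ε N₀)
    (fun n => alphaCoef_pred_sq q c ε N₀)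
  have hY := hT.minusPlusDefect_eq_zero h0 h1 hL hv hs hb hX
    (fun n => alphaCoef_relation q c ε N₀)
  have hF := hV.F_mul_zeroPlusDefect (t := ((2 * tauShift q c : ℝ) : ℂ)) hq
    ((tauShift q c ^ 2 - (1 + (q : ℝ) ^ 2) ^ 2 * discr c ^ 2 : ℝ) : ℂ)
  have hr : (qrt q 2 : ℂ) ≠ 0 := by exact_mod_cast (qrt_pos h0 h1 (by norm_num)).ne'
  -- With two defects gone, `F_mul_zeroPlusDefect` leaves the third one times `K`, and `K` has a
  -- right inverse.
  rw [hX, hY, mul_zero, zero_mul, smul_zero, sub_self, smul_zero, zero_sub, neg_mul, smul_neg,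
    eq_comm, neg_eq_zero, smul_eq_zero_iff_right hr] at hF
  have hY' : plusMinusDefect (((q : ℝ) : ℂ)) ((2 * tauShift q c : ℝ) : ℂ)
      ((tauShift q c ^ 2 - (1 + (q : ℝ) ^ 2) ^ 2 * discr c ^ 2 : ℝ) : ℂ) x₁ x₀ xₘ = 0 := by
    have := congrArg (· * Ki) hF
    simpa [mul_assoc, hKKi] using this
  have hzp : x₀ * x₁ = (((q : ℝ) ^ 2 : ℝ) : ℂ) • (x₁ * x₀)
      + ((2 * tauShift q c : ℝ) : ℂ) • x₁ := by
    rw [zeroPlusDefect, sub_sub, sub_eq_zero] at hX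
    rw [hX, Complex.ofReal_pow]
  have hadj := hT.isAdjointTriple h0 hv hs
  have a1 := hadj.isAdj_plus
  have a0 : IsAdj x₀ x₀ := hadj.zero
  obtain ⟨k1, k0, km, e1, e0, em, f1, f0, fm⟩ := hV
  simp only [← Complex.ofReal_inv] at km e1 f1
  refine ⟨k1, k0, km, e1, e0, em, f1, f0, fm, hzp, ?_, ?_, ?_⟩
  -- The relation of `x_{-1}` and `x_0` is the adjoint of the one of `x_0` and `x_1`.
  · have h := (a0.mul a1).unique (hzp ▸ ((a1.mul a0).smul _).add (a1.smul _))
    simp only [mul_smul_comm, smul_mul_assoc, Complex.ofReal_neg] at h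
    linear_combination (norm := (match_scalars <;> field_simp <;> ring)) (-((q : ℝ) : ℂ)⁻¹) • h
  · rw [plusMinusDefect, sub_eq_zero] at hY'
    rw [← hY']
    push_cast
    rfl
  · rw [minusPlusDefect, sub_eq_zero] at hY
    push_cast at hY ⊢
    exact hY

end Existence

/-! ### The relations of `U_q(su_2)` on the sum of spin representations -/

section Ladder

variable {N₀ : ℕ} {D : Type*} [NormedAddCommGroup D] [InnerProductSpace ℂ D]
  {v : SpinIndex N₀ → D}

theorem eCoef_smul_vec_eq_zero (q : ℝ) (v : SpinIndex N₀ → D) {n k : ℤ} (h : ¬ IsLabel N₀ n k) :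
    (eCoef q (N₀ + 2 * n) k : ℂ) • vec v n (k + 1) = 0 := by
  by_cases h' : IsLabel N₀ n (k + 1)
  · obtain ⟨h1, h2, h3⟩ := h'
    obtain rfl : k = -1 := by
      by_contra hk
      exact h ⟨by omega, by omega, by omega⟩
    simp [eCoef, qrt_zero]
  · rw [vec_eq_zero v h', smul_zero]

theorem fCoef_smul_vec_eq_zero (q : ℝ) (v : SpinIndex N₀ → D) {n k : ℤ} (h : ¬ IsLabel N₀ n k) :
    (fCoef q (N₀ + 2 * n) k : ℂ) • vec v n (k - 1) = 0 := by
  by_cases h' : IsLabel N₀ n (k - 1)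
  · obtain ⟨h1, h2, h3⟩ := h'
    obtain rfl : k = N₀ + 2 * n + 1 := by
      by_contra hk
      exact h ⟨by omega, by omega, by omega⟩
    simp [fCoef, qrt_zero]
  · rw [vec_eq_zero v h', smul_zero]

theorem isSpinSum_iff {q : QParam} {c : ℝ≥0∞} {π : StarRep q c D} :
    IsSpinSum N₀ π v ↔ Orthonormal ℂ v ∧ IsLadder q v (π.op .E) (π.op .F) (π.op .K) := by
  have e1 : ∀ n k : ℤ, spin N₀ n + weight N₀ n k = (k : ℤ) := by
    intro n k; simp only [weight]; ring
  have e2 : ∀ n k : ℤ, spin N₀ n - weight N₀ n k = ((N₀ + 2 * n - k : ℤ) : ℝ) := by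
    intro n k; simp only [weight, spin]; push_cast; ring
  have p1 : ∀ n k : ℤ, (q : ℝ) ^ (weight N₀ n k) = wt q (N₀ + 2 * n) k := by
    intro n k
    rw [rpow_add_weight q N₀ n k (m := 0) (by push_cast; ring), zpow_zero, mul_one]
  have s0 : ∀ m : ℤ, √(qnum q (m : ℝ)) = qrt q m := fun m => rfl
  have s1 : ∀ m : ℤ, √(qnum q ((m : ℝ) + 1)) = qrt q (m + 1) := fun m =>
    sqrt_qnum_eq_qrt q (by push_cast; ring)
  have vz : ∀ T : Module.End ℂ D, ∀ n k, ¬ IsLabel N₀ n k → T (vec v n k) = 0 := by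
    intro T n k h; rw [vec_eq_zero v h, map_zero]
  constructor
  · rintro ⟨ho, hK, hE, hF⟩
    refine ⟨ho, forall_vec (vz _) (fun n k => eCoef_smul_vec_eq_zero _ v) ?_,
      forall_vec (vz _) (fun n k => fCoef_smul_vec_eq_zero _ v) ?_,
      forall_vec (vz _) (fun n k h => by rw [vec_eq_zero v h, smul_zero]) ?_⟩ <;> intro n k
    · rw [hE]; simp only [e1, e2, s0, s1, eCoef]
    · rw [hF]; simp only [e1, e2, s0, s1, fCoef]
    · rw [hK, p1]
  · rintro ⟨ho, hE, hF, hK⟩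
    refine ⟨ho, ?_, ?_, ?_⟩ <;> intro n k
    · intro j; rw [hK, ← p1]
    · intro l j; rw [hE]; simp only [l, j, e1, e2, s0, s1, eCoef]
    · intro l j; rw [hF]; simp only [l, j, e1, e2, s0, s1, fCoef]

variable {q : ℝ} {E F K Ki : Module.End ℂ D}

theorem IsLadder.K_mul_E (h0 : 0 < q) (hL : IsLadder q v E F K) (hs : Spans v) :
    K * E = (q : ℂ) • (E * K) := hs.hom_ext fun n k _ => by
  simp only [Module.End.mul_apply, LinearMap.smul_apply, hL.E_vec, hL.K_vec, map_smul,
    wt_add_one h0]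
  push_cast
  module

theorem IsLadder.F_mul_K (h0 : 0 < q) (hL : IsLadder q v E F K) (hs : Spans v) :
    F * K = (q : ℂ) • (K * F) := hs.hom_ext fun n k _ => by
  have hq : (q : ℂ) ≠ 0 := by exact_mod_cast h0.ne'
  simp only [Module.End.mul_apply, LinearMap.smul_apply, hL.F_vec, hL.K_vec, map_smul,
    wt_sub_one h0]
  push_cast
  match_scalars
  field_simp

/-- Both sides are `[2j]`. -/
theorem fCoef_sq_sub_eCoef_sq (h0 : 0 < q) (h1 : q < 1) {N k : ℤ} (hk : 0 ≤ k) (hkN : k ≤ N) :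
    fCoef q N k ^ 2 - eCoef q N k ^ 2
      = (q - q⁻¹)⁻¹ * (wt q N k ^ 2 - (wt q N k ^ 2)⁻¹) := by
  have hq := h0.ne'
  have hN := zpow_ne_zero N hq
  have hk' := zpow_ne_zero k hq
  have hl : q ^ 2 - 1 ≠ 0 := by nlinarith
  rw [fCoef, eCoef, mul_pow, mul_pow, qrt_sq h0 h1 (by omega), qrt_sq h0 h1 (by omega),
    qrt_sq h0 h1 (by omega), qrt_sq h0 h1 (by omega), wt_sq h0]
  simp only [qint_eq, zpow_add₀ hq, zpow_sub₀ hq, zpow_one]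
  field_simp
  ring

theorem IsLadder.E_mul_F (h0 : 0 < q) (h1 : q < 1) (hL : IsLadder q v E F K) (hs : Spans v)
    (hKi : ∀ n k : ℤ, Ki (vec v n k) = ((wt q (N₀ + 2 * n) k)⁻¹ : ℂ) • vec v n k) :
    E * F - F * E = (((q - q⁻¹)⁻¹ : ℝ) : ℂ) • (K * K - Ki * Ki) := hs.hom_ext fun n k h => by
  have hc := congrArg Complex.ofReal (fCoef_sq_sub_eCoef_sq h0 h1 (N := N₀ + 2 * n) h.2.1 h.2.2)
  push_cast at hc
  simp only [Module.End.mul_apply, LinearMap.smul_apply, LinearMap.sub_apply, hL.F_vec, hL.E_vec,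
    hL.K_vec, hKi, map_smul, sub_add_cancel, add_sub_cancel_right, eCoef_sub_one, fCoef_add_one]
  push_cast
  match_scalars
  linear_combination hc

end Ladder

/-! ### Construction of the representations -/

section Representation

variable {N₀ : ℕ} {D : Type*} [NormedAddCommGroup D] [InnerProductSpace ℂ D]
  {v : SpinIndex N₀ → D}

/-- A linear operator is determined by arbitrary prescribed values on an orthonormal basis. -/
theorem exists_end_vec (hv : Orthonormal ℂ v) (hs : Spans v) (y : ℤ → ℤ → D)
    (hy : ∀ n k, ¬ IsLabel N₀ n k → y n k = 0) :
    ∃ T : Module.End ℂ D, ∀ n k, T (vec v n k) = y n k := by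
  let B := Module.Basis.mk hv.linearIndependent hs.ge
  refine ⟨B.constr ℂ fun i => y i.1 i.2, forall_vec
    (fun n k h => by rw [vec_eq_zero v h, map_zero]) hy fun n k => ?_⟩
  rw [vec_natCast, show v ⟨n, k⟩ = B ⟨n, k⟩ by simp [B], Module.Basis.constr_basis]

variable {q : QParam} {c : ℝ≥0∞}

/-- The representation with prescribed operators for the generators. -/
def repOfRel (g : Gen → Module.End ℂ D)
    (hg : ∀ ⦃x y⦄, Rel q c x y → FreeAlgebra.lift ℂ g x = FreeAlgebra.lift ℂ g y) :
    CrossAlg q c →ₐ[ℂ] Module.End ℂ D :=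
  RingQuot.liftAlgHom ℂ ⟨FreeAlgebra.lift ℂ g, hg⟩

theorem repOfRel_gen (g : Gen → Module.End ℂ D)
    (hg : ∀ ⦃x y⦄, Rel q c x y → FreeAlgebra.lift ℂ g x = FreeAlgebra.lift ℂ g y) (x : Gen) :
    repOfRel g hg (gen q c x) = g x := by
  refine (RingQuot.liftAlgHom_mkAlgHom_apply ℂ (FreeAlgebra.lift ℂ g) hg (fgen x)).trans ?_
  rw [fgen, FreeAlgebra.lift_ι_apply]

theorem crossAlg_induction {P : CrossAlg q c → Prop} (hg : ∀ g, P (gen q c g)) (h1 : P 1)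
    (hadd : ∀ x y, P x → P y → P (x + y)) (hmul : ∀ x y, P x → P y → P (x * y))
    (hsmul : ∀ (z : ℂ) x, P x → P (z • x)) (x : CrossAlg q c) : P x := by
  obtain ⟨x, rfl⟩ := RingQuot.mkAlgHom_surjective ℂ (Rel q c) x
  change P (mk q c x)
  induction x using FreeAlgebra.induction with
  | grade0 r =>
    rw [Algebra.algebraMap_eq_smul_one, map_smul, map_one]
    exact hsmul _ _ h1
  | grade1 x => exact hg x
  | mul x y hx hy => rw [map_mul]; exact hmul _ _ hx hy
  | add x y hx hy => rw [map_add]; exact hadd _ _ hx hy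

/-- The elements on which `f` respects the involution form a unital subalgebra, so the generators
suffice. -/
theorem isAdj_of_gen {f : CrossAlg q c →ₐ[ℂ] Module.End ℂ D}
    (h : ∀ g, IsAdj (f (gen q c g)) (f (gen q c (starGen g)))) (x : CrossAlg q c) :
    IsAdj (f x) (f (star x)) := by
  induction x using crossAlg_induction with
  | hg g => rw [star_gen]; exact h g
  | h1 => rw [star_one, map_one]; exact isAdj_one
  | hadd x y hx hy => rw [star_add, map_add, map_add]; exact hx.add hy
  | hmul x y hx hy => rw [star_mul, map_mul, map_mul]; exact hx.mul hy
  | hsmul z x hx =>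
    intro u w
    rw [star_smul, map_smul, map_smul, LinearMap.smul_apply, LinearMap.smul_apply,
      inner_smul_left, inner_smul_right, hx]
    rfl

/-- The explicit formulas define a `*`-representation. -/
theorem exists_hasFormulas (q : QParam) (c : ℝ≥0∞) (ε : ℤˣ) (hv : Orthonormal ℂ v)
    (hs : Spans v) : ∃ π : StarRep q c D, IsSpinSum N₀ π v ∧ HasFormulas N₀ ε π v := by
  have h0 : (0 : ℝ) < q := q.2.1
  have h1 : (q : ℝ) < 1 := q.2.2
  have hq : ((q : ℝ) : ℂ) ≠ 0 := by exact_mod_cast h0.ne'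
  have ha := alphaSeq_neg_one q c ε N₀
  obtain ⟨E, hE⟩ := exists_end_vec hv hs _ fun n k => eCoef_smul_vec_eq_zero q v
  obtain ⟨F, hF⟩ := exists_end_vec hv hs _ fun n k => fCoef_smul_vec_eq_zero q v
  obtain ⟨K, hK⟩ := exists_end_vec hv hs (fun n k => (wt q (N₀ + 2 * n) k : ℂ) • vec v n k)
    fun n k h => by rw [vec_eq_zero v h, smul_zero]
  obtain ⟨Ki, hKi⟩ := exists_end_vec hv hs
    (fun n k => ((wt q (N₀ + 2 * n) k)⁻¹ : ℂ) • vec v n k)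
    fun n k h => by rw [vec_eq_zero v h, smul_zero]
  obtain ⟨x₁, hx₁⟩ := exists_end_vec hv hs
    (plusVec q (alphaSeq q c ε N₀) (betaSeq q c ε N₀) (fun n => alphaSeq q c ε N₀ (n - 1)) v)
    fun n k => plusVec_eq_zero h0 h1 ha
  obtain ⟨x₀, hx₀⟩ := exists_end_vec hv hs
    (zeroVec q (alphaSeq q c ε N₀) (betaSeq q c ε N₀) (fun n => alphaSeq q c ε N₀ (n - 1)) v)
    fun n k => zeroVec_eq_zero h0 h1 ha
  obtain ⟨xₘ, hxₘ⟩ := exists_end_vec hv hs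
    (minusVec q (alphaSeq q c ε N₀) (betaSeq q c ε N₀) (fun n => alphaSeq q c ε N₀ (n - 1)) v)
    fun n k => minusVec_eq_zero h0 h1 ha
  have hT : HasSeqForm q (alphaSeq q c ε N₀) (betaSeq q c ε N₀)
    (fun n => alphaSeq q c ε N₀ (n - 1)) v x₁ x₀ xₘ := ⟨hx₁, hx₀, hxₘ⟩
  have hL : IsLadder q v E F K := ⟨hE, hF, hK⟩
  have hw : ∀ n k : ℤ, (wt q (N₀ + 2 * n) k : ℂ) ≠ 0 := fun n k => by
    exact_mod_cast (wt_pos h0 _ _).ne'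
  have hKKi : K * Ki = 1 := hs.hom_ext fun n k _ => by
    rw [Module.End.mul_apply, hKi, map_smul, hK, smul_smul, inv_mul_cancel₀ (hw n k), one_smul,
      Module.End.one_apply]
  have hKiK : Ki * K = 1 := hs.hom_ext fun n k _ => by
    rw [Module.End.mul_apply, hK, map_smul, hKi, smul_smul, mul_inv_cancel₀ (hw n k), one_smul,
      Module.End.one_apply]
  have hrel := fun x y => (hT.isSpinOneTriple hL hKKi hv hs).lift_rel (x := x) (y := y) hKKi hKiK
    (hL.K_mul_E h0 hs) (hL.F_mul_K h0 hs) (hL.E_mul_F h0 h1 hs hKi)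
  set f := repOfRel _ hrel with hf
  have hgen : ∀ g, f (gen q c g) = genOfTriple q c x₁ x₀ xₘ E F K Ki g := repOfRel_gen _ hrel
  have hT' : HasSeqForm q (cseq (alphaCoef q c ε N₀)) (cseq (betaCoef q c ε N₀))
    (fun n => cseq (alphaCoef q c ε N₀) (n - 1)) v x₁ x₀ xₘ := hT
  have hadj := hT'.isAdjointTriple h0 hv hs
  have hstar : ∀ g, IsAdj (f (gen q c g)) (f (gen q c (starGen g))) := by
    have hB : IsAdj (f (gen q c .Bs)) (f (gen q c .B)) := by
      rw [hgen, hgen, genOfTriple, genOfTriple]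
      have := hadj.isAdj_plus.smul (-(√(1 + (q : ℝ) ^ 2))⁻¹)
      rw [smul_smul, ← Complex.ofReal_mul, neg_mul_neg, mul_comm _ (q : ℝ)] at this
      exact this
    have hEF := hL.isAdj_E_F hv hs
    have hKK := hL.isAdj_K hv hs
    intro g
    cases g
    case A =>
      rw [starGen, hgen, genOfTriple, sub_eq_add_neg, ← neg_one_smul ℂ x₀,
        show (-1 : ℂ) = ((-1 : ℝ) : ℂ) by push_cast; rfl]
      exact ((isAdj_one.smul _).add (IsAdj.smul hadj.zero _)).smul _
    case B => exact hB.symm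
    case Bs => exact hB
    case E => rw [starGen, hgen, hgen]; exact hEF.symm
    case F => rw [starGen, hgen, hgen]; exact hEF
    case K => rw [starGen, hgen]; exact hKK
    case Ki =>
      rw [starGen, hgen]
      intro x y
      -- The inverse of the symmetric bijection `K` is symmetric: `x` and `y` are written as images
      -- under `K`.
      have hx : x = K (Ki x) := (LinearMap.congr_fun hKKi x).symm
      have hy : y = K (Ki y) := (LinearMap.congr_fun hKKi y).symm
      change ⟪Ki x, y⟫_ℂ = ⟪x, Ki y⟫_ℂ
      nth_rewrite 1 [hy]
      rw [← hKK, ← hx]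
  refine ⟨⟨f, isAdj_of_gen hstar⟩, isSpinSum_iff.2 ⟨hv, ?_⟩, hasFormulas_iff.2 ?_⟩
  · simp only [StarRep.op, hgen]
    exact hL
  · have hs2 : 0 < √(1 + (q : ℝ) ^ 2) := Real.sqrt_pos.2 (by positivity)
    have hs2' : ((√(1 + (q : ℝ) ^ 2) : ℝ) : ℂ) ≠ 0 := by exact_mod_cast hs2.ne'
    have hq2 : (1 + ((q : ℝ) : ℂ) ^ 2) ≠ 0 := by
      have : (1 + (q : ℝ) ^ 2 : ℝ) ≠ 0 := by positivity
      exact_mod_cast this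
    have i1 : f (xPlus q c) = x₁ := by
      rw [xPlus, map_smul, hgen, genOfTriple]
      push_cast
      match_scalars
      field_simp
    have i0 : f (xZero q c) = x₀ := by
      rw [xZero, map_sub, map_smul, map_smul, map_one, hgen, genOfTriple]
      push_cast
      match_scalars
      · field_simp; ring
      · field_simp
    have im : f (xMinus q c) = xₘ := by
      rw [xMinus, map_smul, hgen, genOfTriple]
      push_cast
      match_scalars
      field_simp
    simp only [i1, i0, im]
    exact hT

/-- A space with an orthonormal basis indexed by the labels of the vectors `v^l_j`. -/
theorem exists_orthonormal_spans (N₀ : ℕ) :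
    ∃ (D : Type) (_ : NormedAddCommGroup D) (_ : InnerProductSpace ℂ D) (v : SpinIndex N₀ → D),
      Orthonormal ℂ v ∧ Spans v := by
  -- The domain is the algebraic span of the standard basis in the square summable sequences.
  let b := HilbertBasis.ofRepr (LinearIsometryEquiv.refl ℂ (lp (fun _ : SpinIndex N₀ => ℂ) 2))
  let B := Module.Basis.span b.orthonormal.linearIndependent
  refine ⟨Submodule.span ℂ (Set.range b), inferInstance, inferInstance,
    fun i => ⟨b i, Submodule.subset_span (Set.mem_range_self i)⟩,
    orthonormal_span b.orthonormal, ?_⟩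
  have hB : (B : SpinIndex N₀ → _) = fun i =>
      ⟨b i, Submodule.subset_span (Set.mem_range_self i)⟩ :=
    funext fun i => Module.Basis.span_apply b.orthonormal.linearIndependent i
  rw [Spans, ← hB]
  exact B.span_eq

end Representation

/-! ### Wigner-Eckart form of a given representation and choice of phases -/

section ReducedElements

variable {N₀ : ℕ} {D : Type*} [NormedAddCommGroup D] [InnerProductSpace ℂ D]
  {q : ℝ} {v : SpinIndex N₀ → D} {E F K x₁ x₀ xₘ : Module.End ℂ D}

theorem midPlus_sub_one_ne_zero (h0 : 0 < q) (h1 : q < 1) {N : ℤ} (hN : 0 < N) :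
    midPlus q N (N - 1) ≠ 0 := by
  have p1 := (qrt_pos h0 h1 (m := N - (N - 1)) (by omega)).ne'
  have p2 := (qrt_pos h0 h1 (m := N - 1 + 1) (by omega)).ne'
  have p3 := (qrt_pos h0 h1 (m := 2) (by omega)).ne'
  have p4 := (qint_pos h0 h1 hN).ne'
  have p5 := (wt_pos h0 N (N - 1)).ne'
  rw [midPlus]
  have := h0.ne'
  positivity

theorem upZero_zero_ne_zero (h0 : 0 < q) (h1 : q < 1) {N : ℤ} (hN : 0 ≤ N) :
    upZero q N 0 ≠ 0 := by
  have p1 := (qrt_pos h0 h1 (m := N - 0 + 1) (by omega)).ne'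
  have p2 := (qrt_pos h0 h1 (m := 0 + 1) (by omega)).ne'
  have p3 := (qrt_pos h0 h1 (m := 2) (by omega)).ne'
  have p4 := (qrt_pos h0 h1 (m := N + 1) (by omega)).ne'
  have p5 := (qrt_pos h0 h1 (m := N + 2) (by omega)).ne'
  have p6 := (wt_pos h0 N 0).ne'
  rw [upZero]
  positivity

/-- The Wigner-Eckart theorem for `x_1`. -/
theorem exists_plusVec (h0 : 0 < q) (h1 : q < 1) (hL : IsLadder q v E F K)
    (hv : Orthonormal ℂ v) (hd : SpansDense v) (aF : IsAdj F E) (aK : IsAdj K K)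
    (hV : IsSpinOneVector (q : ℂ) (qrt q 2 : ℂ) x₁ x₀ xₘ E F K) :
    ∃ a b d : ℤ → ℂ, (∀ n < 0, a n = 0) ∧ (∀ n ≤ 0, d n = 0) ∧ (N₀ = 0 → b 0 = 0) ∧
      ∀ n k, x₁ (vec v n k) = plusVec q a b d v n k := by
  have hq : (q : ℂ) ≠ 0 := by exact_mod_cast h0.ne'
  have vneg : ∀ n k : ℤ, n < 0 → vec v n k = 0 := fun n k hn =>
    vec_eq_zero v fun h => by have := h.1; omega
  -- The reduced matrix elements are read off at the entries tested by `family_eq_zero` for `r = 1`,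
  -- where the coefficients are `upPlus N N = 1`, `midPlus N (N - 1)` and `downPlus N 0 = q`. The
  -- difference of `x_1` and `plusVec` then has vanishing reduced matrix elements.
  let a : ℤ → ℂ := fun n => ⟪vec v (n + 1) (N₀ + 2 * n + 2), x₁ (vec v n (N₀ + 2 * n))⟫_ℂ
  let b : ℤ → ℂ := fun n => -(midPlus q (N₀ + 2 * n) (N₀ + 2 * n - 1) : ℂ)⁻¹
    * ⟪vec v n (N₀ + 2 * n), x₁ (vec v n (N₀ + 2 * n - 1))⟫_ℂ
  let d : ℤ → ℂ := fun n => -(q : ℂ)⁻¹ * ⟪vec v (n - 1) 0, x₁ (vec v n 0)⟫_ℂ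
  have ha : ∀ n < 0, a n = 0 := fun n hn => by
    simp only [a, vneg n _ hn, map_zero, inner_zero_right]
  have hdz : ∀ n ≤ 0, d n = 0 := fun n hn => by
    simp only [d, vneg (n - 1) _ (by omega), inner_zero_left, mul_zero]
  have hb : N₀ = 0 → b 0 = 0 := fun h => by
    have : vec v 0 (N₀ + 2 * 0 - 1) = 0 :=
      vec_eq_zero v fun h' => by have := h'.2.1; omega
    simp only [b]
    rw [this, map_zero, inner_zero_right, mul_zero]
  refine ⟨a, b, d, ha, hdz, hb, fun n k => sub_eq_zero.1 ?_⟩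
  have key := family_eq_zero h0 h1 hd hL aF aK (r := 1) (μ := (q : ℂ)⁻¹) (inv_ne_zero hq)
    (y := fun n k => x₁ (vec v n k) - plusVec q a b d v n k) ?_ ?_ ?_ ?_ ?_
  · exact key n k
  · intro n k h
    rw [vec_eq_zero v h, map_zero, plusVec_eq_zero h0 h1 (ha _ (by norm_num)) h, sub_zero]
  · intro n k
    have h := LinearMap.congr_fun hV.K_plus (vec v n k)
    simp only [LinearMap.smul_apply, Module.End.mul_apply, hL.K_vec, map_smul, smul_smul] at h
    rw [map_sub, h, K_plusVec h0 hL, smul_sub, pow_one]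
    push_cast
    rfl
  · intro n k
    have h := LinearMap.congr_fun hV.E_plus (vec v n k)
    simp only [LinearMap.smul_apply, Module.End.mul_apply, hL.E_vec, map_smul, smul_smul] at h
    rw [map_sub, h, E_plusVec h0 hL, smul_sub]
    push_cast
    rfl
  · intro n e hn he her
    have : e = 0 ∨ e = 1 := by push_cast at her; omega
    rcases this with rfl | rfl
    · simp only [add_zero, mul_zero, Nat.cast_one]
      rcases (by omega : (0 : ℤ) = N₀ + 2 * n ∨ 0 < N₀ + 2 * n) with h | h
      · have hl : ¬ IsLabel N₀ n (N₀ + 2 * n - 1) := fun h => by have := h.2.1; omega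
        rw [vec_eq_zero v hl, plusVec_eq_zero h0 h1 (ha _ (by norm_num)) hl, map_zero, sub_zero,
          inner_zero_right]
      · have hm : (midPlus q (N₀ + 2 * n) (N₀ + 2 * n - 1) : ℂ) ≠ 0 := by
          exact_mod_cast midPlus_sub_one_ne_zero h0 h1 h
        have hl : IsLabel N₀ n (N₀ + 2 * n) := ⟨by omega, by omega, by omega⟩
        rw [plusVec]
        simp only [inner_sub_right, inner_smul_right, inner_vec hv hl, true_and]
        split_ifs <;> try omega
        simp only [b]
        field_simp
        ring
    · simp only [Nat.cast_one, mul_one, add_sub_cancel_right]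
      rw [plusVec_top h0 h1 _ _ _ _ hn, inner_sub_right, inner_smul_right,
        inner_vec hv (n := n + 1) (k := N₀ + 2 * n + 2) ⟨by omega, by omega, by omega⟩,
        if_pos ⟨rfl, rfl⟩]
      simp [a]
  · intro n e hn he her
    obtain rfl : e = -1 := by push_cast at her; omega
    simp only [Nat.cast_one, neg_add_cancel]
    rcases hn.eq_or_lt with rfl | hn
    · rw [vneg _ _ (by norm_num), inner_zero_left]
    · have hl : IsLabel N₀ (n - 1) 0 := ⟨by omega, by omega, by omega⟩
      rw [plusVec, downPlus_zero h0 h1 (by omega), ← sub_eq_add_neg]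
      simp only [inner_sub_right, inner_smul_right, inner_vec hv hl, and_true, if_true]
      split_ifs <;> try omega
      simp only [d]
      field_simp
      ring

/-- The operators `x_1, x_0, x_{-1}` of a representation are of Wigner-Eckart form. -/
theorem exists_hasSeqForm (h0 : 0 < q) (h1 : q < 1) (hL : IsLadder q v E F K)
    (hv : Orthonormal ℂ v) (hd : SpansDense v) (aF : IsAdj F E) (aK : IsAdj K K)
    (hV : IsSpinOneVector (q : ℂ) (qrt q 2 : ℂ) x₁ x₀ xₘ E F K) (a0 : IsAdj x₀ x₀) :
    ∃ a b : ℤ → ℂ, (∀ n < 0, a n = 0) ∧ (N₀ = 0 → b 0 = 0) ∧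
      (∀ n, 0 ≤ n → starRingEnd ℂ (b n) = b n) ∧
      HasSeqForm q a b (fun n => starRingEnd ℂ (a (n - 1))) v x₁ x₀ xₘ := by
  obtain ⟨a, b, d, ha, hdz, hb, hp⟩ := exists_plusVec h0 h1 hL hv hd aF aK hV
  have hr : (qrt q 2 : ℂ) ≠ 0 := by exact_mod_cast (qrt_pos h0 h1 (by norm_num)).ne'
  have hw : ∀ n k : ℤ, (wt q (N₀ + 2 * n) k : ℂ) ≠ 0 := fun n k => by
    exact_mod_cast (wt_pos h0 _ _).ne'
  have ha1 : a (-1) = 0 := ha _ (by norm_num)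
  -- The commutator of `F` with `x_1` is computed once from the form of `x_1` and once from the
  -- cross relation; the common factor `[2]^{1/2} q^j` is cancelled. The same argument with `x_0`
  -- gives `x_{-1}`.
  have hz : ∀ n k, x₀ (vec v n k) = zeroVec q a b d v n k := by
    intro n k
    by_cases h : IsLabel N₀ n k
    · have e1 := F_plusVec h0 h1 hL hp hb h
      have e2 := LinearMap.congr_fun hV.F_plus (vec v n k)
      simp only [LinearMap.smul_apply, LinearMap.add_apply, Module.End.mul_apply, hL.K_vec] at e2
      rw [e1, Complex.ofReal_inv, add_right_inj, map_smul, smul_smul, Complex.ofReal_mul] at e2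
      exact (smul_right_injective D (mul_ne_zero hr (hw n k)) e2).symm
    · rw [vec_eq_zero v h, map_zero, zeroVec_eq_zero h0 h1 ha1 h]
  have hm : ∀ n k, xₘ (vec v n k) = minusVec q a b d v n k := by
    intro n k
    by_cases h : IsLabel N₀ n k
    · have e1 := F_zeroVec h0 h1 hL hz h
      have e2 := LinearMap.congr_fun hV.F_zero (vec v n k)
      simp only [LinearMap.smul_apply, LinearMap.add_apply, Module.End.mul_apply, hL.K_vec] at e2
      rw [e1, add_right_inj, map_smul, smul_smul, Complex.ofReal_mul] at e2
      exact (smul_right_injective D (mul_ne_zero hr (hw n k)) e2).symm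
    · rw [vec_eq_zero v h, map_zero, minusVec_eq_zero h0 h1 ha1 h]
  -- Symmetry of `x_0` between the lowest weight vector of one multiplet and the vector of equal
  -- weight in the next; the two coefficients coincide and are nonzero.
  have hd' : d = fun n => starRingEnd ℂ (a (n - 1)) := by
    funext n
    rcases le_or_gt n 0 with hn | hn
    · rw [hdz n hn, ha _ (by omega), map_zero]
    · obtain ⟨m, rfl⟩ : ∃ m, n = m + 1 := ⟨n - 1, by ring⟩
      have hu : (upZero q (N₀ + 2 * m) 0 : ℂ) ≠ 0 := by
        exact_mod_cast upZero_zero_ne_zero h0 h1 (by omega)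
      have hdn : downZero q (N₀ + 2 * (m + 1)) 1 = upZero q (N₀ + 2 * m) 0 := by
        rw [upZero_eq, zero_add, show (N₀ : ℤ) + 2 * (m + 1) = N₀ + 2 * m + 2 by ring]
      have h := a0 (vec v m 0) (vec v (m + 1) 1)
      rw [hz, hz, zeroVec, zeroVec, hdn] at h
      simp only [inner_add_left, inner_add_right, inner_smul_left, inner_smul_right, map_mul,
        Complex.conj_ofReal,
        inner_vec hv (n := m) (k := 0) ⟨by omega, by omega, by omega⟩,
        inner_vec' hv (n' := m + 1) (k' := 1) ⟨by omega, by omega, by omega⟩] at h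
      rw [add_sub_cancel_right]
      have hu' : upZero q (N₀ + 2 * m) 0 ≠ 0 := by exact_mod_cast hu
      have h' : starRingEnd ℂ (a m) = d (m + 1) := by simpa [hu'] using h
      exact h'.symm
  -- `b n` is the diagonal entry of the symmetric operator `x_0` at the highest weight vector.
  have hbr : ∀ n, 0 ≤ n → starRingEnd ℂ (b n) = b n := by
    intro n hn
    have h := a0 (vec v n (N₀ + 2 * n)) (vec v n (N₀ + 2 * n))
    rw [hz, zeroVec_top] at h
    simp only [inner_add_left, inner_add_right, inner_smul_left, inner_smul_right, map_mul,
      inner_vec hv (n := n) (k := N₀ + 2 * n) ⟨by omega, by omega, by omega⟩,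
      inner_vec' hv (n' := n) (k' := N₀ + 2 * n) ⟨by omega, by omega, by omega⟩] at h
    simpa using h
  exact ⟨a, b, ha, hb, hbr, hd' ▸ ⟨hp, hz, hm⟩⟩

/-- Values at negative `n` do not matter, except that `a' (-1)` must vanish: its term would land in
the multiplet `n = 0`. -/
theorem HasSeqForm.congr (h0 : 0 < q) (h1 : q < 1) {a b d a' b' d' : ℤ → ℂ}
    (hT : HasSeqForm q a b d v x₁ x₀ xₘ) (ha : ∀ n, 0 ≤ n → a n = a' n) (ha' : a' (-1) = 0)
    (hb : ∀ n, 0 ≤ n → b n = b' n) (hd : ∀ n, 0 ≤ n → d n = d' n) :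
    HasSeqForm q a' b' d' v x₁ x₀ xₘ := by
  refine ⟨?_, ?_, ?_⟩ <;> intro n k <;> by_cases h : IsLabel N₀ n k
  · rw [hT.plus_vec, plusVec, plusVec, ha n h.1, hb n h.1, hd n h.1]
  · rw [vec_eq_zero v h, map_zero, plusVec_eq_zero h0 h1 ha' h]
  · rw [hT.zero_vec, zeroVec, zeroVec, ha n h.1, hb n h.1, hd n h.1]
  · rw [vec_eq_zero v h, map_zero, zeroVec_eq_zero h0 h1 ha' h]
  · rw [hT.minus_vec, minusVec, minusVec, ha n h.1, hb n h.1, hd n h.1]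
  · rw [vec_eq_zero v h, map_zero, minusVec_eq_zero h0 h1 ha' h]

theorem vec_smul (θ : ℕ → ℂ) (v : SpinIndex N₀ → D) (n k : ℤ) :
    vec (fun i => θ i.1 • v i) n k = θ n.toNat • vec v n k := by
  by_cases h : IsLabel N₀ n k
  · obtain ⟨m, p, rfl, rfl⟩ := h.exists_nat
    rw [vec_natCast, vec_natCast, Int.toNat_natCast]
  · rw [vec_eq_zero _ h, vec_eq_zero _ h, smul_zero]

theorem orthonormal_phase {θ : ℕ → ℂ} (hθ : ∀ n, ‖θ n‖ = 1) (hv : Orthonormal ℂ v) :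
    Orthonormal ℂ fun i => θ i.1 • v i := by
  refine ⟨fun i => by rw [norm_smul, hθ, hv.1, one_mul], fun i j h => ?_⟩
  change ⟪θ i.1 • v i, θ j.1 • v j⟫_ℂ = 0
  rw [inner_smul_left, inner_smul_right, hv.2 h, mul_zero, mul_zero]

/-- A change of phases changes the reduced matrix elements. -/
theorem HasSeqForm.phase {θ : ℕ → ℂ} {a b d a' d' : ℤ → ℂ}
    (hT : HasSeqForm q a b d v x₁ x₀ xₘ)
    (ha : ∀ n : ℤ, a n * θ n.toNat = a' n * θ (n + 1).toNat)
    (hd : ∀ n : ℤ, d n * θ n.toNat = d' n * θ (n - 1).toNat) :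
    HasSeqForm q a' b d' (fun i => θ i.1 • v i) x₁ x₀ xₘ := by
  refine ⟨?_, ?_, ?_⟩ <;> intro n k <;> have h1 := ha n <;> have h2 := hd n
  · rw [vec_smul, map_smul, hT.plus_vec, plusVec, plusVec, vec_smul, vec_smul, vec_smul]
    match_scalars
    · linear_combination (upPlus q (N₀ + 2 * n) k : ℂ) * h1
    · ring
    · linear_combination -(downPlus q (N₀ + 2 * n) k : ℂ) * h2
  · rw [vec_smul, map_smul, hT.zero_vec, zeroVec, zeroVec, vec_smul, vec_smul, vec_smul]
    match_scalars
    · linear_combination (upZero q (N₀ + 2 * n) k : ℂ) * h1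
    · ring
    · linear_combination (downZero q (N₀ + 2 * n) k : ℂ) * h2
  · rw [vec_smul, map_smul, hT.minus_vec, minusVec, minusVec, vec_smul, vec_smul, vec_smul]
    match_scalars
    · linear_combination (upMinus q (N₀ + 2 * n) k : ℂ) * h1
    · ring
    · linear_combination -(downMinus q (N₀ + 2 * n) k : ℂ) * h2

/-- The phase of a complex number, `1` at `0`. -/
def phase (z : ℂ) : ℂ := if z = 0 then 1 else z / ‖z‖

theorem norm_phase (z : ℂ) : ‖phase z‖ = 1 := by
  rw [phase]
  split_ifs with h
  · exact norm_one
  · rw [norm_div, Complex.norm_real, norm_norm, div_self (norm_ne_zero_iff.2 h)]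

theorem norm_mul_phase (z : ℂ) : (‖z‖ : ℂ) * phase z = z := by
  rw [phase]
  split_ifs with h
  · simp [h]
  · have : (‖z‖ : ℂ) ≠ 0 := by exact_mod_cast norm_ne_zero_iff.2 h
    field_simp

/-- The accumulated phases of a sequence. -/
def phaseSeq (a : ℤ → ℂ) : ℕ → ℂ
  | 0 => 1
  | n + 1 => phase (a n) * phaseSeq a n

theorem norm_phaseSeq (a : ℤ → ℂ) (n : ℕ) : ‖phaseSeq a n‖ = 1 := by
  induction n with
  | zero => exact norm_one
  | succ n ih => rw [phaseSeq, norm_mul, norm_phase, ih, one_mul]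

/-- After a change of phases the reduced matrix elements are real. -/
theorem HasSeqForm.exists_phase (h0 : 0 < q) (h1 : q < 1) {a b : ℤ → ℂ}
    (ha : ∀ n < 0, a n = 0)
    (hbr : ∀ n, 0 ≤ n → starRingEnd ℂ (b n) = b n)
    (hT : HasSeqForm q a b (fun n => starRingEnd ℂ (a (n - 1))) v x₁ x₀ xₘ) :
    HasSeqForm q (cseq fun n => ‖a n‖) (cseq fun n => (b n).re)
      (fun n => cseq (fun n => ‖a n‖) (n - 1)) (fun i => phaseSeq a i.1 • v i) x₁ x₀ xₘ := by
  -- `phaseSeq` moves the phase of `a n` into the phase of the next multiplet.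
  have key : ∀ n : ℤ, a n * phaseSeq a n.toNat = ‖a n‖ * phaseSeq a (n + 1).toNat := by
    intro n
    rcases lt_or_ge n 0 with hn | hn
    · rw [ha n hn]; simp
    · obtain ⟨m, rfl⟩ := Int.eq_ofNat_of_zero_le hn
      rw [show ((m : ℤ) + 1).toNat = m + 1 by omega, Int.toNat_natCast, phaseSeq, ← mul_assoc,
        norm_mul_phase]
  have hc : ∀ n, phaseSeq a n * starRingEnd ℂ (phaseSeq a n) = 1 := fun n => by
    rw [Complex.mul_conj, Complex.normSq_eq_norm_sq, norm_phaseSeq]; simp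
  refine (hT.phase (a' := cseq fun n => ‖a n‖) (d' := fun n => cseq (fun n => ‖a n‖) (n - 1))
    key fun n => ?_).congr h0 h1 (fun n _ => rfl) ?_ (fun n hn => ?_) (fun n _ => rfl)
  -- The condition for the downward element is the conjugate of `key` at `n - 1`, freed from
  -- conjugates by `|θ| = 1`.
  · have h := congrArg (starRingEnd ℂ) (key (n - 1))
    rw [map_mul, map_mul, Complex.conj_ofReal, sub_add_cancel] at h
    simp only [cseq]
    linear_combination (phaseSeq a n.toNat * phaseSeq a (n - 1).toNat) * h
      - (phaseSeq a n.toNat * starRingEnd ℂ (a (n - 1))) * hc (n - 1).toNat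
      + (phaseSeq a (n - 1).toNat * (‖a (n - 1)‖ : ℂ)) * hc n.toNat
  · rw [cseq, ha _ (by norm_num), norm_zero, Complex.ofReal_zero]
  · exact (Complex.conj_eq_iff_re.1 (hbr n hn)).symm

end ReducedElements

/-! ### The relations fix the reduced matrix elements up to a sign -/

section Uniqueness

variable {N₀ : ℕ} {D : Type*} [NormedAddCommGroup D] [InnerProductSpace ℂ D]
  {q : QParam} {c : ℝ≥0∞} {v : SpinIndex N₀ → D}

theorem IsSpinOneTriple.isSpinOneVector {R : Type*} [Ring R] [Algebra ℂ R]
    {x₁ x₀ xₘ E F K : R} (h : IsSpinOneTriple q c x₁ x₀ xₘ E F K) :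
    IsSpinOneVector ((q : ℝ) : ℂ) (qrt q 2 : ℂ) x₁ x₀ xₘ E F K := by
  obtain ⟨k1, k0, km, e1, e0, em, f1, f0, fm, -, -, -, -⟩ := h
  simp only [Complex.ofReal_inv] at km e1 f1
  exact ⟨k1, k0, km, e1, e0, em, f1, f0, fm⟩

theorem IsSpinOneTriple.map {R S : Type*} [Ring R] [Algebra ℂ R] [Ring S] [Algebra ℂ S]
    {x₁ x₀ xₘ E F K : R} (h : IsSpinOneTriple q c x₁ x₀ xₘ E F K) (f : R →ₐ[ℂ] S) :
    IsSpinOneTriple q c (f x₁) (f x₀) (f xₘ) (f E) (f F) (f K) := by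
  obtain ⟨k1, k0, km, e1, e0, em, f1, f0, fm, zp, mz, pm, mp⟩ := h
  constructor
  all_goals simp only [← map_mul, ← map_smul, ← map_add, ← map_sub, ← map_one f]
  all_goals refine congrArg f ?_
  all_goals assumption

/-- The operators of a representation form a spin one triple. -/
theorem StarRep.isSpinOneTriple (π : StarRep q c D) :
    IsSpinOneTriple q c (π.toHom (xPlus q c)) (π.toHom (xZero q c)) (π.toHom (xMinus q c))
      (π.op .E) (π.op .F) (π.op .K) :=
  (isSpinOneTriple_gen q c).map π.toHom

theorem StarRep.isAdj_op (π : StarRep q c D) (g : Gen) : IsAdj (π.op g) (π.op (starGen g)) := by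
  intro x y
  rw [StarRep.op, π.inner_star, star_gen]
  rfl

theorem StarRep.isAdjointTriple (π : StarRep q c D) :
    IsAdjointTriple q (π.toHom (xPlus q c)) (π.toHom (xZero q c)) (π.toHom (xMinus q c)) := by
  refine ⟨fun x y => ?_, fun x y => ?_⟩
  · rw [π.inner_star, star_xPlus, map_smul, LinearMap.smul_apply, inner_smul_right]
  · rw [π.inner_star, star_xZero]

/-- The relations determine the reduced matrix elements up to a sign. -/
theorem exists_sign {x₁ x₀ xₘ E F K : Module.End ℂ D} (hv : Orthonormal ℂ v)
    (hadj : IsAdjointTriple q x₁ x₀ xₘ) (hR : IsSpinOneTriple q c x₁ x₀ xₘ E F K)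
    {a b : ℤ → ℝ} (ha1 : a (-1) = 0) (ha : ∀ n, 0 ≤ a n) (hb : N₀ = 0 → b 0 = 0)
    (hT : HasSeqForm q (cseq a) (cseq b) (fun n => cseq a (n - 1)) v x₁ x₀ xₘ) :
    ∃ ε : ℤˣ, ∀ n : ℕ, a n = alphaCoef q c ε N₀ n ∧ b n = betaCoef q c ε N₀ n := by
  have h0 : (0 : ℝ) < q := q.2.1
  have h1 : (q : ℝ) < 1 := q.2.2
  have hq := h0.ne'
  -- The matrix element carries the factor `a n`, so the recursion is available only where `a n ≠
  -- 0`.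
  have hrec : ∀ n : ℤ, 0 ≤ n → a n ≠ 0 → (q : ℝ) ^ 2 * qint q (N₀ + 2 * n + 4) * b (n + 1)
      = qint q (N₀ + 2 * n + 2) * ((q : ℝ) ^ 2 * b n + 2 * tauShift q c) := by
    intro n hn han
    have h := inner_zero_plus_top h0 h1 hv hT hn (tauShift q c)
    have hx := LinearMap.congr_fun hR.zero_plus (vec v n (N₀ + 2 * n))
    simp only [LinearMap.add_apply, LinearMap.smul_apply, Module.End.mul_apply] at hx
    rw [hx, add_sub_cancel_left, sub_self, inner_zero_right, eq_comm, Complex.ofReal_eq_zero] at h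
    have p := (qint_pos h0 h1 (m := N₀ + 2 * n + 2) (by omega)).ne'
    exact sub_eq_zero.1 ((mul_eq_zero.1 h).resolve_left (mul_ne_zero han (inv_ne_zero p)))
  have hH : ∀ n : ℤ, 0 ≤ n → ((q : ℝ) ^ 2 * b n + tauShift q c) ^ 2
      + (q : ℝ) ^ 2 * qint q 2 * qint q (N₀ + 2 * n + 3) * (qint q (N₀ + 2 * n + 2))⁻¹ * a n ^ 2
      = (q : ℝ) ^ 2 * qint q 2 ^ 2 * discr c ^ 2 := by
    intro n hn
    have h := inner_minus_plus h0 h1 hv hT hadj hn (tauShift q c) (discr c)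
    have hx := LinearMap.congr_fun hR.minus_plus (vec v n (N₀ + 2 * n))
    simp only [LinearMap.add_apply, LinearMap.smul_apply, Module.End.mul_apply,
      Module.End.one_apply] at hx
    rw [hx, sub_self, inner_zero_right, eq_comm, Complex.ofReal_eq_zero, sub_eq_zero] at h
    exact h.symm
  -- At `n = 0` the relation for `x_1 x_{-1}` has no contribution from below, which leaves an
  -- equation between two squares. For `N₀ = 0` the value is `0` for either sign.
  have hsign : ∃ ε : ℤˣ, b 0 = betaCoef q c ε N₀ 0 := by
    rcases Nat.eq_zero_or_pos N₀ with hN | hN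
    · exact ⟨1, by subst hN; rw [hb rfl, betaCoef_zero]⟩
    have h := inner_plus_minus h0 h1 hv hT hadj ha1 le_rfl (by omega) (tauShift q c) (discr c)
    have hx := LinearMap.congr_fun hR.plus_minus (vec v 0 (N₀ + 2 * 0))
    simp only [LinearMap.add_apply, LinearMap.sub_apply, LinearMap.smul_apply,
      Module.End.mul_apply, Module.End.one_apply] at hx
    rw [hx, sub_self, inner_zero_right, eq_comm, Complex.ofReal_eq_zero, sub_eq_zero] at h
    have h2 := (quadratic_iff h0 h1 (by omega) (hH 0 le_rfl)).1 h.symm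
    rw [zero_sub, ha1] at h2
    have p2 := (qint_pos h0 h1 (m := 2) (by omega)).ne'
    have p3 := (qint_pos h0 h1 (m := N₀ + 2 * 0 + 2) (by omega)).ne'
    have h3 : (qint q (N₀ + 2 * 0 + 2) * ((q : ℝ) ^ 2 * b 0) - tauShift q c * qint q (N₀ + 2 * 0)) ^ 2
        = ((q : ℝ) * qint q 2 * (qint q N₀ * discr c)) ^ 2 := by
      apply mul_left_cancel₀ p2
      rw [mul_zero (2 : ℤ), add_zero] at h2 ⊢
      linear_combination h2
    -- The expression in `b 0` is `q [2] γ(-1)` when `b 0` is the explicit value, and `γ(-1) = [N₀]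
    -- ε ρ`; the factors of `b 0` are nonzero.
    have fin : ∀ ε : ℤˣ, qint q (N₀ + 2 * 0 + 2) * ((q : ℝ) ^ 2 * b 0)
        - tauShift q c * qint q (N₀ + 2 * 0)
        = (q : ℝ) * qint q 2 * (qint q N₀ * sgnDiscr c ε) → b 0 = betaCoef q c ε N₀ 0 := by
      intro ε h
      have e := gammaCoef_sub_one_eq q c ε N₀ le_rfl
      have hγ : gammaCoef q c ε N₀ (0 - 1) = qint q N₀ * sgnDiscr c ε := by
        simp [gammaCoef, qint_zero]
      rw [hγ, ← h] at e
      have e' := sub_left_inj.1 e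
      exact mul_left_cancel₀ (pow_ne_zero 2 hq) (mul_left_cancel₀ p3 e')
    rcases sq_eq_sq_iff_eq_or_eq_neg.1 h3 with h | h
    · exact ⟨1, fin 1 (by rw [h]; simp [sgnDiscr])⟩
    · exact ⟨-1, fin (-1) (by rw [h]; simp [sgnDiscr])⟩
  obtain ⟨ε, hε⟩ := hsign
  -- `hH` determines `a n ^ 2` from `b n`, and both candidates for `a n` are nonnegative.
  have hstep : ∀ n : ℤ, 0 ≤ n → b n = betaCoef q c ε N₀ n → a n = alphaCoef q c ε N₀ n := by
    intro n hn hbn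
    have h := hH n hn
    rw [hbn, ← alphaCoef_relation q c ε N₀ hn, add_right_inj] at h
    have p1 := (qint_pos h0 h1 (m := 2) (by omega)).ne'
    have p2 := (qint_pos h0 h1 (m := N₀ + 2 * n + 2) (by omega)).ne'
    have p3 := (qint_pos h0 h1 (m := N₀ + 2 * n + 3) (by omega)).ne'
    have h' := mul_left_cancel₀ (by positivity) h
    exact (pow_left_inj₀ (ha n) (alphaCoef_pos q c ε N₀ hn).le two_ne_zero).1 h'
  refine ⟨ε, fun n => ?_⟩
  suffices b n = betaCoef q c ε N₀ n from ⟨hstep n (by omega) this, this⟩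
  induction n with
  | zero => exact hε
  -- Positivity of `α⁺` keeps the recursion for `b` alive at every step.
  | succ n ih =>
    have han := hstep n (by omega) ih
    have h := hrec n (by omega) (by rw [han]; exact (alphaCoef_pos q c ε N₀ (by omega)).ne')
    rw [ih, ← betaCoef_succ q c ε N₀ (by omega)] at h
    have p4 := (qint_pos h0 h1 (m := N₀ + 2 * n + 4) (by omega)).ne'
    push_cast
    exact mul_left_cancel₀ (by positivity) h

/-- The explicit formulas hold after a change of phases. -/
theorem exists_phase_hasFormulas (π : StarRep q c D) (hπ : IsSpinSum N₀ π v)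
    (hd : SpansDense v) : ∃ (ε : ℤˣ) (θ : ℕ → ℂ), (∀ n, ‖θ n‖ = 1) ∧
      HasFormulas N₀ ε π (fun i => θ i.1 • v i) := by
  have h0 : (0 : ℝ) < q := q.2.1
  have h1 : (q : ℝ) < 1 := q.2.2
  obtain ⟨hv, hL⟩ := isSpinSum_iff.1 hπ
  have hR := π.isSpinOneTriple
  have hadj := π.isAdjointTriple
  obtain ⟨a, b, ha, hb, hbr, hT⟩ := exists_hasSeqForm h0 h1 hL hv hd (π.isAdj_op .F)
    (π.isAdj_op .K) hR.isSpinOneVector hadj.zero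
  have hT' := hT.exists_phase h0 h1 ha hbr
  obtain ⟨ε, hε⟩ := exists_sign (orthonormal_phase (norm_phaseSeq a) hv) hadj hR
    (by rw [ha _ (by norm_num), norm_zero]) (fun n => norm_nonneg _)
    (fun h => by rw [hb h, Complex.zero_re]) hT'
  have hε' : ∀ n : ℤ, 0 ≤ n → ‖a n‖ = alphaCoef q c ε N₀ n ∧ (b n).re = betaCoef q c ε N₀ n := by
    intro n hn
    obtain ⟨m, rfl⟩ := Int.eq_ofNat_of_zero_le hn
    exact hε m
  refine ⟨ε, phaseSeq a, norm_phaseSeq a, hasFormulas_iff.2 (hT'.congr h0 h1 (fun n hn => ?_)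
    (alphaSeq_neg_one q c ε N₀) (fun n hn => ?_) fun n hn => ?_)⟩
  · rw [cseq, (hε' n hn).1, alphaSeq]
  · rw [cseq, (hε' n hn).2, betaSeq]
  · rcases hn.eq_or_lt with rfl | hn
    · rw [zero_sub, alphaSeq_neg_one, cseq, ha _ (by norm_num), norm_zero, Complex.ofReal_zero]
    · rw [cseq, (hε' (n - 1) (by omega)).1, alphaSeq]

end Uniqueness

/-! ### Equal formulas give equivalent representations -/

section Intertwiner

variable {N₀ : ℕ} {q : QParam} {c : ℝ≥0∞} {ε : ℤˣ}
  {D : Type*} [NormedAddCommGroup D] [InnerProductSpace ℂ D] {v : SpinIndex N₀ → D}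
  {D' : Type*} [NormedAddCommGroup D'] [InnerProductSpace ℂ D'] {v' : SpinIndex N₀ → D'}
  {π : StarRep q c D} {π' : StarRep q c D'}

/-- The generators in terms of `x_1, x_0, x_{-1}`. -/
theorem genOfTriple_gen (q : QParam) (c : ℝ≥0∞) (g : Gen) :
    genOfTriple q c (xPlus q c) (xZero q c) (xMinus q c) (gen q c .E) (gen q c .F) (gen q c .K)
      (gen q c .Ki) g = gen q c g := by
  have h0 : (0 : ℝ) < q := q.2.1
  have hq : ((q : ℝ) : ℂ) ≠ 0 := by exact_mod_cast h0.ne'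
  have hs2 : 0 < √(1 + (q : ℝ) ^ 2) := Real.sqrt_pos.2 (by positivity)
  have hs2' : ((√(1 + (q : ℝ) ^ 2) : ℝ) : ℂ) ≠ 0 := by exact_mod_cast hs2.ne'
  have hq2 : (1 + ((q : ℝ) : ℂ) ^ 2) ≠ 0 := by
    have : (1 + (q : ℝ) ^ 2 : ℝ) ≠ 0 := by positivity
    exact_mod_cast this
  cases g <;> simp only [genOfTriple, xPlus, xZero, xMinus]
  · push_cast
    match_scalars
    · field_simp; ring
    · field_simp
  · push_cast
    match_scalars
    field_simp
  · push_cast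
    match_scalars
    field_simp

/-- An induction principle for the cross product algebra. -/
theorem crossAlg_induction_spinOne {P : CrossAlg q c → Prop} (hE : P (gen q c .E))
    (hF : P (gen q c .F)) (hK : P (gen q c .K)) (hKi : P (gen q c .Ki)) (hp : P (xPlus q c))
    (hz : P (xZero q c)) (hm : P (xMinus q c)) (h1 : P 1)
    (hadd : ∀ x y, P x → P y → P (x + y)) (hmul : ∀ x y, P x → P y → P (x * y))
    (hsmul : ∀ (z : ℂ) x, P x → P (z • x)) (x : CrossAlg q c) : P x := by
  refine crossAlg_induction (fun g => ?_) h1 hadd hmul hsmul x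
  rw [← genOfTriple_gen]
  cases g
  case A =>
    rw [genOfTriple, sub_eq_add_neg, ← neg_one_smul ℂ (xZero q c)]
    exact hsmul _ _ (hadd _ _ (hsmul _ _ h1) (hsmul _ _ hz))
  case B => exact hsmul _ _ hm
  case Bs => exact hsmul _ _ hp
  all_goals assumption

theorem StarRep.op_K_Ki (π : StarRep q c D) (x : D) : π.op .K (π.op .Ki x) = x := by
  rw [StarRep.op, StarRep.op, ← Module.End.mul_apply, ← map_mul, K_Ki, map_one,
    Module.End.one_apply]

theorem StarRep.op_Ki_K (π : StarRep q c D) (x : D) : π.op .Ki (π.op .K x) = x := by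
  rw [StarRep.op, StarRep.op, ← Module.End.mul_apply, ← map_mul, Ki_K, map_one,
    Module.End.one_apply]

/-- A linear map that identifies the vectors `v^l_j` intertwines the representations. -/
theorem intertwines (hπ : IsSpinSum N₀ π v) (hf : HasFormulas N₀ ε π v) (hs : Spans v)
    (hπ' : IsSpinSum N₀ π' v') (hf' : HasFormulas N₀ ε π' v') (T : D →ₗ[ℂ] D')
    (hT : ∀ i, T (v i) = v' i) (a : CrossAlg q c) (x : D) :
    T (π.toHom a x) = π'.toHom a (T x) := by
  obtain ⟨-, hE, hF, hK⟩ := isSpinSum_iff.1 hπ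
  obtain ⟨-, hE', hF', hK'⟩ := isSpinSum_iff.1 hπ'
  obtain ⟨hp, hz, hm⟩ := hasFormulas_iff.1 hf
  obtain ⟨hp', hz', hm'⟩ := hasFormulas_iff.1 hf'
  have hTv : ∀ n k : ℤ, T (vec v n k) = vec v' n k := by
    intro n k
    by_cases h : IsLabel N₀ n k
    · obtain ⟨m, p, rfl, rfl⟩ := h.exists_nat
      rw [vec_natCast, vec_natCast, hT]
    · rw [vec_eq_zero v h, vec_eq_zero v' h, map_zero]
  have key : ∀ (S : Module.End ℂ D) (S' : Module.End ℂ D'),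
      (∀ n k : ℤ, T (S (vec v n k)) = S' (vec v' n k)) → ∀ x, T (S x) = S' (T x) := by
    intro S S' h x
    refine LinearMap.congr_fun (hs.hom_ext (S := T ∘ₗ S) (T := S' ∘ₗ T) fun n k _ => ?_) x
    rw [LinearMap.comp_apply, LinearMap.comp_apply, h, hTv]
  have hKT : ∀ x, T (π.op .K x) = π'.op .K (T x) :=
    key _ _ fun n k => by rw [hK, hK', map_smul, hTv]
  induction a using crossAlg_induction_spinOne generalizing x with
  | hE => exact key _ _ (fun n k => (by rw [hE, hE', map_smul, hTv] :
      T (π.op .E (vec v n k)) = π'.op .E (vec v' n k))) x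
  | hF => exact key _ _ (fun n k => (by rw [hF, hF', map_smul, hTv] :
      T (π.op .F (vec v n k)) = π'.op .F (vec v' n k))) x
  | hK => exact hKT x
  | hKi =>
    change T (π.op .Ki x) = π'.op .Ki (T x)
    nth_rewrite 2 [← π.op_K_Ki x]
    rw [hKT, π'.op_Ki_K]
  | hp => exact key _ _ (fun n k => by
      rw [hp, hp', plusVec, plusVec, map_sub, map_sub, map_smul, map_smul, map_smul, hTv, hTv,
        hTv]) x
  | hz => exact key _ _ (fun n k => by
      rw [hz, hz', zeroVec, zeroVec, map_add, map_add, map_smul, map_smul, map_smul, hTv, hTv,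
        hTv]) x
  | hm => exact key _ _ (fun n k => by
      rw [hm, hm', minusVec, minusVec, map_sub, map_add, map_smul, map_smul, map_smul, hTv, hTv,
        hTv]) x
  | h1 => simp
  | hadd a b ha hb =>
    rw [map_add, map_add, LinearMap.add_apply, LinearMap.add_apply, map_add, ha, hb]
  | hmul a b ha hb => rw [map_mul, map_mul, Module.End.mul_apply, Module.End.mul_apply, ha, hb]
  | hsmul z a ha =>
    rw [map_smul, map_smul, LinearMap.smul_apply, LinearMap.smul_apply, map_smul, ha]

/-- Representations with the same explicit formulas are unitarily equivalent. -/
theorem unitarilyEquiv_of_hasFormulas (hπ : IsSpinSum N₀ π v) (hf : HasFormulas N₀ ε π v)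
    (hs : Spans v) (hπ' : IsSpinSum N₀ π' v') (hf' : HasFormulas N₀ ε π' v') (hs' : Spans v') :
    π.UnitarilyEquiv π' := by
  let B := Module.Basis.mk hπ.orthonormal.linearIndependent hs.ge
  let B' := Module.Basis.mk hπ'.orthonormal.linearIndependent hs'.ge
  have hB : ⇑B = v := Module.Basis.coe_mk _ _
  have hB' : ⇑B' = v' := Module.Basis.coe_mk _ _
  let e := B.equiv B' (Equiv.refl _)
  have he : ∀ i, e (v i) = v' i := fun i => by
    rw [← hB, ← hB', Module.Basis.equiv_apply, Equiv.refl_apply]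
  have ho : Orthonormal ℂ B := by rw [hB]; exact hπ.orthonormal
  have ho' : Orthonormal ℂ (e ∘ B) := by
    rw [hB, show e ∘ v = v' from funext he]; exact hπ'.orthonormal
  exact ⟨e.isometryOfOrthonormal ho ho',
    fun a x => intertwines hπ hf hs hπ' hf' e.toLinearMap he a x⟩

/-- For `l₀ = 0` the two signs give the same formulas. -/
theorem HasFormulas.of_zero {v : SpinIndex 0 → D} (hf : HasFormulas 0 ε π v) (ε' : ℤˣ) :
    HasFormulas 0 ε' π v := by
  have ha : alphaSeq q c ε 0 = alphaSeq q c ε' 0 := by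
    funext n
    simp only [alphaSeq, alphaCoef_eq, gammaCoef, Nat.cast_zero, qint_zero, zero_mul]
  have hb : betaSeq q c ε 0 = betaSeq q c ε' 0 := by
    funext n
    simp only [betaSeq, betaCoef_eq, Nat.cast_zero, qint_zero, zero_mul]
  rw [hasFormulas_iff, ← ha, ← hb]
  exact hasFormulas_iff.1 hf

end Intertwiner

/-! ### Simultaneous eigenvectors and invariant subspaces -/

section Separation

variable {N₀ : ℕ} {q : ℝ}

/-- The weight and the eigenvalue of `FE` separate the vectors `v^l_j`. -/
theorem wt_ne_or_eCoef_sq_ne (h0 : 0 < q) (h1 : q < 1) {n k n' k' : ℤ} (h : IsLabel N₀ n k)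
    (h' : IsLabel N₀ n' k') (hne : ¬ (n = n' ∧ k = k')) :
    wt q (N₀ + 2 * n) k ≠ wt q (N₀ + 2 * n') k' ∨
      eCoef q (N₀ + 2 * n) k ^ 2 ≠ eCoef q (N₀ + 2 * n') k' ^ 2 := by
  have hmono := qint_strictMono h0 h1
  -- At equal weight `k - n` is constant, so both factors of `[N - k][k + 1]` increase strictly with
  -- `n`.
  have sep : ∀ {n k n' k' : ℤ}, IsLabel N₀ n k → IsLabel N₀ n' k' → k - n = k' - n' → n < n' →
      eCoef q (N₀ + 2 * n) k ^ 2 < eCoef q (N₀ + 2 * n') k' ^ 2 := by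
    rintro n k n' k' ⟨_, _, _⟩ ⟨_, _, _⟩ he hlt
    rw [eCoef, eCoef, mul_pow, mul_pow, qrt_sq h0 h1 (by omega), qrt_sq h0 h1 (by omega),
      qrt_sq h0 h1 (by omega), qrt_sq h0 h1 (by omega)]
    exact mul_lt_mul'' (hmono (by omega)) (hmono (by omega)) (qint_nonneg h0 h1 (by omega))
      (qint_nonneg h0 h1 (by omega))
  by_cases hw : wt q (N₀ + 2 * n) k = wt q (N₀ + 2 * n') k'
  · have he : k - n = k' - n' := by
      have := le_antisymm ((Real.rpow_le_rpow_left_iff_of_base_lt_one h0 h1).1 hw.ge)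
        ((Real.rpow_le_rpow_left_iff_of_base_lt_one h0 h1).1 hw.le)
      push_cast at this
      have h2 : ((k - n : ℤ) : ℝ) = ((k' - n' : ℤ) : ℝ) := by push_cast; linarith
      exact_mod_cast h2
    right
    rcases lt_trichotomy n n' with hlt | rfl | hlt
    · exact (sep h h' he hlt).ne
    · exact absurd ⟨rfl, by omega⟩ hne
    · exact (sep h' h he.symm hlt).ne'
  · exact Or.inl hw

/-- An invariant subspace of a separating family of diagonal operators contains a basis vector. -/
theorem exists_basis_mem {ι V : Type*} [AddCommGroup V] [Module ℂ V] (B : Module.Basis ι ℂ V)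
    {W : Submodule ℂ V} (hW : W ≠ ⊥)
    (hsep : ∀ i j, i ≠ j → ∃ (T : Module.End ℂ V) (μ : ι → ℂ), (∀ x ∈ W, T x ∈ W) ∧
      (∀ k, T (B k) = μ k • B k) ∧ μ i ≠ μ j) : ∃ i, B i ∈ W := by
  classical
  -- Induction on the number of basis vectors in `x`: if two occur, `T - μ i` annihilates one of
  -- them, keeps the other and introduces no new ones.
  have key : ∀ (m : ℕ) (x : V), x ∈ W → x ≠ 0 → (B.repr x).support.card = m → ∃ i, B i ∈ W := by
    intro m
    induction m using Nat.strong_induction_on with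
    | _ m ih =>
      intro x hx hx0 hm
      have hr : B.repr x ≠ 0 := fun h => hx0 (B.repr.map_eq_zero_iff.1 h)
      obtain ⟨i, hi⟩ := Finsupp.support_nonempty_iff.2 hr
      by_cases hone : ∀ j ∈ (B.repr x).support, j = i
      · refine ⟨i, ?_⟩
        have hxi : x = B.repr x i • B i := by
          apply B.repr.injective
          ext j
          rw [map_smul, B.repr_self, Finsupp.smul_apply, smul_eq_mul, Finsupp.single_apply]
          split_ifs with hij
          · rw [hij, mul_one]
          · rw [mul_zero]
            by_contra hj
            exact hij (hone j (Finsupp.mem_support_iff.2 hj)).symm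
        have hxi' := Finsupp.mem_support_iff.1 hi
        rw [hxi] at hx
        exact (W.smul_mem_iff hxi').1 hx
      · push Not at hone
        obtain ⟨j, hj, hji⟩ := hone
        obtain ⟨T, μ, hTW, hT, hμ⟩ := hsep j i hji
        have hrep : ∀ k, B.repr (T x - μ i • x) k = (μ k - μ i) * B.repr x k := by
          intro k
          have : B.coord k ∘ₗ T = μ k • B.coord k := B.ext fun l => by
            rw [LinearMap.comp_apply, hT, map_smul, LinearMap.smul_apply, B.coord_apply,
              B.repr_self, Finsupp.single_apply]
            split_ifs with hlk
            · rw [hlk]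
            · simp
          have hk := LinearMap.congr_fun this x
          simp only [LinearMap.comp_apply, LinearMap.smul_apply, B.coord_apply, smul_eq_mul] at hk
          rw [map_sub, map_smul, Finsupp.sub_apply, Finsupp.smul_apply, hk, smul_eq_mul, sub_mul]
        refine ih _ ?_ (T x - μ i • x) (W.sub_mem (hTW x hx) (W.smul_mem _ hx)) ?_ rfl
        · rw [← hm]
          refine Finset.card_lt_card ⟨fun k hk => ?_, fun hsub => ?_⟩
          · rw [Finsupp.mem_support_iff, hrep] at hk
            exact Finsupp.mem_support_iff.2 (right_ne_zero_of_mul hk)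
          · have := hsub hi
            rw [Finsupp.mem_support_iff, hrep, sub_self, zero_mul] at this
            exact this rfl
        · intro h
          have := hrep j
          rw [h, map_zero, Finsupp.zero_apply, eq_comm, mul_eq_zero, sub_eq_zero] at this
          exact this.elim hμ (Finsupp.mem_support_iff.1 hj)
  obtain ⟨x, hx, hx0⟩ := (Submodule.ne_bot_iff W).1 hW
  exact key _ x hx hx0 rfl

end Separation

/-! ### Irreducibility -/

section Irreducibility

variable {N₀ : ℕ} {q : QParam} {c : ℝ≥0∞} {ε : ℤˣ}
  {D : Type*} [NormedAddCommGroup D] [InnerProductSpace ℂ D] {v : SpinIndex N₀ → D}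
  {π : StarRep q c D}

theorem IsLadder.F_E_vec {q : ℝ} {E F K : Module.End ℂ D} (hL : IsLadder q v E F K) (n k : ℤ) :
    F (E (vec v n k)) = ((eCoef q (N₀ + 2 * n) k ^ 2 : ℝ) : ℂ) • vec v n k := by
  rw [hL.E_vec, map_smul, hL.F_vec, fCoef_add_one, add_sub_cancel_right, smul_smul, sq,
    Complex.ofReal_mul]

/-- `E` and `F` have nonzero coefficients inside a multiplet, so one vector generates all of it;
outside the range `vec` is zero. -/
theorem IsLadder.vec_mem {q : ℝ} (h0 : 0 < q) (h1 : q < 1) {E F K : Module.End ℂ D}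
    (hL : IsLadder q v E F K) {W : Submodule ℂ D} (hE : ∀ x ∈ W, E x ∈ W)
    (hF : ∀ x ∈ W, F x ∈ W) {n k : ℤ} (h : IsLabel N₀ n k) (hW : vec v n k ∈ W) (k' : ℤ) :
    vec v n k' ∈ W := by
  obtain ⟨hn, hk, hkN⟩ := h
  have up : ∀ m : ℕ, vec v n (k + m) ∈ W := by
    intro m
    induction m with
    | zero => simpa using hW
    | succ m ih =>
      by_cases hm : k + m < N₀ + 2 * n
      · have h := hE _ ih
        have he : (eCoef q (N₀ + 2 * n) (k + m) : ℂ) ≠ 0 := by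
          exact_mod_cast eCoef_ne_zero h0 h1 (by omega) hm
        rw [hL.E_vec, W.smul_mem_iff he] at h
        push_cast
        rwa [← add_assoc]
      · rw [vec_eq_zero v fun h => hm (by have := h.2.2; push_cast at this; omega)]
        exact W.zero_mem
  have down : ∀ m : ℕ, vec v n (k - m) ∈ W := by
    intro m
    induction m with
    | zero => simpa using hW
    | succ m ih =>
      by_cases hm : 0 < k - m
      · have h := hF _ ih
        have he : (fCoef q (N₀ + 2 * n) (k - m) : ℂ) ≠ 0 := by
          rw [← eCoef_sub_one]
          exact_mod_cast eCoef_ne_zero h0 h1 (by omega) (by omega)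
        rw [hL.F_vec, W.smul_mem_iff he] at h
        push_cast
        rwa [← sub_sub]
      · rw [vec_eq_zero v fun h => hm (by have := h.2.1; push_cast at this; omega)]
        exact W.zero_mem
  rcases le_total k k' with hk' | hk'
  · obtain ⟨m, rfl⟩ := Int.le.dest hk'
    exact up m
  · obtain ⟨m, hm⟩ := Int.le.dest hk'
    rw [show k' = k - m by omega]
    exact down m

/-- The commuting diagonal operators `K` and `FE` force a basis vector into the subspace; then `E,
F` fill its multiplet and `x_1` reaches the neighbouring ones because `α⁺ ≠ 0`. -/
theorem irreducible_of_hasFormulas (hπ : IsSpinSum N₀ π v) (hf : HasFormulas N₀ ε π v)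
    (hs : Spans v) : π.Irreducible := by
  have h0 : (0 : ℝ) < q := q.2.1
  have h1 : (q : ℝ) < 1 := q.2.2
  obtain ⟨hv, hL⟩ := isSpinSum_iff.1 hπ
  have hT := hasFormulas_iff.1 hf
  refine ⟨⟨v ⟨0, 0⟩, 0, hv.ne_zero _⟩, fun W hW => or_iff_not_imp_left.2 fun hne => ?_⟩
  have hE : ∀ x ∈ W, π.op .E x ∈ W := hW _
  have hF : ∀ x ∈ W, π.op .F x ∈ W := hW _
  let B := Module.Basis.mk hv.linearIndependent hs.ge
  have hB : ⇑B = v := Module.Basis.coe_mk _ _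
  obtain ⟨⟨n, k⟩, hnk⟩ := exists_basis_mem B hne (by
    rintro ⟨n, k⟩ ⟨n', k'⟩ hij
    have hij' : ¬ ((n : ℤ) = n' ∧ (k : ℤ) = k') := by
      rintro ⟨h1, h2⟩
      have h1 : n = n' := by exact_mod_cast h1
      subst h1
      exact hij (by rw [Fin.ext (by exact_mod_cast h2 : (k : ℕ) = k')])
    rcases wt_ne_or_eCoef_sq_ne h0 h1 (isLabel_natCast n k) (isLabel_natCast n' k') hij' with h | h
    · refine ⟨π.op .K, fun i => wt q (N₀ + 2 * i.1) i.2, hW _, fun i => ?_,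
        fun e => h (Complex.ofReal_injective e)⟩
      rw [hB, ← vec_natCast v i.1 i.2, hL.K_vec]
    · refine ⟨π.op .F * π.op .E, fun i => ((eCoef q (N₀ + 2 * i.1) i.2 ^ 2 : ℝ) : ℂ),
        fun x hx => hF _ (hE x hx), fun i => ?_,
        fun e => h (Complex.ofReal_injective e)⟩
      rw [hB, ← vec_natCast v i.1 i.2, Module.End.mul_apply, hL.F_E_vec])
  rw [hB, ← vec_natCast v n k] at hnk
  have level : ∀ {n k : ℤ}, IsLabel N₀ n k → vec v n k ∈ W → ∀ k', vec v n k' ∈ W :=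
    fun h hk => hL.vec_mem h0 h1 hE hF h hk
  have hup : ∀ n : ℤ, 0 ≤ n → (∀ k, vec v n k ∈ W) → ∀ k, vec v (n + 1) k ∈ W := by
    intro n hn h
    have ha : alphaSeq q c ε N₀ n ≠ 0 := by
      rw [alphaSeq]; exact_mod_cast (alphaCoef_pos q c ε N₀ hn).ne'
    have hx := hW (xPlus q c) _ (h (N₀ + 2 * n))
    rw [hT.plus_vec, plusVec_top h0 h1 _ _ _ _ hn, W.smul_mem_iff ha] at hx
    exact level ⟨by omega, by omega, by omega⟩ hx
  -- Applied to a lowest weight vector, `x_1` also has components of spin `l + 1` and `l`; these are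
  -- already in `W` by `hup` and `h`, so the component of spin `l - 1` is too.
  have hdown : ∀ n : ℤ, 0 ≤ n → (∀ k, vec v (n + 1) k ∈ W) → ∀ k, vec v n k ∈ W := by
    intro n hn h
    have ha : ((downPlus q (N₀ + 2 * (n + 1)) 0 : ℂ) * alphaSeq q c ε N₀ (n + 1 - 1)) ≠ 0 := by
      rw [downPlus_zero h0 h1 (by omega), add_sub_cancel_right, alphaSeq]
      exact_mod_cast mul_ne_zero h0.ne' (alphaCoef_pos q c ε N₀ hn).ne'
    have hx := hW (xPlus q c) _ (h 0)
    rw [hT.plus_vec, plusVec, W.sub_mem_iff_right (W.sub_mem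
      (W.smul_mem _ (hup _ (by omega) h _)) (W.smul_mem _ (h _))), W.smul_mem_iff ha,
      add_sub_cancel_right] at hx
    exact level ⟨by omega, by omega, by omega⟩ hx
  have hn := level (isLabel_natCast n k) hnk
  have descend : ∀ d m : ℕ, (∀ k, vec v (m + d : ℕ) k ∈ W) → ∀ k, vec v m k ∈ W := by
    intro d m h
    induction d with
    | zero => exact h
    | succ d ih => exact ih (hdown _ (by omega) (by exact_mod_cast h))
  have all : ∀ m : ℕ, ∀ k, vec v m k ∈ W := by
    intro m
    rcases le_total n m with h | h
    · induction m, h using Nat.le_induction with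
      | base => exact hn
      | succ m _ ih => exact_mod_cast hup m (by omega) ih
    · obtain ⟨d, rfl⟩ := Nat.exists_eq_add_of_le h
      exact descend d m hn
  rw [eq_top_iff, ← show Submodule.span ℂ (Set.range v) = ⊤ from hs, Submodule.span_le]
  rintro _ ⟨⟨m, k⟩, rfl⟩
  rw [← vec_natCast v m k]
  exact all m k

end Irreducibility

/-! ### Inequivalence of the two signs -/

section Inequivalence

variable {N₀ : ℕ} {q : QParam} {c : ℝ≥0∞}
  {D : Type*} [NormedAddCommGroup D] [InnerProductSpace ℂ D] {v : SpinIndex N₀ → D}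

/-- A joint eigenvector of `K` and `FE` is a multiple of a vector `v^l_j`. -/
theorem IsLadder.eq_smul_vec {q : ℝ} (h0 : 0 < q) (h1 : q < 1) {E F K : Module.End ℂ D}
    (hL : IsLadder q v E F K) (hv : Orthonormal ℂ v) (hd : SpansDense v) (aF : IsAdj F E)
    (aK : IsAdj K K) {n k : ℤ} (h : IsLabel N₀ n k) {u : D}
    (hK : K u = (wt q (N₀ + 2 * n) k : ℂ) • u)
    (hFE : F (E u) = ((eCoef q (N₀ + 2 * n) k ^ 2 : ℝ) : ℂ) • u) :
    u = ⟪vec v n k, u⟫_ℂ • vec v n k := by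
  rw [← sub_eq_zero]
  refine eq_zero_of_inner_vec hd fun n' k' h' => ?_
  rw [inner_sub_right, inner_smul_right, inner_vec hv h']
  by_cases he : n' = n ∧ k' = k
  · obtain ⟨rfl, rfl⟩ := he
    simp
  · rw [if_neg he, mul_zero, sub_zero]
    have e1 := aK (vec v n' k') u
    have e2 := (aF.mul aF.symm) (vec v n' k') u
    rw [Module.End.mul_apply, hL.F_E_vec, Module.End.mul_apply, hFE, inner_smul_left,
      inner_smul_right, Complex.conj_ofReal] at e2
    rw [hL.K_vec, hK, inner_smul_left, inner_smul_right, Complex.conj_ofReal] at e1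
    by_contra hne
    have e1' := Complex.ofReal_injective (mul_right_cancel₀ hne e1)
    have e2' := Complex.ofReal_injective (mul_right_cancel₀ hne e2)
    rcases wt_ne_or_eCoef_sq_ne h0 h1 h' h he with hw | hw
    · exact hw e1'
    · exact hw e2'

/-- By `gammaCoef_sub_one_eq` equal values would give equal `γ(-1)`, that is, `[N₀] ρ = -[N₀] ρ`,
although both factors are positive. -/
theorem betaCoef_one_ne_neg_one (q : QParam) (c : ℝ≥0∞) (hN : 0 < N₀) :
    betaCoef q c 1 N₀ 0 ≠ betaCoef q c (-1) N₀ 0 := by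
  intro h
  have h0 : (0 : ℝ) < q := q.2.1
  have h1 : (q : ℝ) < 1 := q.2.2
  have p2 := qint_pos h0 h1 (m := 2) (by omega)
  have pN := qint_pos h0 h1 (m := N₀) (by omega)
  have e1 := gammaCoef_sub_one_eq q c 1 N₀ le_rfl
  rw [h, ← gammaCoef_sub_one_eq q c (-1) N₀ le_rfl] at e1
  have e2 := mul_left_cancel₀ (mul_pos h0 p2).ne' e1
  have e3 : qint q N₀ * discr c = qint q N₀ * -discr c := by
    simpa [gammaCoef, sgnDiscr, qint_zero] using e2
  have e4 := mul_left_cancel₀ pN.ne' e3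
  have := discr_pos c
  linarith

/-- For `l₀ > 0` the representations with different signs are not equivalent. -/
theorem not_unitarilyEquiv {π π' : StarRep q c D} (hN : 0 < N₀) (hs : Spans v)
    (hπ : IsSpinSum N₀ π v) (hf : HasFormulas N₀ 1 π v)
    (hπ' : IsSpinSum N₀ π' v) (hf' : HasFormulas N₀ (-1) π' v) : ¬ π.UnitarilyEquiv π' := by
  rintro ⟨U, hU⟩
  have h0 : (0 : ℝ) < q := q.2.1
  have h1 : (q : ℝ) < 1 := q.2.2
  obtain ⟨hv, hL⟩ := isSpinSum_iff.1 hπ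
  obtain ⟨-, hL'⟩ := isSpinSum_iff.1 hπ'
  have hT := hasFormulas_iff.1 hf
  have hT' := hasFormulas_iff.1 hf'
  have hl : IsLabel N₀ 0 (N₀ + 2 * 0) := ⟨by omega, by omega, by omega⟩
  -- `U` preserves the eigenvalues of `K` and `FE`, and these characterise `v^{l₀}_{l₀}` up to a
  -- scalar, necessarily of modulus one. Hence the diagonal entry of `x_0` at this vector is an
  -- invariant.
  have hu := hL'.eq_smul_vec h0 h1 hv hs.dense (π'.isAdj_op .F) (π'.isAdj_op .K) hl
    (u := U (vec v 0 (N₀ + 2 * 0)))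
    (by rw [StarRep.op, ← hU, ← StarRep.op, hL.K_vec, map_smul])
    (by rw [StarRep.op, StarRep.op, ← hU, ← hU, ← StarRep.op, ← StarRep.op, hL.F_E_vec, map_smul])
  set w := vec v 0 (N₀ + 2 * 0) with hw
  set z := ⟪w, U w⟫_ℂ with hz
  have hww : ⟪w, w⟫_ℂ = 1 := by rw [hw, inner_vec hv hl, if_pos ⟨rfl, rfl⟩]
  have hzz : starRingEnd ℂ z * z = 1 := by
    have := U.inner_map_map w w
    rwa [hu, inner_smul_left, inner_smul_right, hww, mul_one] at this
  have key : ∀ {ε : ℤˣ} {π : StarRep q c D}, HasSeqForm q (alphaSeq q c ε N₀) (betaSeq q c ε N₀)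
      (fun n => alphaSeq q c ε N₀ (n - 1)) v (π.toHom (xPlus q c)) (π.toHom (xZero q c))
      (π.toHom (xMinus q c)) → ⟪w, π.toHom (xZero q c) w⟫_ℂ = betaSeq q c ε N₀ 0 := by
    intro ε π hT
    rw [hw, hT.zero_vec, zeroVec_top, inner_add_right, inner_smul_right, inner_smul_right,
      inner_vec hv hl, inner_vec hv hl, if_neg (by omega), if_pos ⟨rfl, rfl⟩, mul_zero, mul_one,
      zero_add]
  have e := U.inner_map_map w (π.toHom (xZero q c) w)
  rw [hU, hu, map_smul, inner_smul_left, inner_smul_right, key hT, key hT', ← mul_assoc, hzz,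
    one_mul] at e
  exact betaCoef_one_ne_neg_one q c hN (Complex.ofReal_injective e).symm

end Inequivalence

/-! ### The Heisenberg representation -/

section Heisenberg

variable {q : QParam} {c : ℝ≥0∞} {ε : ℤˣ}
  {D : Type*} [NormedAddCommGroup D] [InnerProductSpace ℂ D] {v : SpinIndex 0 → D}
  {π : StarRep q c D}

theorem gen_mem_podles {g : Gen} (hg : ¬ IsUGen g) : gen q c g ∈ podles q c := by
  refine Algebra.subset_adjoin ?_
  cases g <;> simp_all [IsUGen]

/-- The orbit map of a vector under the Podles sphere. -/
def orbitMap (π : StarRep q c D) (w : D) : podles q c →ₗ[ℂ] D :=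
  (LinearMap.applyₗ w) ∘ₗ π.toHom.toLinearMap ∘ₗ (podles q c).val.toLinearMap

theorem orbitMap_apply (π : StarRep q c D) (w : D) (x : podles q c) :
    orbitMap π w x = π.toHom x w := rfl

/-- The vector state of a vector. -/
def vectorState (π : StarRep q c D) (w : D) : podles q c →ₗ[ℂ] ℂ :=
  ((innerSL ℂ w : D →L[ℂ] ℂ) : D →ₗ[ℂ] ℂ) ∘ₗ orbitMap π w

theorem vectorState_apply (π : StarRep q c D) (w : D) (x : podles q c) :
    vectorState π w x = ⟪w, π.toHom x w⟫_ℂ := rfl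

/-- An irreducible representation with an invariant vector is the Heisenberg representation. -/
theorem isHeisenberg_of_invariant (hirr : π.Irreducible) {w : D} (hw : ⟪w, w⟫_ℂ = 1)
    (hE : π.op .E w = 0) (hF : π.op .F w = 0) (hK : π.op .K w = w) : π.IsHeisenberg := by
  have hKi : π.op .Ki w = w := by
    nth_rewrite 1 [← hK]
    exact π.op_Ki_K w
  -- `E` and `F` annihilate `w`, while `K` and `K⁻¹` fix it. Of `f₍₁₎ x S(f₍₂₎) w` only `f x w`
  -- survives.
  have hact : ∀ g, IsUGen g → ∀ y, π.op g (orbitMap π w y) = orbitMap π w (act g y) := by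
    intro g hg y
    rw [orbitMap_apply, orbitMap_apply, act]
    simp only [StarRep.op] at hE hF hK hKi ⊢
    cases g <;> simp only [IsUGen] at hg <;>
      simp only [adj, map_sub, map_smul, map_mul, LinearMap.sub_apply, LinearMap.smul_apply,
        Module.End.mul_apply, hE, hF, hK, hKi, map_zero, smul_zero, sub_zero]
  have hmul : ∀ x y : podles q c, π.toHom x (orbitMap π w y) = orbitMap π w (x * y) := by
    intro x y
    rw [orbitMap_apply, orbitMap_apply, Subalgebra.coe_mul, map_mul, Module.End.mul_apply]
  -- The orbit of `w` under the sphere alone is already invariant under the whole algebra, so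
  -- irreducibility makes the orbit map surjective.
  have hinv : ∀ (a : CrossAlg q c), ∀ x ∈ LinearMap.range (orbitMap π w),
      π.toHom a x ∈ LinearMap.range (orbitMap π w) := by
    intro a
    induction a using crossAlg_induction with
    | hg g =>
      rintro _ ⟨y, rfl⟩
      by_cases hg : IsUGen g
      · exact ⟨_, (hact g hg y).symm⟩
      · exact ⟨_, (hmul ⟨_, gen_mem_podles hg⟩ y).symm⟩
    | h1 => intro x hx; simpa using hx
    | hadd a b ha hb =>
      intro x hx
      rw [map_add]
      exact Submodule.add_mem _ (ha x hx) (hb x hx)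
    | hmul a b ha hb =>
      intro x hx
      rw [map_mul]
      exact ha _ (hb x hx)
    | hsmul z a ha =>
      intro x hx
      rw [map_smul]
      exact Submodule.smul_mem _ z (ha x hx)
  refine ⟨vectorState π w, orbitMap π w, ⟨?_, fun x => ?_, fun g hg x => ?_⟩, ?_, fun x y => ?_,
    hmul, hact⟩
  · rw [vectorState_apply, Subalgebra.coe_one, map_one, Module.End.one_apply, hw]
  · have : vectorState π w (pstar x * x) = ⟪π.toHom x w, π.toHom x w⟫_ℂ := by
      rw [vectorState_apply, Subalgebra.coe_mul, map_mul, Module.End.mul_apply, pstar,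
        π.inner_star]
    rw [this]
    exact ⟨inner_self_nonneg (𝕜 := ℂ), inner_self_im (𝕜 := ℂ) _⟩
  · change ⟪w, orbitMap π w (act g x)⟫_ℂ = counit g * ⟪w, orbitMap π w x⟫_ℂ
    rw [← hact g hg, ← (π.isAdj_op g).symm w]
    cases g <;> simp only [IsUGen] at hg <;>
      simp only [starGen, counit, hE, hF, hK, hKi, inner_zero_left, zero_mul, one_mul]
  · rw [← LinearMap.range_eq_top]
    refine (hirr.2 _ hinv).resolve_left fun h => ?_
    have hmem : orbitMap π w 1 ∈ LinearMap.range (orbitMap π w) := ⟨1, rfl⟩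
    rw [h, Submodule.mem_bot, orbitMap_apply, Subalgebra.coe_one, map_one,
      Module.End.one_apply] at hmem
    rw [hmem, inner_zero_left] at hw
    exact zero_ne_one hw
  · rw [vectorState_apply, Subalgebra.coe_mul, map_mul, Module.End.mul_apply, pstar,
      orbitMap_apply, orbitMap_apply, π.inner_star]

/-- The vector `v^0_0` spans the trivial representation contained in the sum for `l₀ = 0`. -/
theorem isHeisenberg_of_hasFormulas (hπ : IsSpinSum 0 π v) (hf : HasFormulas 0 ε π v)
    (hs : Spans v) : π.IsHeisenberg := by
  obtain ⟨hv, hL⟩ := isSpinSum_iff.1 hπ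
  refine isHeisenberg_of_invariant (irreducible_of_hasFormulas hπ hf hs) (w := vec v 0 0) ?_ ?_ ?_ ?_
  · rw [inner_vec hv ⟨by omega, by omega, by omega⟩, if_pos ⟨rfl, rfl⟩]
  · rw [hL.E_vec, vec_eq_zero v (fun h => by have := h.2.2; omega), smul_zero]
  · rw [hL.F_vec, vec_eq_zero v (fun h => by have := h.2.1; omega), smul_zero]
  · rw [hL.K_vec]
    simp [wt]

end Heisenberg

/-! ### Change of phases in the spin sum -/

section Phases

variable {N₀ : ℕ} {q : QParam} {c : ℝ≥0∞}
  {D : Type*} [NormedAddCommGroup D] [InnerProductSpace ℂ D] {v : SpinIndex N₀ → D}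
  {π : StarRep q c D} {θ : ℕ → ℂ}

theorem IsSpinSum.phase (hπ : IsSpinSum N₀ π v) (hθ : ∀ n, ‖θ n‖ = 1) :
    IsSpinSum N₀ π fun i => θ i.1 • v i := by
  obtain ⟨hv, hE, hF, hK⟩ := isSpinSum_iff.1 hπ
  refine isSpinSum_iff.2 ⟨orthonormal_phase hθ hv, ?_, ?_, ?_⟩ <;> intro n k
  · rw [vec_smul, vec_smul, map_smul, hE, smul_comm]
  · rw [vec_smul, vec_smul, map_smul, hF, smul_comm]
  · rw [vec_smul, map_smul, hK, smul_comm]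

theorem Spans.phase (hs : Spans v) (hθ : ∀ n, ‖θ n‖ = 1) :
    Spans fun i : SpinIndex N₀ => θ i.1 • v i := by
  rw [Spans, eq_top_iff, ← show Submodule.span ℂ (Set.range v) = ⊤ from hs, Submodule.span_le]
  rintro _ ⟨i, rfl⟩
  have h : θ i.1 ≠ 0 := fun h => by
    have := hθ i.1
    rw [h, norm_zero] at this
    exact zero_ne_one this
  exact (Submodule.smul_mem_iff _ h).1 (Submodule.subset_span ⟨i, rfl⟩)

end Phases

end PodlesCross

end

/-! ### The main theorem -/

theorem mainTheorem1 (q : PodlesCross.QParam) (c : ENNReal) (N₀ : ℕ) :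
    -- existence and exhaustion: the representations with signs `+` and `-`
    (∃ (D : Type) (_ : NormedAddCommGroup D) (_ : InnerProductSpace ℂ D)
      (v : PodlesCross.SpinIndex N₀ → D) (π : ℤˣ → PodlesCross.StarRep q c D),
      PodlesCross.Spans v ∧
      (∀ ε, PodlesCross.IsSpinSum N₀ (π ε) v ∧ PodlesCross.HasFormulas N₀ ε (π ε) v ∧
        (π ε).Irreducible) ∧
      (0 < N₀ → ¬ (π 1).UnitarilyEquiv (π (-1))) ∧
      (N₀ = 0 → π 1 = π (-1) ∧ (π 1).IsHeisenberg) ∧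
      (∀ (D' : Type*) [NormedAddCommGroup D'] [InnerProductSpace ℂ D']
        (π' : PodlesCross.StarRep q c D'), PodlesCross.RestrictsToSpinSum N₀ π' →
          ∃ ε, π'.UnitarilyEquiv (π ε))) ∧
    -- the formulas hold for every choice of the domain, after a change of phases
    (∀ (D' : Type*) [NormedAddCommGroup D'] [InnerProductSpace ℂ D']
      (π' : PodlesCross.StarRep q c D') (v' : PodlesCross.SpinIndex N₀ → D'),
      PodlesCross.IsSpinSum N₀ π' v' → PodlesCross.SpansDense v' →
        ∃ (ε : ℤˣ) (θ : ℕ → ℂ), (∀ n, ‖θ n‖ = 1) ∧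
          PodlesCross.HasFormulas N₀ ε π' (fun i => θ i.1 • v' i)) := by
  open PodlesCross in
  refine ⟨?_, fun D' _ _ π' v' h hd => exists_phase_hasFormulas π' h hd⟩
  obtain ⟨D, i1, i2, v, hv, hs⟩ := exists_orthonormal_spans N₀
  choose π hπ hf using fun ε => exists_hasFormulas q c ε hv hs
  have hirr := fun ε => irreducible_of_hasFormulas (hπ ε) (hf ε) hs
  refine ⟨D, i1, i2, v, π, hs, fun ε => ⟨hπ ε, hf ε, hirr ε⟩,
    fun hN => not_unitarilyEquiv hN hs (hπ 1) (hf 1) (hπ (-1)) (hf (-1)), ?_, ?_⟩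
  · rintro rfl
    refine ⟨StarRep.ext (AlgHom.ext fun a => LinearMap.ext fun x => ?_),
      isHeisenberg_of_hasFormulas (hπ 1) (hf 1) hs⟩
    -- For `l₀ = 0` both signs have the same formulas on the same vectors, so the identity map
    -- intertwines and the representations are equal, not merely equivalent.
    exact intertwines (hπ 1) (hf 1) hs (hπ (-1)) ((hf (-1)).of_zero 1) LinearMap.id
      (fun i => rfl) a x
  · rintro D' _ _ π' ⟨v', hv', hs'⟩
    obtain ⟨ε, θ, hθ, hf'⟩ := exists_phase_hasFormulas π' hv' hs'.dense
    exact ⟨ε, unitarilyEquiv_of_hasFormulas (hv'.phase hθ) hf' (hs'.phase hθ) (hπ ε) (hf ε) hs⟩
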